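/- Let $\zeta(s)$ be the Riemann zeta function, and write its zeros as $\rho=\beta+i\gamma$. For real $b$ and $T>1$ let $$B_b=B_b(T):=\Big\{\sigma+it : \tfrac12-\tfrac{b}{2\log T}<\sigma<\tfrac12+\tfrac{b}{2\log T},\ T<t\le 2T\Big\}.$$ Let $N(B_b)$, $N_s(B_b)$, $N_0(B_b)$ and $N_0^s(B_b)$ denote, respectively, the number of zeros of $\zeta$ in $B_b$, of zeros in $B_b$ that are simple, of zeros in $B_b$ that lie on the critical line $\operatorname{Re}s=\tfrac12$, and of zeros in $B_b$ that are both simple and on the critical line. All zeros, here and in the sums below, are counted with multiplicity. Let $b=b(T)$ be a real-valued function with $b(T)\to0$ as $T\to\infty$, and assume that for all sufficiently large $T$ every zero $\rho=\beta+i\gamma$ of $\zeta$ with $T<\gamma\le 2T$ lies in $B_{b(T)}(T)$. Then, as $T\to\infty$, with $b=b(T)$, $$N_s(B_b)=\sum_{\substack{T<\gamma\le2T\\ \rho\ \text{simple}}}1\ \ge\ \Big(\tfrac23+o(1)\Big)\sum_{T<\gamma\le2T}1=\Big(\tfrac23+o(1)\Big)N(B_b),$$ $$N_0(B_b)=\sum_{\substack{T<\gamma\le2T\\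 \beta=1/2}}1\ \ge\ \Big(\tfrac23+o(1)\Big)\sum_{T<\gamma\le2T}1=\Big(\tfrac23+o(1)\Big)N(B_b),$$ $$N_0^s(B_b)=\sum_{\substack{T<\gamma\le2T\\ \beta=1/2,\ \rho\ \text{simple}}}1\ \ge\ \Big(\tfrac13+o(1)\Big)\sum_{T<\gamma\le2T}1=\Big(\tfrac13+o(1)\Big)N(B_b).$$ -/

import Mathlib

open Filter Topology

/-- The multiplicity `m_ρ` of `ρ` as a zero of the Riemann zeta function: its order of vanishing. -/
noncomputable def zetaMult (ρ : ℂ) : ℕ := analyticOrderNatAt riemannZeta ρ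

/-- The number of zeros of the Riemann zeta function in `S`, counted with multiplicity.
The sum is over finitely many zeros for each of the sets `zetaStrip T`, `thinBox b T` with `T > 0`
and their subsets, see `zetaStrip_zeros_finite` and `thinBox_subset_zetaStrip`. -/
noncomputable def zetaZeroCount (S : Set ℂ) : ℕ :=
  ∑ᶠ ρ ∈ S ∩ riemannZetaZeros, zetaMult ρ

/-- The horizontal strip `T < t ≤ 2T`, where `s = σ + it`. -/
def zetaStrip (T : ℝ) : Set ℂ := {s | T < s.im ∧ s.im ≤ 2 * T}

/-- The thin vertical box `B_b` (at height `T`) centered on the critical line. -/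
noncomputable def thinBox (b T : ℝ) : Set ℂ :=
  {s | 1 / 2 - b / (2 * Real.log T) < s.re ∧ s.re < 1 / 2 + b / (2 * Real.log T) ∧
    T < s.im ∧ s.im ≤ 2 * T}

/-- The simple zeros of the Riemann zeta function. -/
def simpleZetaZeros : Set ℂ := {s | riemannZeta s = 0 ∧ zetaMult s = 1}

/-- The critical line `Re s = 1/2`. -/
def criticalLine : Set ℂ := {s | s.re = 1 / 2}

theorem thinBox_subset_zetaStrip (b T : ℝ) : thinBox b T ⊆ zetaStrip T :=
  fun _ hs => hs.2.2

theorem re_mem_of_zetaZero {s : ℂ} (h0 : riemannZeta s = 0) (him : s.im ≠ 0) :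
    0 < s.re ∧ s.re < 1 := by
  have h1 : s.re < 1 := by
    by_contra! h
    exact riemannZeta_ne_zero_of_one_le_re h h0
  refine ⟨?_, h1⟩
  by_contra! h
  have hre : 1 ≤ (1 - s).re := by simp; linarith
  have himn : (1 - s).im ≠ 0 := by simpa using him
  have hn : ∀ n : ℕ, 1 - s ≠ -(n : ℂ) := by
    intro n hn
    apply himn
    rw [hn]
    simp
  have hne1 : 1 - s ≠ 1 := by
    intro h'
    apply himn
    rw [h']
    simp
  have key := riemannZeta_one_sub hn hne1
  rw [sub_sub_cancel, h0] at key
  have hG : Complex.Gamma (1 - s) ≠ 0 := Complex.Gamma_ne_zero_of_re_pos (by linarith)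
  have hz : riemannZeta (1 - s) ≠ 0 := riemannZeta_ne_zero_of_one_le_re hre
  have hc : Complex.cos (Real.pi * (1 - s) / 2) ≠ 0 := by
    rw [Complex.cos_ne_zero_iff]
    intro k hk
    apply himn
    have hpi : (Real.pi : ℂ) ≠ 0 := by exact_mod_cast Real.pi_ne_zero
    have : 1 - s = ((2 * k + 1 : ℤ) : ℂ) := by
      push_cast
      have := congrArg (fun z : ℂ => 2 * z / Real.pi) hk
      field_simp at this
      linear_combination this
    rw [this]
    exact Complex.intCast_im _
  have hp : (2 * (Real.pi : ℂ)) ^ (-(1 - s)) ≠ 0 := by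
    rw [Complex.cpow_ne_zero_iff]
    left
    exact_mod_cast (by positivity : 2 * Real.pi ≠ 0)
  exact mul_ne_zero (mul_ne_zero (mul_ne_zero (mul_ne_zero two_ne_zero hp) hG) hc) hz key.symm

theorem zetaStrip_zeros_finite {T : ℝ} (hT : 0 < T) :
    (zetaStrip T ∩ riemannZetaZeros).Finite := by
  have hK : IsCompact (Set.Icc (0 : ℝ) 1 ×ℂ Set.Icc T (2 * T)) :=
    isCompact_Icc.reProdIm isCompact_Icc
  refine hK.inter_riemannZetaZeros_finite.subset ?_
  rintro s ⟨⟨h1, h2⟩, h0⟩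
  have h := re_mem_of_zetaZero h0 (by linarith : 0 < s.im).ne'
  exact ⟨⟨⟨h.1.le, h.2.le⟩, ⟨h1.le, h2⟩⟩, h0⟩

/-! ### Entire functions: counting zeros in discs and bounding f'/f from growth. -/

section ComplexAnalysis
open Complex Metric

/-! The proof is Montgomery's pair correlation argument, applied to pairs of zeros with equal
ordinates. Let m(ρ) be the multiplicity, and let P be the sum of m(ρ)m(ρ') over ordered pairs of
zero points in T < γ ≤ 2T with γ = γ', the case ρ = ρ' included. The reflection ρ ↦ 1 - conj ρ
preserves ordinates, so a zero that is multiple or off the line has total multiplicity at least 2 at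
its ordinate. Hence 2N ≤ N_0^s + P, and P ≤ (4/3 + o(1))N gives N_0^s ≥ (2/3 + o(1))N. This single
bound implies all three claims, the last one with 2/3 in place of 1/3.

To bound P, fix a height Y, put L = log Y, Δ = Y/L, and for T between Y/2 and 3Y form M(x) = Σ m(ρ)
exp(-(γ-T)²/Δ²) exp(ixγ). The weight 1 - x/X on [0, X] has a nonnegative cosine transform with value
X/2 at 0 (Fejér), so X/2 times the weighted version of P is at most the weighted mean square of M
over [0, X] (`half_mul_sum_diag_le`).

For the upper bound, the explicit formula (`tsum_stripMult_gaussTest`) turns the sum over zeros into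
L ĝ(x) - Σ Λ(n) n^(-1/2) ĝ(x - log n) plus small terms, where ĝ is a bump of width about 1/Δ. With X
= θL and θ < 1 the relevant points log n are separated by much more than 1/Δ, so the bumps hardly
interact (`norm_sq_sum_dirCoeff_le`) and the diagonal alone remains: π√(2π) Δ (L²/2 + X²/6). Here
L²/2 comes from the half bump at 0 and X²/6 from Mertens' theorem. As θ → 1 this is 1/2 + 1/6 = 2/3
times π√(2π) Δ L², which becomes 4/3 after division by X/2.

The hypothesis replaces the Riemann hypothesis. The explicit formula involves exp(x(ρ - 1/2)), not
exp(ixγ); when |β - 1/2| L ≤ δ the coefficients differ by a relative O(δ), and the majorant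
principle for the Fejér weight (`integral_fejer_trigPoly_le`, `integral_fejer_trigPoly_twist_le`)
bounds the mean square of the difference by O(δ²) times that of M itself, so it can be absorbed.

Integrating over the centre T removes the Gaussian weights, and the explicit formula at x = 0
supplies the lower bound N ≥ (1 - o(1)) Y log Y / 2π against which P is compared. -/

theorem exists_eq_pow_mul_of_differentiable {f : ℂ → ℂ} (hf : Differentiable ℂ f) {c : ℂ}
    (hc : f c ≠ 0) (ρ : ℂ) :
    ∃ g : ℂ → ℂ, Differentiable ℂ g ∧ g ρ ≠ 0 ∧
      ∀ s, f s = (s - ρ) ^ analyticOrderNatAt f ρ * g s := by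
  have hA : AnalyticOnNhd ℂ f Set.univ := fun z _ => hf.analyticAt z
  have htop : analyticOrderAt f ρ ≠ ⊤ := by
    refine hA.analyticOrderAt_ne_top_of_isPreconnected (x := c) isPreconnected_univ
      (Set.mem_univ _) (Set.mem_univ _) ?_
    rw [(hf.analyticAt c).analyticOrderAt_eq_zero.2 hc]
    exact ENat.zero_ne_top
  obtain ⟨h, hh, hh0, hev⟩ :=
    ((hf.analyticAt ρ).analyticOrderNatAt_eq_iff htop (n := analyticOrderNatAt f ρ)).1 rfl
  set n := analyticOrderNatAt f ρ
  set g : ℂ → ℂ := Function.update (fun s => f s / (s - ρ) ^ n) ρ (h ρ) with hg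
  have hgρ : g ρ = h ρ := by simp [hg]
  have hgs : ∀ s, s ≠ ρ → g s = f s / (s - ρ) ^ n := fun s hs => by simp [hg, hs]
  refine ⟨g, fun s => ?_, by rwa [hgρ], fun s => ?_⟩
  · by_cases hs : s = ρ
    · subst hs
      refine hh.differentiableAt.congr_of_eventuallyEq ?_
      filter_upwards [hev] with z hz
      by_cases hzs : z = s
      · rw [hzs, hgρ]
      · rw [hgs z hzs, hz, smul_eq_mul, mul_div_cancel_left₀]
        exact pow_ne_zero _ (sub_ne_zero.2 hzs)
    · have : (fun s => f s / (s - ρ) ^ n) =ᶠ[𝓝 s] g := by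
        filter_upwards [isOpen_ne.mem_nhds hs] with z hz using (hgs z hz).symm
      refine DifferentiableAt.congr_of_eventuallyEq ?_ this.symm
      exact (hf s).div (by fun_prop) (pow_ne_zero _ (sub_ne_zero.2 hs))
  · by_cases hs : s = ρ
    · subst hs
      rw [hgρ]
      simpa using hev.self_of_nhds
    · rw [hgs s hs, mul_div_cancel₀]
      exact pow_ne_zero _ (sub_ne_zero.2 hs)

theorem exists_eq_prod_mul_of_differentiable {f : ℂ → ℂ} (hf : Differentiable ℂ f) {c : ℂ}
    (hc : f c ≠ 0) (S : Finset ℂ) :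
    ∃ g : ℂ → ℂ, Differentiable ℂ g ∧ (∀ ρ ∈ S, g ρ ≠ 0) ∧
      ∀ s, f s = (∏ ρ ∈ S, (s - ρ) ^ analyticOrderNatAt f ρ) * g s := by
  classical
  induction S using Finset.induction_on with
  | empty => exact ⟨f, hf, by simp, by simp⟩
  | insert a S ha ih =>
    obtain ⟨g, hg, hg0, hfg⟩ := ih
    have hgc : g c ≠ 0 := fun h => hc (by rw [hfg c, h, mul_zero])
    obtain ⟨k, hk, hka, hgk⟩ := exists_eq_pow_mul_of_differentiable hg hgc a
    have hord : analyticOrderNatAt f a = analyticOrderNatAt g a := by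
      have hP : Differentiable ℂ (fun s : ℂ => ∏ ρ ∈ S, (s - ρ) ^ analyticOrderNatAt f ρ) := by
        fun_prop
      have hPa : (∏ ρ ∈ S, (a - ρ) ^ analyticOrderNatAt f ρ) ≠ 0 := by
        refine Finset.prod_ne_zero_iff.2 fun ρ hρ => pow_ne_zero _ (sub_ne_zero.2 ?_)
        rintro rfl
        exact ha hρ
      have h1 : f = (fun s : ℂ => ∏ ρ ∈ S, (s - ρ) ^ analyticOrderNatAt f ρ) * g := funext hfg
      have h2 : analyticOrderAt f a = analyticOrderAt g a := by
        conv_lhs => rw [h1]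
        rw [analyticOrderAt_mul (hP.analyticAt a) (hg.analyticAt a),
          (hP.analyticAt a).analyticOrderAt_eq_zero.2 hPa, zero_add]
      rw [analyticOrderNatAt, h2, analyticOrderNatAt]
    refine ⟨k, hk, ?_, fun s => ?_⟩
    · intro ρ hρ
      rcases Finset.mem_insert.1 hρ with rfl | h
      · exact hka
      · intro h0
        exact hg0 ρ h (by rw [hgk ρ, h0, mul_zero])
    · rw [Finset.prod_insert ha, hfg s, hgk s, hord]
      ring

theorem logDeriv_prod_pow_mul {S : Finset ℂ} {m : ℂ → ℕ} {f g : ℂ → ℂ}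
    (hg : Differentiable ℂ g)
    (hfg : ∀ s, f s = (∏ ρ ∈ S, (s - ρ) ^ m ρ) * g s) {s : ℂ} (hs : ∀ ρ ∈ S, s ≠ ρ)
    (hgs : g s ≠ 0) :
    logDeriv f s = ∑ ρ ∈ S, (m ρ : ℂ) / (s - ρ) + logDeriv g s := by
  have h1 : f = fun s => (fun s => ∏ ρ ∈ S, (s - ρ) ^ m ρ) s * g s := funext hfg
  have h2 : ∀ ρ ∈ S, (s - ρ) ^ m ρ ≠ 0 := fun ρ hρ => pow_ne_zero _ (sub_ne_zero.2 (hs ρ hρ))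
  rw [h1, logDeriv_mul s (Finset.prod_ne_zero_iff.2 h2) hgs (by fun_prop) (hg s)]
  congr 1
  have h3 := logDeriv_prod (s := S) (f := fun ρ s => (s - ρ) ^ m ρ) (x := s) (fun ρ hρ => h2 ρ hρ)
    (fun ρ _ => by fun_prop)
  rw [h3]
  refine Finset.sum_congr rfl fun ρ hρ => ?_
  rw [logDeriv_fun_pow (by fun_prop), logDeriv_apply]
  simp [div_eq_mul_inv]

/-- Dividing out the zeros in the ball of radius `4` by means of the maximum principle on the ball
of radius `12`. -/
theorem norm_cofactor_le {f g : ℂ → ℂ} {c : ℂ} {M : ℝ} {S : Finset ℂ} {m : ℂ → ℕ}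
    (hg : Differentiable ℂ g)
    (hfg : ∀ s, f s = (∏ ρ ∈ S, (s - ρ) ^ m ρ) * g s)
    (hM : ∀ s ∈ closedBall c 12, ‖f s‖ ≤ Real.exp M * ‖f c‖)
    (hS : ∀ ρ ∈ S, ρ ∈ closedBall c 4) {s : ℂ} (hs : s ∈ closedBall c 12) :
    2 ^ (∑ ρ ∈ S, m ρ) * ‖g s‖ ≤ Real.exp M * ‖g c‖ := by
  have hfr : frontier (ball c (12 : ℝ)) = sphere c 12 := frontier_ball c (by norm_num)
  have hcl : closure (ball c (12 : ℝ)) = closedBall c 12 := closure_ball c (by norm_num)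
  set n := ∑ ρ ∈ S, m ρ
  have key : ∀ z ∈ sphere c (12 : ℝ), ‖g z‖ ≤ Real.exp M * ‖g c‖ / 2 ^ n := by
    intro z hz
    have h1 := hM z (sphere_subset_closedBall hz)
    rw [hfg z, hfg c, norm_mul, norm_mul, norm_prod, norm_prod] at h1
    -- On the sphere of radius 12 each factor is at least 12 - 4 = 8, while at the centre it is at
    -- most 4. The quotient is a gain of 2 per zero.
    have h2 : (8 : ℝ) ^ n ≤ ∏ ρ ∈ S, ‖(z - ρ) ^ m ρ‖ := by
      rw [← Finset.prod_pow_eq_pow_sum]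
      refine Finset.prod_le_prod (fun _ _ => by positivity) fun ρ hρ => ?_
      rw [norm_pow]
      refine pow_le_pow_left₀ (by norm_num) ?_ _
      have h3 := mem_closedBall_iff_norm.1 (hS ρ hρ)
      have h4 := mem_sphere_iff_norm.1 hz
      have h5 : ‖z - c‖ ≤ ‖z - ρ‖ + ‖ρ - c‖ := by
        simpa using norm_add_le (z - ρ) (ρ - c)
      linarith
    have h3 : ∏ ρ ∈ S, ‖(c - ρ) ^ m ρ‖ ≤ (4 : ℝ) ^ n := by
      rw [← Finset.prod_pow_eq_pow_sum]
      refine Finset.prod_le_prod (fun _ _ => by positivity) fun ρ hρ => ?_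
      rw [norm_pow, norm_sub_rev]
      exact pow_le_pow_left₀ (norm_nonneg _) (mem_closedBall_iff_norm.1 (hS ρ hρ)) _
    have h4 : (8 : ℝ) ^ n = 4 ^ n * 2 ^ n := by rw [← mul_pow]; norm_num
    rw [le_div_iff₀ (by positivity)]
    have h5 : (8 : ℝ) ^ n * ‖g z‖ ≤ Real.exp M * (4 ^ n * ‖g c‖) :=
      (mul_le_mul_of_nonneg_right h2 (norm_nonneg _)).trans (h1.trans (by gcongr))
    rw [h4] at h5
    have h6 : (4 : ℝ) ^ n * (‖g z‖ * 2 ^ n) ≤ 4 ^ n * (Real.exp M * ‖g c‖) := by linarith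
    exact le_of_mul_le_mul_left h6 (by positivity)
  have h := norm_le_of_forall_mem_frontier_norm_le (isBounded_ball (x := c) (r := 12))
    hg.diffContOnCl (by rwa [hfr]) (by rwa [hcl] : s ∈ closure (ball c (12 : ℝ)))
  rw [le_div_iff₀ (by positivity)] at h
  linarith

/-- A form of Jensen's inequality: in the cofactor bound taken at the centre itself the value of g
cancels, and growth becomes a count of zeros. -/
theorem two_pow_sum_order_le {f : ℂ → ℂ} (hf : Differentiable ℂ f) {c : ℂ} (hc : f c ≠ 0) {M : ℝ}
    (hM : ∀ s ∈ closedBall c 12, ‖f s‖ ≤ Real.exp M * ‖f c‖) {S : Finset ℂ}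
    (hS : ∀ ρ ∈ S, ρ ∈ closedBall c 4) :
    (2 : ℝ) ^ (∑ ρ ∈ S, analyticOrderNatAt f ρ) ≤ Real.exp M := by
  obtain ⟨g, hg, -, hfg⟩ := exists_eq_prod_mul_of_differentiable hf hc S
  have hgc : g c ≠ 0 := fun h => hc (by rw [hfg c, h, mul_zero])
  exact le_of_mul_le_mul_right
    (norm_cofactor_le hg hfg hM hS (mem_closedBall_self (by norm_num))) (norm_pos_iff.2 hgc)

/-- Borel–Carathéodory bound for the logarithmic derivative of a zero-free function. -/
theorem norm_logDeriv_le_of_zero_free {g : ℂ → ℂ} (hg : Differentiable ℂ g) {c : ℂ} {M : ℝ}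
    (hM0 : 0 < M) (hM : ∀ s ∈ ball c 4, ‖g s‖ ≤ Real.exp M * ‖g c‖)
    (hg0 : ∀ s ∈ ball c 4, g s ≠ 0) {s : ℂ} (hs : s ∈ closedBall c 3) :
    ‖logDeriv g s‖ ≤ 28 * M := by
  have hdl : DifferentiableOn ℂ (logDeriv g) (ball c 4) := by
    have : logDeriv g = fun s => deriv g s / g s := rfl
    rw [this]
    exact (hg.contDiff.differentiable_deriv_two).differentiableOn.div hg.differentiableOn hg0
  have hcb : c ∈ ball c (4 : ℝ) := mem_ball_self (by norm_num)
  -- The primitive of g'/g vanishing at c is a logarithm of g/g(c).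
  obtain ⟨h, hh0, hh⟩ := hdl.isExactOn_ball.with_val_at c 0
  have hexp : ∀ z ∈ ball c (4 : ℝ), g z = g c * exp (h z) := by
    have hd : ∀ z ∈ ball c (4 : ℝ), HasDerivAt (fun z => g z * exp (-h z)) 0 z := by
      intro z hz
      have h1 := (hg z).hasDerivAt.mul ((hh z hz).neg.cexp)
      have h2 : deriv g z * exp ((-h) z) + g z * (exp ((-h) z) * -logDeriv g z) = 0 := by
        rw [logDeriv_apply]
        field_simp [hg0 z hz]
        ring
      rw [h2] at h1
      exact h1
    intro z hz
    have := (convex_ball c (4 : ℝ)).is_const_of_fderivWithin_eq_zero (𝕜 := ℂ)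
      (f := fun z => g z * exp (-h z)) (fun z hz => (hd z hz).differentiableAt.differentiableWithinAt)
      (fun z hz => by
        rw [fderivWithin_of_isOpen isOpen_ball hz]
        ext
        simpa using (hd z hz).deriv) hz hcb
    simp only [hh0, neg_zero, exp_zero, mul_one] at this
    rw [← this, mul_assoc, ← exp_add]
    simp
  have hre : ∀ z ∈ ball c (4 : ℝ), (h z).re ≤ M := by
    intro z hz
    have h1 := hM z hz
    rw [hexp z hz, norm_mul, norm_exp, mul_comm] at h1
    exact Real.exp_le_exp.1 (le_of_mul_le_mul_right h1 (norm_pos_iff.2 (hg0 c hcb)))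
  -- Passing from radius 4 to 7/2 gives 2M(7/2)/(1/2) = 14M; Cauchy's estimate on circles of radius
  -- 1/2 then doubles this to 28M.
  have hbound : ∀ z ∈ closedBall c (7 / 2 : ℝ), ‖h z‖ ≤ 14 * M := by
    intro z hz
    have hz' : ‖z - c‖ ≤ 7 / 2 := mem_closedBall_iff_norm.1 hz
    have := borelCaratheodory_zero (f := fun u => h (u + c)) (R := 4) (z := z - c) hM0 ?_ ?_
      (by norm_num) (by simpa using hz'.trans_lt (by norm_num)) (by simpa using hh0)
    · simp only [sub_add_cancel] at this
      refine this.trans ?_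
      rw [div_le_iff₀ (by linarith)]
      nlinarith
    · intro u hu
      have hu' : u + c ∈ ball c (4 : ℝ) := by simpa using hu
      exact ((hh _ hu').comp_add_const u c).differentiableAt.differentiableWithinAt
    · intro u hu
      exact hre _ (by simpa using hu)
  have hs' : s ∈ ball c (4 : ℝ) := closedBall_subset_ball (by norm_num) hs
  rw [← (hh s hs').deriv]
  have hsub : closedBall s (1 / 2 : ℝ) ⊆ closedBall c (7 / 2) :=
    closedBall_subset_closedBall' (by have := mem_closedBall.1 hs; linarith)
  have := norm_deriv_le_of_forall_mem_sphere_norm_le (f := h) (c := s) (R := 1 / 2) (C := 14 * M)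
    (by norm_num) ?_ (fun z hz => hbound z (hsub (sphere_subset_closedBall hz)))
  · linarith
  · refine DifferentiableOn.diffContOnCl fun z hz => ?_
    rw [closure_ball _ (by norm_num)] at hz
    exact (hh z (closedBall_subset_ball (by norm_num) (hsub hz))).differentiableAt.differentiableWithinAt

/-- Landau's local decomposition: after division by the zeros in the ball of radius 4 the cofactor
is zero-free there, and its logarithmic derivative is controlled by growth alone. -/
theorem norm_logDeriv_le_sum_add {f : ℂ → ℂ} (hf : Differentiable ℂ f) {c : ℂ} (hc : f c ≠ 0)
    {M : ℝ} (hM0 : 0 < M)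
    (hM : ∀ s ∈ closedBall c 12, ‖f s‖ ≤ Real.exp M * ‖f c‖) {S : Finset ℂ}
    (hS : ∀ ρ, ρ ∈ S ↔ ρ ∈ closedBall c 4 ∧ f ρ = 0) {s : ℂ} (hs : s ∈ closedBall c 3)
    (hfs : f s ≠ 0) :
    ‖logDeriv f s‖ ≤ ∑ ρ ∈ S, (analyticOrderNatAt f ρ : ℝ) / ‖s - ρ‖ + 28 * M := by
  obtain ⟨g, hg, hg0, hfg⟩ := exists_eq_prod_mul_of_differentiable hf hc S
  have hgz : ∀ z ∈ closedBall c (4 : ℝ), g z ≠ 0 := by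
    intro z hz h0
    have : z ∈ S := (hS z).2 ⟨hz, by rw [hfg z, h0, mul_zero]⟩
    exact hg0 z this h0
  have hgb : ∀ z ∈ closedBall c (12 : ℝ), ‖g z‖ ≤ Real.exp M * ‖g c‖ := by
    intro z hz
    refine le_trans ?_ (norm_cofactor_le hg hfg hM (fun ρ hρ => ((hS ρ).1 hρ).1) hz)
    exact le_mul_of_one_le_left (norm_nonneg _) (one_le_pow₀ (by norm_num))
  have hs4 : s ∈ closedBall c (4 : ℝ) := closedBall_subset_closedBall (by norm_num) hs
  rw [logDeriv_prod_pow_mul hg hfg (fun ρ hρ h => hfs (by rw [h]; exact ((hS ρ).1 hρ).2))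
    (hgz s hs4)]
  refine (norm_add_le _ _).trans (add_le_add ((norm_sum_le _ _).trans ?_) ?_)
  · refine Finset.sum_le_sum fun ρ _ => ?_
    simp
  · exact norm_logDeriv_le_of_zero_free hg hM0
      (fun z hz => hgb z (closedBall_subset_closedBall (by norm_num) (ball_subset_closedBall hz)))
      (fun z hz => hgz z (ball_subset_closedBall hz)) hs

end ComplexAnalysis


/-! ### Residues and the argument principle on rectangles. -/

section Rectangle
open Complex MeasureTheory

/-- The integral over the boundary of the rectangle `[a, b] × [c, d]`. -/
noncomputable def rectIntegral (f : ℂ → ℂ) (a b c d : ℝ) : ℂ :=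
  (∫ x : ℝ in a..b, f (x + c * I)) - (∫ x : ℝ in a..b, f (x + d * I)) +
    I • (∫ y : ℝ in c..d, f (b + y * I)) - I • (∫ y : ℝ in c..d, f (a + y * I))

theorem rectIntegral_eq_zero {f : ℂ → ℂ} {a b c d : ℝ} (hab : a ≤ b) (hcd : c ≤ d)
    (hf : ∀ s : ℂ, a ≤ s.re → s.re ≤ b → c ≤ s.im → s.im ≤ d → DifferentiableAt ℂ f s) :
    rectIntegral f a b c d = 0 := by
  have := integral_boundary_rect_eq_zero_of_differentiableOn f (a + c * I) (b + d * I) (by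
    intro s hs
    simp only [add_re, ofReal_re, mul_re, I_re, mul_zero, ofReal_im, I_im, mul_one, sub_self,
      add_zero, add_im, mul_im, zero_add, Set.uIcc_of_le hab, Set.uIcc_of_le hcd] at hs
    obtain ⟨⟨h1, h2⟩, h3, h4⟩ := hs
    exact (hf s h1 h2 h3 h4).differentiableWithinAt)
  simpa [rectIntegral] using this

theorem integral_inv_horizontal {ρ : ℂ} {a b y : ℝ} (hy : y ≠ ρ.im) :
    ∫ x : ℝ in a..b, (1 : ℂ) / (x + y * I - ρ) =
      log (b + y * I - ρ) - log (a + y * I - ρ) := by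
  have hne : ∀ x : ℝ, (x + y * I - ρ : ℂ) ∈ slitPlane := fun x => by
    rw [mem_slitPlane_iff]
    right
    simpa [sub_eq_zero] using hy
  refine intervalIntegral.integral_eq_sub_of_hasDerivAt (f := fun x : ℝ => log (x + y * I - ρ))
    (fun x _ => ?_) ?_
  · have h1 : HasDerivAt (fun x : ℝ => (x + y * I - ρ : ℂ)) 1 x :=
      ((ofRealCLM.hasDerivAt (x := x)).add_const _).sub_const _
    simpa using h1.clog_real (hne x)
  · refine Continuous.intervalIntegrable ?_ _ _
    exact continuous_const.div (by fun_prop) fun x => slitPlane_ne_zero (hne x)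

theorem integral_inv_vertical {ρ : ℂ} {x c d : ℝ} (hx : ρ.re < x) :
    I • ∫ y : ℝ in c..d, (1 : ℂ) / (x + y * I - ρ) =
      log (x + d * I - ρ) - log (x + c * I - ρ) := by
  have hne : ∀ y : ℝ, (x + y * I - ρ : ℂ) ∈ slitPlane := fun y => by
    rw [mem_slitPlane_iff]
    left
    simpa using hx
  rw [← intervalIntegral.integral_smul]
  refine intervalIntegral.integral_eq_sub_of_hasDerivAt (f := fun y : ℝ => log (x + y * I - ρ))
    (fun y _ => ?_) ?_
  · have h1 : HasDerivAt (fun y : ℝ => (x + y * I - ρ : ℂ)) I y := by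
      have := (((ofRealCLM.hasDerivAt (x := y)).mul_const I).const_add (x : ℂ)).sub_const ρ
      simpa using this
    have := h1.clog_real (hne y)
    simpa [div_eq_mul_inv] using this
  · refine Continuous.intervalIntegrable ?_ _ _
    simp only [smul_eq_mul]
    exact continuous_const.mul
      (continuous_const.div (by fun_prop) fun x => slitPlane_ne_zero (hne x))

theorem log_neg_of_im_pos {z : ℂ} (hz : 0 < z.im) : log (-z) = log z - Real.pi * I := by
  rw [log, log, norm_neg, arg_neg_eq_arg_sub_pi_of_im_pos hz]
  push_cast
  ring

theorem integral_inv_vertical_left {ρ : ℂ} {x c d : ℝ} (hx : x < ρ.re) :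
    I • ∫ y : ℝ in c..d, (1 : ℂ) / (x + y * I - ρ) =
      log (-(x + d * I - ρ)) - log (-(x + c * I - ρ)) := by
  have hne : ∀ y : ℝ, (-(x + y * I - ρ) : ℂ) ∈ slitPlane := fun y => by
    rw [mem_slitPlane_iff]
    left
    simpa using hx
  rw [← intervalIntegral.integral_smul]
  refine intervalIntegral.integral_eq_sub_of_hasDerivAt (f := fun y : ℝ => log (-(x + y * I - ρ)))
    (fun y _ => ?_) ?_
  · have h1 : HasDerivAt (fun y : ℝ => (-(x + y * I - ρ) : ℂ)) (-I) y := by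
      have := ((((ofRealCLM.hasDerivAt (x := y)).mul_const I).const_add (x : ℂ)).sub_const ρ).neg
      simp only [ofRealCLM_apply, ofReal_one, one_mul] at this
      exact this
    have := h1.clog_real (hne y)
    rw [neg_div_neg_eq] at this
    rw [smul_eq_mul, mul_one_div]
    exact this
  · refine Continuous.intervalIntegrable ?_ _ _
    simp only [smul_eq_mul]
    refine continuous_const.mul (continuous_const.div (by fun_prop) fun y => ?_)
    exact neg_ne_zero.1 (slitPlane_ne_zero (hne y))

/-- The logarithm of s - ρ is a primitive on three edges. The left edge crosses the cut, so log(-(s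
- ρ)) is used there. Everything cancels at the corners except the discrepancy of πi at each end of
the left edge. -/
theorem rectIntegral_inv {ρ : ℂ} {a b c d : ℝ} (ha : a < ρ.re) (hb : ρ.re < b) (hc : c < ρ.im)
    (hd : ρ.im < d) :
    rectIntegral (fun s => 1 / (s - ρ)) a b c d = 2 * Real.pi * I := by
  have h1 := log_neg_of_im_pos (z := a + d * I - ρ) (by simpa using hd)
  have h2 := log_neg_of_im_pos (z := -(a + c * I - ρ)) (by simpa using hc)
  rw [neg_neg] at h2
  rw [rectIntegral, integral_inv_horizontal hc.ne, integral_inv_horizontal hd.ne',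
    integral_inv_vertical hb, integral_inv_vertical_left ha, h1, h2]
  ring

theorem differentiable_dslope_of_differentiable {φ : ℂ → ℂ} (hφ : Differentiable ℂ φ) (ρ : ℂ) :
    Differentiable ℂ (dslope φ ρ) := by
  have := (differentiableOn_dslope (s := Set.univ) (f := φ) (c := ρ) univ_mem).2
    hφ.differentiableOn
  exact differentiableOn_univ.1 this

/-- Integrability of `f` along the four edges of the rectangle. -/
structure RectContinuous (f : ℂ → ℂ) (a b c d : ℝ) : Prop where
  bottom : IntervalIntegrable (fun x : ℝ => f (x + c * I)) volume a b
  top : IntervalIntegrable (fun x : ℝ => f (x + d * I)) volume a b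
  right : IntervalIntegrable (fun y : ℝ => f (b + y * I)) volume c d
  left : IntervalIntegrable (fun y : ℝ => f (a + y * I)) volume c d

theorem RectContinuous.add {f g : ℂ → ℂ} {a b c d : ℝ} (hf : RectContinuous f a b c d)
    (hg : RectContinuous g a b c d) : RectContinuous (fun s => f s + g s) a b c d :=
  ⟨hf.bottom.add hg.bottom, hf.top.add hg.top, hf.right.add hg.right, hf.left.add hg.left⟩

theorem RectContinuous.const_mul {f : ℂ → ℂ} {a b c d : ℝ} (hf : RectContinuous f a b c d) (k : ℂ) :
    RectContinuous (fun s => k * f s) a b c d :=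
  ⟨hf.bottom.const_mul k, hf.top.const_mul k, hf.right.const_mul k, hf.left.const_mul k⟩

theorem RectContinuous.sum {ι : Type*} {S : Finset ι} {f : ι → ℂ → ℂ} {a b c d : ℝ}
    (hf : ∀ i ∈ S, RectContinuous (f i) a b c d) :
    RectContinuous (fun s => ∑ i ∈ S, f i s) a b c d := by
  classical
  induction S using Finset.induction_on with
  | empty => exact ⟨by simp, by simp, by simp, by simp⟩
  | insert i S hi ih =>
    simp only [Finset.sum_insert hi]
    exact (hf i (Finset.mem_insert_self _ _)).add
      (ih fun j hj => hf j (Finset.mem_insert_of_mem hj))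

/-- A function which is continuous at each boundary point is integrable along the edges. -/
theorem RectContinuous.of_continuousAt {f : ℂ → ℂ} {a b c d : ℝ} (hab : a ≤ b) (hcd : c ≤ d)
    (hf : ∀ s : ℂ, a ≤ s.re → s.re ≤ b → c ≤ s.im → s.im ≤ d →
      (s.re = a ∨ s.re = b ∨ s.im = c ∨ s.im = d) → ContinuousAt f s) :
    RectContinuous f a b c d := by
  refine ⟨?_, ?_, ?_, ?_⟩ <;> refine ContinuousOn.intervalIntegrable fun t ht => ?_ <;>
    simp only [Set.uIcc_of_le hab, Set.uIcc_of_le hcd] at ht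
  · exact ContinuousAt.continuousWithinAt <| ContinuousAt.comp'
      (hf _ (by simpa using ht.1) (by simpa using ht.2) (by simp) (by simpa using hcd) (by simp))
      (by fun_prop)
  · exact ContinuousAt.continuousWithinAt <| ContinuousAt.comp'
      (hf _ (by simpa using ht.1) (by simpa using ht.2) (by simpa using hcd) (by simp) (by simp))
      (by fun_prop)
  · exact ContinuousAt.continuousWithinAt <| ContinuousAt.comp'
      (hf _ (by simpa using hab) (by simp) (by simpa using ht.1) (by simpa using ht.2) (by simp))
      (by fun_prop)
  · exact ContinuousAt.continuousWithinAt <| ContinuousAt.comp'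
      (hf _ (by simp) (by simpa using hab) (by simpa using ht.1) (by simpa using ht.2) (by simp))
      (by fun_prop)

theorem rectIntegral_add {f g : ℂ → ℂ} {a b c d : ℝ} (hf : RectContinuous f a b c d)
    (hg : RectContinuous g a b c d) :
    rectIntegral (fun s => f s + g s) a b c d =
      rectIntegral f a b c d + rectIntegral g a b c d := by
  rw [rectIntegral, intervalIntegral.integral_add hf.bottom hg.bottom,
    intervalIntegral.integral_add hf.top hg.top, intervalIntegral.integral_add hf.right hg.right,
    intervalIntegral.integral_add hf.left hg.left, rectIntegral, rectIntegral]
  simp only [smul_eq_mul]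
  ring

theorem rectIntegral_const_mul {f : ℂ → ℂ} {a b c d : ℝ} (k : ℂ) :
    rectIntegral (fun s => k * f s) a b c d = k * rectIntegral f a b c d := by
  simp only [rectIntegral, intervalIntegral.integral_const_mul, smul_eq_mul]
  ring

theorem rectIntegral_sum {ι : Type*} {S : Finset ι} {f : ι → ℂ → ℂ} {a b c d : ℝ}
    (hf : ∀ i ∈ S, RectContinuous (f i) a b c d) :
    rectIntegral (fun s => ∑ i ∈ S, f i s) a b c d = ∑ i ∈ S, rectIntegral (f i) a b c d := by
  classical
  induction S using Finset.induction_on with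
  | empty => simp [rectIntegral]
  | insert i S hi ih =>
    simp only [Finset.sum_insert hi]
    rw [rectIntegral_add (hf i (Finset.mem_insert_self _ _))
      (RectContinuous.sum fun j hj => hf j (Finset.mem_insert_of_mem hj)),
      ih fun j hj => hf j (Finset.mem_insert_of_mem hj)]

theorem rectIntegral_congr {f g : ℂ → ℂ} {a b c d : ℝ} (hab : a ≤ b) (hcd : c ≤ d)
    (h : ∀ s : ℂ, a ≤ s.re → s.re ≤ b → c ≤ s.im → s.im ≤ d →
      (s.re = a ∨ s.re = b ∨ s.im = c ∨ s.im = d) → f s = g s) :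
    rectIntegral f a b c d = rectIntegral g a b c d := by
  rw [rectIntegral, rectIntegral]
  congr 1
  · congr 1
    · congr 1 <;> refine intervalIntegral.integral_congr fun t ht => ?_ <;>
        simp only [Set.uIcc_of_le hab] at ht
      · exact h _ (by simpa using ht.1) (by simpa using ht.2) (by simp) (by simpa using hcd) (by simp)
      · exact h _ (by simpa using ht.1) (by simpa using ht.2) (by simpa using hcd) (by simp) (by simp)
    · congr 1
      refine intervalIntegral.integral_congr fun t ht => ?_
      simp only [Set.uIcc_of_le hcd] at ht
      exact h _ (by simpa using hab) (by simp) (by simpa using ht.1) (by simpa using ht.2) (by simp)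
  · congr 1
    refine intervalIntegral.integral_congr fun t ht => ?_
    simp only [Set.uIcc_of_le hcd] at ht
    exact h _ (by simp) (by simpa using hab) (by simpa using ht.1) (by simpa using ht.2) (by simp)

theorem rectContinuous_div_sub {φ : ℂ → ℂ} (hφ : Differentiable ℂ φ) {ρ : ℂ} {a b c d : ℝ}
    (ha : a < ρ.re) (hb : ρ.re < b) (hc : c < ρ.im) (hd : ρ.im < d) :
    RectContinuous (fun s => φ s / (s - ρ)) a b c d := by
  refine RectContinuous.of_continuousAt (ha.trans hb).le (hc.trans hd).le
    fun s _ _ _ _ h => (hφ s).continuousAt.div (by fun_prop) (sub_ne_zero.2 ?_)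
  rintro rfl
  rcases h with h | h | h | h <;> linarith

theorem rectIntegral_div_sub {φ : ℂ → ℂ} (hφ : Differentiable ℂ φ) {ρ : ℂ} {a b c d : ℝ}
    (ha : a < ρ.re) (hb : ρ.re < b) (hc : c < ρ.im) (hd : ρ.im < d) :
    rectIntegral (fun s => φ s / (s - ρ)) a b c d = 2 * Real.pi * I * φ ρ := by
  have hab := (ha.trans hb).le
  have hcd := (hc.trans hd).le
  have hdφ := differentiable_dslope_of_differentiable hφ ρ
  -- The polar part carries the residue; the divided difference is entire, so Cauchy's theorem
  -- removes it.
  rw [rectIntegral_congr (g := fun s => φ ρ * (1 / (s - ρ)) + dslope φ ρ s) hab hcd]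
  · rw [rectIntegral_add, rectIntegral_const_mul, rectIntegral_inv ha hb hc hd,
      rectIntegral_eq_zero hab hcd fun s _ _ _ _ => hdφ s]
    · ring
    · exact (rectContinuous_div_sub (φ := fun _ => 1) (by fun_prop) ha hb hc hd).const_mul _
    · exact RectContinuous.of_continuousAt hab hcd fun s _ _ _ _ _ => (hdφ s).continuousAt
  · intro s _ _ _ _ h
    have hne : s ≠ ρ := by
      rintro rfl
      rcases h with h | h | h | h <;> linarith
    rw [dslope_of_ne _ hne, slope_def_field]
    ring

/-- The argument principle on a rectangle, weighted by an entire function. -/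
theorem rectIntegral_mul_logDeriv {f φ : ℂ → ℂ} (hf : Differentiable ℂ f) (hφ : Differentiable ℂ φ)
    {a b c d : ℝ} (hab : a ≤ b) (hcd : c ≤ d) {S : Finset ℂ}
    (hS : ∀ ρ, ρ ∈ S ↔ (a < ρ.re ∧ ρ.re < b ∧ c < ρ.im ∧ ρ.im < d) ∧ f ρ = 0)
    (hbd : ∀ s : ℂ, a ≤ s.re → s.re ≤ b → c ≤ s.im → s.im ≤ d →
      (s.re = a ∨ s.re = b ∨ s.im = c ∨ s.im = d) → f s ≠ 0) :
    rectIntegral (fun s => φ s * logDeriv f s) a b c d =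
      2 * Real.pi * I * ∑ ρ ∈ S, (analyticOrderNatAt f ρ : ℂ) * φ ρ := by
  have hne := hbd (a + c * I) (by simp) (by simpa using hab) (by simp) (by simpa using hcd)
    (by simp)
  obtain ⟨g, hg, hg0, hfg⟩ := exists_eq_prod_mul_of_differentiable hf hne S
  have hgz : ∀ s : ℂ, a ≤ s.re → s.re ≤ b → c ≤ s.im → s.im ≤ d → g s ≠ 0 := by
    intro s h1 h2 h3 h4 h0
    have hfs : f s = 0 := by rw [hfg s, h0, mul_zero]
    have : ¬ (s.re = a ∨ s.re = b ∨ s.im = c ∨ s.im = d) := fun h => hbd s h1 h2 h3 h4 h hfs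
    push Not at this
    exact hg0 s ((hS s).2 ⟨⟨lt_of_le_of_ne h1 this.1.symm, lt_of_le_of_ne h2 this.2.1,
      lt_of_le_of_ne h3 this.2.2.1.symm, lt_of_le_of_ne h4 this.2.2.2⟩, hfs⟩) h0
  have hlg : ∀ s : ℂ, a ≤ s.re → s.re ≤ b → c ≤ s.im → s.im ≤ d →
      DifferentiableAt ℂ (fun s => φ s * logDeriv g s) s := fun s h1 h2 h3 h4 =>
    (hφ s).mul (((hg.contDiff.differentiable_deriv_two) s).div (hg s) (hgz s h1 h2 h3 h4))
  rw [rectIntegral_congr (g := fun s => (∑ ρ ∈ S, (analyticOrderNatAt f ρ : ℂ) * (φ s / (s - ρ))) +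
    φ s * logDeriv g s) hab hcd]
  · have hρ : ∀ ρ ∈ S, RectContinuous
        (fun s => (analyticOrderNatAt f ρ : ℂ) * (φ s / (s - ρ))) a b c d := fun ρ hρ => by
      obtain ⟨⟨h1, h2, h3, h4⟩, -⟩ := (hS ρ).1 hρ
      exact (rectContinuous_div_sub hφ h1 h2 h3 h4).const_mul _
    rw [rectIntegral_add (RectContinuous.sum hρ), rectIntegral_sum hρ,
      rectIntegral_eq_zero hab hcd hlg, add_zero, Finset.mul_sum]
    · refine Finset.sum_congr rfl fun ρ hρ => ?_
      obtain ⟨⟨h1, h2, h3, h4⟩, -⟩ := (hS ρ).1 hρ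
      rw [rectIntegral_const_mul, rectIntegral_div_sub hφ h1 h2 h3 h4]
      ring
    · exact RectContinuous.of_continuousAt hab hcd fun s h1 h2 h3 h4 _ =>
        (hlg s h1 h2 h3 h4).continuousAt
  · intro s h1 h2 h3 h4 h
    rw [logDeriv_prod_pow_mul hg hfg ?_ (hgz s h1 h2 h3 h4), mul_add, Finset.mul_sum]
    · congr 1
      refine Finset.sum_congr rfl fun ρ _ => ?_
      ring
    · rintro ρ hρ rfl
      exact hbd s h1 h2 h3 h4 h ((hS s).1 hρ).2

end Rectangle


/-! ### Growth of the zeta function in vertical strips. -/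

section ZetaGrowth
open Complex MeasureTheory Set

/-- The Mellin integral of the modified function converges absolutely at every exponent, and t^(Re s
- 1) is at most the sum of its two extreme values t^(A-1) and t^(-A-1), so the bound is uniform in
Im s. -/
theorem WeakFEPair.exists_norm_Λ₀_le (P : WeakFEPair ℂ) (A : ℝ) :
    ∃ C : ℝ, ∀ s : ℂ, |s.re| ≤ A → ‖P.Λ₀ s‖ ≤ C := by
  have hintg : ∀ a : ℝ, IntegrableOn (fun t : ℝ => t ^ (a - 1) * ‖P.f_modif t‖) (Ioi 0) := by
    intro a
    have h := (P.isStrongFEPair_toStrongFEPair.hasMellin (a : ℂ)).1.norm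
    refine (integrableOn_congr_fun (fun t (ht : 0 < t) => ?_) measurableSet_Ioi).1 h
    simp only [smul_eq_mul, norm_mul]
    rw [norm_cpow_eq_rpow_re_of_pos ht]
    simp [WeakFEPair.toStrongFEPair]
  refine ⟨∫ t in Ioi (0 : ℝ), (t ^ (A - 1) * ‖P.f_modif t‖ + t ^ (-A - 1) * ‖P.f_modif t‖),
    fun s hs => ?_⟩
  obtain ⟨h1, h2⟩ := abs_le.1 hs
  rw [WeakFEPair.Λ₀, mellin]
  refine norm_integral_le_of_norm_le ((hintg A).add (hintg (-A))) ?_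
  filter_upwards [ae_restrict_mem measurableSet_Ioi] with t ht
  have ht0 : (0 : ℝ) < t := ht
  rw [norm_smul, norm_cpow_eq_rpow_re_of_pos ht0, sub_re, one_re, ← add_mul]
  refine mul_le_mul_of_nonneg_right ?_ (norm_nonneg _)
  rcases le_total 1 t with h | h
  · exact (Real.rpow_le_rpow_of_exponent_le h (by linarith)).trans
      (le_add_of_nonneg_right (Real.rpow_nonneg ht0.le _))
  · exact (Real.rpow_le_rpow_of_exponent_ge ht0 h (by linarith)).trans
      (le_add_of_nonneg_left (Real.rpow_nonneg ht0.le _))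

theorem exists_norm_completedRiemannZeta₀_le :
    ∃ C : ℝ, ∀ s : ℂ, |s.re| ≤ 20 → ‖completedRiemannZeta₀ s‖ ≤ C := by
  obtain ⟨C, hC⟩ := (HurwitzZeta.hurwitzEvenFEPair 0).exists_norm_Λ₀_le 10
  refine ⟨C / 2, fun s hs => ?_⟩
  have h := hC (s / 2) (by
    have : (s / 2).re = s.re / 2 := by simp
    rw [this, abs_div, abs_two]
    linarith)
  rw [completedRiemannZeta₀, HurwitzZeta.completedHurwitzZetaEven₀, norm_div, RCLike.norm_two]
  gcongr

theorem norm_Gamma_le_Gamma_re {s : ℂ} (hs : 0 < s.re) : ‖Gamma s‖ ≤ Real.Gamma s.re := by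
  rw [Gamma_eq_integral hs, Real.Gamma_eq_integral hs, GammaIntegral]
  refine norm_integral_le_of_norm_le (Real.GammaIntegral_convergent hs) ?_
  filter_upwards [ae_restrict_mem measurableSet_Ioi] with t ht
  have ht0 : (0 : ℝ) < t := ht
  rw [norm_mul, norm_cpow_eq_rpow_re_of_pos ht0, norm_real, Real.norm_of_nonneg (Real.exp_pos _).le]
  simp

theorem norm_Gamma_le_norm_Gamma_add_nat {w : ℂ} (hw : 1 ≤ |w.im|) (n : ℕ) :
    ‖Gamma w‖ ≤ ‖Gamma (w + n)‖ := by
  induction n with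
  | zero => simp
  | succ n ih =>
    refine ih.trans ?_
    have him : |(w + n).im| = |w.im| := by simp
    have hne : w + n ≠ 0 := by
      intro h
      rw [h] at him
      simp at him
      rw [← him] at hw
      norm_num at hw
    push_cast
    rw [← add_assoc, Gamma_add_one _ hne, norm_mul]
    refine le_mul_of_one_le_left (norm_nonneg _) ?_
    exact (him ▸ hw).trans (abs_im_le_norm _)

theorem norm_sin_le_exp (z : ℂ) : ‖sin z‖ ≤ Real.exp |z.im| := by
  have h := (norm_sub_le (exp (-z * I)) (exp (z * I)))
  rw [sin, norm_div, norm_mul, norm_I, mul_one, RCLike.norm_two, div_le_iff₀ two_pos]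
  refine h.trans ?_
  rw [norm_exp, norm_exp]
  have h1 : (-z * I).re ≤ |z.im| := by simpa using le_abs_self z.im
  have h2 : (z * I).re ≤ |z.im| := by simpa using neg_le_abs z.im
  linarith [Real.exp_le_exp.2 h1, Real.exp_le_exp.2 h2]

/-- By reflection 1/Γ(z) = Γ(1-z) sin(πz)/π. The sine costs exp(π|Im z|). Shifting 1 - z to the
right by 10 does not decrease |Γ|, since each factor has modulus at least 1, and reaches real parts
in [1, 21], where |Γ| is at most Γ of the real part. -/
theorem exists_norm_inv_Gamma_le :
    ∃ C : ℝ, 0 ≤ C ∧ ∀ z : ℂ, |z.re| ≤ 10 → 1 ≤ |z.im| →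
      ‖(Gamma z)⁻¹‖ ≤ C * Real.exp (Real.pi * |z.im|) := by
  obtain ⟨C, hC⟩ : ∃ C : ℝ, ∀ x ∈ Icc (1 : ℝ) 22, Real.Gamma x ≤ C := by
    have hcont : ContinuousOn Real.Gamma (Icc (1 : ℝ) 22) := fun x hx =>
      (Real.differentiableAt_Gamma fun m h => by
        have := hx.1
        have hm : (0 : ℝ) ≤ m := Nat.cast_nonneg m
        linarith).continuousAt.continuousWithinAt
    obtain ⟨C, hC⟩ := isCompact_Icc.bddAbove_image hcont
    exact ⟨C, fun x hx => hC (mem_image_of_mem _ hx)⟩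
  have hC0 : 0 ≤ C := (Real.Gamma_pos_of_pos one_pos).le.trans (hC 1 (by simp))
  refine ⟨C, hC0, fun z hre him => ?_⟩
  obtain ⟨h1, h2⟩ := abs_le.1 hre
  have hz : ∀ m : ℕ, z ≠ -m := by
    rintro m rfl
    simp at him
    norm_num at him
  have hG := Gamma_ne_zero hz
  have hrefl := Gamma_mul_Gamma_one_sub z
  have hpi : (Real.pi : ℂ) ≠ 0 := ofReal_ne_zero.2 Real.pi_ne_zero
  have hsin : sin (Real.pi * z) ≠ 0 := by
    intro h
    rw [h, div_zero, mul_eq_zero] at hrefl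
    rcases hrefl with h | h
    · exact hG h
    · refine Gamma_ne_zero (s := 1 - z) ?_ h
      intro m hm
      have : (1 - z).im = 0 := by rw [hm]; simp
      simp at this
      rw [this] at him
      norm_num at him
  have heq : (Gamma z)⁻¹ = Gamma (1 - z) * sin (Real.pi * z) / Real.pi := by
    rw [eq_div_iff hsin] at hrefl
    refine inv_eq_of_mul_eq_one_right ?_
    rw [mul_div_assoc', ← mul_assoc, hrefl, div_self hpi]
  have h3 : ‖Gamma (1 - z)‖ ≤ C := by
    refine (norm_Gamma_le_norm_Gamma_add_nat (by simpa using him) 10).trans ?_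
    have hre' : (1 - z + (10 : ℕ)).re = 11 - z.re := by simp; ring
    refine (norm_Gamma_le_Gamma_re (by rw [hre']; linarith)).trans (hC _ ?_)
    rw [hre']
    constructor <;> linarith
  have h4 : ‖sin (Real.pi * z)‖ ≤ Real.exp (Real.pi * |z.im|) := by
    refine (norm_sin_le_exp _).trans (le_of_eq ?_)
    simp [abs_mul, abs_of_pos Real.pi_pos]
  rw [heq, norm_div, norm_mul, norm_real, Real.norm_of_nonneg Real.pi_pos.le]
  refine (div_le_self (by positivity) (by linarith [Real.pi_gt_three])).trans ?_
  gcongr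

/-- An exponential bound is enough. It makes the local zero count linear rather than logarithmic in
the height, a loss that the decay of the test functions absorbs. -/
theorem exists_norm_riemannZeta_le :
    ∃ C : ℝ, 0 ≤ C ∧ ∀ s : ℂ, |s.re| ≤ 20 → 2 ≤ |s.im| →
      ‖riemannZeta s‖ ≤ C * Real.exp (2 * |s.im|) := by
  obtain ⟨C₁, hC₁⟩ := exists_norm_completedRiemannZeta₀_le
  obtain ⟨C₂, hC₂0, hC₂⟩ := exists_norm_inv_Gamma_le
  have hC₁0 : 0 ≤ C₁ := (norm_nonneg _).trans (hC₁ 0 (by simp))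
  refine ⟨(C₁ + 2) * C₂ * Real.pi ^ (10 : ℝ), by positivity, fun s hre him => ?_⟩
  have hs0 : s ≠ 0 := by rintro rfl; simp at him; norm_num at him
  rw [riemannZeta_eq_completedRiemannZeta₀ hs0, div_eq_mul_inv, norm_mul, mul_inv, norm_mul]
  have h1 : ‖completedRiemannZeta₀ s - 1 / s - 1 / (1 - s)‖ ≤ C₁ + 2 := by
    have ha : ‖1 / s‖ ≤ 1 := by
      rw [norm_div, norm_one]
      exact div_le_one_of_le₀ (by linarith [abs_im_le_norm s]) (norm_nonneg _)
    have hb : ‖1 / (1 - s)‖ ≤ 1 := by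
      rw [norm_div, norm_one]
      refine div_le_one_of_le₀ ?_ (norm_nonneg _)
      have := abs_im_le_norm (1 - s)
      simp at this
      linarith
    have := norm_sub_le (completedRiemannZeta₀ s - 1 / s) (1 / (1 - s))
    have := norm_sub_le (completedRiemannZeta₀ s) (1 / s)
    linarith [hC₁ s hre]
  have h2 : ‖((Real.pi : ℂ) ^ (-s / 2))⁻¹‖ ≤ Real.pi ^ (10 : ℝ) := by
    rw [← cpow_neg, norm_cpow_eq_rpow_re_of_pos Real.pi_pos]
    refine Real.rpow_le_rpow_of_exponent_le (by linarith [Real.pi_gt_three]) ?_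
    have : (-(-s / 2)).re = s.re / 2 := by simp [neg_div]
    rw [this]
    linarith [(abs_le.1 hre).2]
  have him2 : |(s / 2).im| = |s.im| / 2 := by
    have : (s / 2).im = s.im / 2 := by simp
    rw [this, abs_div, abs_two]
  have h3 : ‖(Gamma (s / 2))⁻¹‖ ≤ C₂ * Real.exp (2 * |s.im|) := by
    refine (hC₂ (s / 2) ?_ ?_).trans ?_
    · have : (s / 2).re = s.re / 2 := by simp
      rw [this, abs_div, abs_two]
      linarith
    · rw [him2]; linarith
    · rw [him2]
      refine mul_le_mul_of_nonneg_left (Real.exp_le_exp.2 ?_) hC₂0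
      nlinarith [Real.pi_lt_four, abs_nonneg s.im]
  calc _ ≤ (C₁ + 2) * (Real.pi ^ (10 : ℝ) * (C₂ * Real.exp (2 * |s.im|))) := by gcongr
    _ = _ := by ring

/-- On this line |ζ(s) - 1| ≤ ζ(2) - 1 < 3/4. The discs used for counting zeros are centred here,
and Jensen's argument needs a lower bound at the centre. -/
theorem norm_riemannZeta_ge_of_re_eq_two {s : ℂ} (hs : s.re = 2) :
    1 / 4 ≤ ‖riemannZeta s‖ := by
  have hz := zeta_eq_tsum_one_div_nat_add_one_cpow (s := s) (by rw [hs]; norm_num)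
  have hnorm : ∀ n : ℕ, ‖1 / ((n : ℂ) + 1) ^ s‖ = 1 / ((n : ℝ) + 1) ^ 2 := by
    intro n
    rw [norm_div, norm_one]
    have : ((n : ℂ) + 1) = ((n + 1 : ℝ) : ℂ) := by push_cast; rfl
    rw [this, norm_cpow_eq_rpow_re_of_pos (by positivity), hs]
    norm_num
  have hsum0 : HasSum (fun n : ℕ => 1 / ((n : ℝ) + 1) ^ 2) (Real.pi ^ 2 / 6) := by
    have := (hasSum_nat_add_iff' (f := fun n : ℕ => 1 / (n : ℝ) ^ 2) 1).2 hasSum_zeta_two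
    simpa using this
  have hsn : Summable fun n : ℕ => ‖1 / ((n : ℂ) + 1) ^ s‖ := by
    simp_rw [hnorm]; exact hsum0.summable
  have hsplit := hsn.of_norm.tsum_eq_zero_add
  have h1 : ‖∑' n : ℕ, 1 / (((n + 1 : ℕ) : ℂ) + 1) ^ s‖ ≤ Real.pi ^ 2 / 6 - 1 := by
    refine tsum_of_norm_bounded (g := fun n : ℕ => 1 / (((n + 1 : ℕ) : ℝ) + 1) ^ 2) ?_
      (fun n => (hnorm (n + 1)).le)
    have := (hasSum_nat_add_iff' (f := fun n : ℕ => 1 / ((n : ℝ) + 1) ^ 2) 1).2 hsum0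
    simpa using this
  rw [hz, hsplit]
  simp only [Nat.cast_zero, zero_add, one_cpow, div_one]
  have h2 := norm_sub_le_norm_add (1 : ℂ) (∑' n : ℕ, 1 / (((n + 1 : ℕ) : ℂ) + 1) ^ s)
  rw [norm_one] at h2
  nlinarith [Real.pi_lt_d2, Real.pi_pos]

/-- The entire function `(s - 1) ζ(s)`. -/
noncomputable def zetaEntire : ℂ → ℂ := Function.update (fun s => (s - 1) * riemannZeta s) 1 1

theorem zetaEntire_one : zetaEntire 1 = 1 := by simp [zetaEntire]

theorem zetaEntire_of_ne {s : ℂ} (hs : s ≠ 1) : zetaEntire s = (s - 1) * riemannZeta s := by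
  simp [zetaEntire, hs]

theorem zetaEntire_eventuallyEq {s : ℂ} (hs : s ≠ 1) :
    zetaEntire =ᶠ[𝓝 s] fun s => (s - 1) * riemannZeta s := by
  filter_upwards [isOpen_ne.mem_nhds hs] with z hz using zetaEntire_of_ne hz

theorem differentiable_zetaEntire : Differentiable ℂ zetaEntire := by
  have hne : ∀ s : ℂ, s ≠ 1 → DifferentiableAt ℂ zetaEntire s := fun s hs =>
    DifferentiableAt.congr_of_eventuallyEq
      ((by fun_prop : DifferentiableAt ℂ (fun s : ℂ => s - 1) s).mul
        (differentiableAt_riemannZeta hs)) (zetaEntire_eventuallyEq hs)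
  intro s
  by_cases hs : s = 1
  · subst hs
    refine (analyticAt_of_differentiable_on_punctured_nhds_of_continuousAt ?_ ?_).differentiableAt
    · filter_upwards [self_mem_nhdsWithin] with z hz using hne z hz
    · exact continuousAt_update_same.2 riemannZeta_residue_one
  · exact hne s hs

theorem zetaEntire_eq_zero_iff {s : ℂ} : zetaEntire s = 0 ↔ riemannZeta s = 0 := by
  by_cases hs : s = 1
  · subst hs
    simp [zetaEntire_one, riemannZeta_one_ne_zero]
  · rw [zetaEntire_of_ne hs, mul_eq_zero, sub_eq_zero]
    simp [hs]

theorem analyticOrderNatAt_zetaEntire {s : ℂ} (hs : s ≠ 1) :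
    analyticOrderNatAt zetaEntire s = zetaMult s := by
  have h1 : AnalyticAt ℂ (fun s : ℂ => s - 1) s := by fun_prop
  have h2 : AnalyticAt ℂ riemannZeta s := analyticOn_riemannZeta s hs
  have h3 : analyticOrderAt zetaEntire s = analyticOrderAt riemannZeta s := by
    rw [analyticOrderAt_congr (zetaEntire_eventuallyEq hs)]
    rw [show (fun s : ℂ => (s - 1) * riemannZeta s) = (fun s : ℂ => s - 1) * riemannZeta from rfl,
      analyticOrderAt_mul h1 h2, h1.analyticOrderAt_eq_zero.2 (sub_ne_zero.2 hs), zero_add]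
  rw [analyticOrderNatAt, h3, zetaMult, analyticOrderNatAt]

theorem logDeriv_zetaEntire {s : ℂ} (hs : s ≠ 1) (h0 : riemannZeta s ≠ 0) :
    logDeriv zetaEntire s = 1 / (s - 1) + logDeriv riemannZeta s := by
  have h : logDeriv zetaEntire s = logDeriv (fun s => (s - 1) * riemannZeta s) s := by
    rw [logDeriv_apply, logDeriv_apply, (zetaEntire_eventuallyEq hs).deriv_eq, zetaEntire_of_ne hs]
  rw [h, logDeriv_mul (f := fun s => s - 1) s (sub_ne_zero.2 hs) h0 (by fun_prop)
    (differentiableAt_riemannZeta hs), logDeriv_apply]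
  simp

/-- Growth of `(s - 1) ζ(s)` on balls of radius `12` centred on the line `Re s = 2`. -/
theorem exists_norm_zetaEntire_le :
    ∃ C : ℝ, 1 ≤ C ∧ ∀ y : ℝ, 20 ≤ |y| → ∀ s ∈ Metric.closedBall (2 + y * I : ℂ) 12,
      ‖zetaEntire s‖ ≤ Real.exp (C * |y|) * ‖zetaEntire (2 + y * I)‖ := by
  obtain ⟨C, hC0, hC⟩ := exists_norm_riemannZeta_le
  refine ⟨C + 20, by linarith, fun y hy s hs => ?_⟩
  have hs' := mem_closedBall_iff_norm.1 hs
  have hre : |s.re - 2| ≤ 12 := by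
    have := (abs_re_le_norm (s - (2 + y * I))).trans hs'
    simpa using this
  have him : |s.im - y| ≤ 12 := by
    have := (abs_im_le_norm (s - (2 + y * I))).trans hs'
    simpa using this
  have him1 : |y| - 12 ≤ |s.im| := by
    have := abs_sub_abs_le_abs_sub y s.im
    rw [abs_sub_comm] at this
    linarith
  have him2 : |s.im| ≤ |y| + 12 := by
    have := abs_sub_abs_le_abs_sub s.im y
    linarith
  have hs1 : s ≠ 1 := by rintro rfl; simp at him1; linarith
  have hc1 : (2 + y * I : ℂ) ≠ 1 := by
    intro h
    have := congrArg im h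
    simp at this
    rw [this] at hy
    norm_num at hy
  have hre' : |s.re| ≤ 20 := by
    rw [abs_le] at hre ⊢
    constructor <;> linarith
  have h1 : ‖s - 1‖ ≤ |y| + 13 := by
    have h2 : s - 1 = (s - (2 + y * I)) + (1 + y * I) := by ring
    rw [h2]
    refine (norm_add_le _ _).trans ?_
    have h3 := norm_add_le (1 : ℂ) (y * I)
    rw [norm_one, norm_mul, norm_I, mul_one, norm_real, Real.norm_eq_abs] at h3
    linarith
  have h2 : 5 ≤ ‖zetaEntire (2 + y * I)‖ := by
    rw [zetaEntire_of_ne hc1, norm_mul]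
    have h3 := norm_riemannZeta_ge_of_re_eq_two (s := 2 + y * I) (by simp)
    have h4 : |y| ≤ ‖(2 + y * I - 1 : ℂ)‖ := by
      have := abs_im_le_norm (2 + y * I - 1 : ℂ)
      simpa using this
    nlinarith [norm_nonneg (2 + y * I - 1 : ℂ)]
  have h3 := hC s hre' (by linarith)
  rw [zetaEntire_of_ne hs1, norm_mul]
  have e1 : C ≤ Real.exp (C * |y|) := by
    have := Real.add_one_le_exp (C * |y|)
    nlinarith
  have e2 : |y| + 13 ≤ Real.exp (2 * |y|) := by
    have := Real.add_one_le_exp (2 * |y|)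
    nlinarith
  calc ‖s - 1‖ * ‖riemannZeta s‖ ≤ (|y| + 13) * (C * Real.exp (2 * |s.im|)) := by gcongr
    _ ≤ Real.exp (2 * |y|) * (Real.exp (C * |y|) * Real.exp (2 * (|y| + 12))) := by gcongr
    _ = Real.exp (C * |y| + 4 * |y| + 24) := by
      rw [← Real.exp_add, ← Real.exp_add]; ring_nf
    _ ≤ Real.exp ((C + 20) * |y|) := by
      gcongr
      nlinarith
    _ ≤ _ := le_mul_of_one_le_right (Real.exp_pos _).le (by linarith)

end ZetaGrowth


/-! ### The digamma function on Re s = 3/2, from Euler's limit for Γ. -/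

section Digamma
open Complex MeasureTheory Set

theorem integrable_GammaSeq_integrand {s : ℂ} (hs : 0 < s.re) (n : ℕ) :
    IntegrableOn ((Ioc (0 : ℝ) n).indicator
      fun x : ℝ => (((1 - x / n) ^ n : ℝ) : ℂ) * (x : ℂ) ^ (s - 1)) (Ioi 0) := by
  rw [IntegrableOn, integrable_indicator_iff measurableSet_Ioc, IntegrableOn,
    Measure.restrict_restrict measurableSet_Ioc, inter_eq_left.2 Ioc_subset_Ioi_self]
  have h1 : IntegrableOn (fun x : ℝ => (x : ℂ) ^ (s - 1)) (Ioc (0 : ℝ) n) := by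
    have := intervalIntegral.intervalIntegrable_cpow' (a := 0) (b := (n : ℝ)) (r := s - 1)
      (by simpa using hs)
    rwa [intervalIntegrable_iff_integrableOn_Ioc_of_le (Nat.cast_nonneg n)] at this
  refine Integrable.bdd_mul (c := 1) h1 (by fun_prop) ?_
  filter_upwards [ae_restrict_mem measurableSet_Ioc] with x hx
  have hn : (0 : ℝ) < n := hx.1.trans_le hx.2
  have h2 : x / n ≤ 1 := (div_le_one hn).2 hx.2
  have h3 : 0 ≤ x / n := div_nonneg hx.1.le hn.le
  rw [norm_real, norm_pow, Real.norm_of_nonneg (by linarith)]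
  exact pow_le_one₀ (by linarith) (by linarith)

theorem GammaSeq_eq_setIntegral {s : ℂ} (hs : 0 < s.re) {n : ℕ} (hn : n ≠ 0) :
    GammaSeq s n = ∫ x in Ioi (0 : ℝ), (Ioc (0 : ℝ) n).indicator
      (fun x : ℝ => (((1 - x / n) ^ n : ℝ) : ℂ) * (x : ℂ) ^ (s - 1)) x := by
  rw [GammaSeq_eq_approx_Gamma_integral hs hn, intervalIntegral.integral_of_le (Nat.cast_nonneg n),
    setIntegral_indicator measurableSet_Ioc, inter_eq_right.2 Ioc_subset_Ioi_self]

/-- The difference between the integrands of `Γ` and of `GammaSeq · n`. -/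
noncomputable def gammaDefect (n : ℕ) (x : ℝ) : ℝ :=
  Real.exp (-x) - (Ioc (0 : ℝ) n).indicator (fun x : ℝ => (1 - x / n) ^ n) x

theorem gammaDefect_nonneg (n : ℕ) (x : ℝ) : 0 ≤ gammaDefect n x := by
  rw [gammaDefect]
  by_cases hx : x ∈ Ioc (0 : ℝ) n
  · rw [indicator_of_mem hx, sub_nonneg]
    exact Real.one_sub_div_pow_le_exp_neg hx.2
  · rw [indicator_of_notMem hx, sub_zero]
    exact (Real.exp_pos _).le

theorem gammaDefect_mul_cpow (s : ℂ) (n : ℕ) (x : ℝ) :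
    (gammaDefect n x : ℂ) * (x : ℂ) ^ (s - 1) = ((Real.exp (-x) : ℝ) : ℂ) * (x : ℂ) ^ (s - 1) -
      (Ioc (0 : ℝ) n).indicator
        (fun x : ℝ => (((1 - x / n) ^ n : ℝ) : ℂ) * (x : ℂ) ^ (s - 1)) x := by
  rw [gammaDefect]
  by_cases hx : x ∈ Ioc (0 : ℝ) n
  · rw [indicator_of_mem hx, indicator_of_mem hx, ← sub_mul, ofReal_sub]
  · rw [indicator_of_notMem hx, indicator_of_notMem hx]
    simp

theorem integrable_gammaDefect_mul {s : ℂ} (hs : 0 < s.re) (n : ℕ) :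
    IntegrableOn (fun x : ℝ => (gammaDefect n x : ℂ) * (x : ℂ) ^ (s - 1)) (Ioi 0) := by
  simp_rw [gammaDefect_mul_cpow]
  exact (GammaIntegral_convergent hs).sub (integrable_GammaSeq_integrand hs n)

theorem integral_gammaDefect_mul {s : ℂ} (hs : 0 < s.re) {n : ℕ} (hn : n ≠ 0) :
    ∫ x in Ioi (0 : ℝ), (gammaDefect n x : ℂ) * (x : ℂ) ^ (s - 1) = Gamma s - GammaSeq s n := by
  simp_rw [gammaDefect_mul_cpow]
  rw [integral_sub (GammaIntegral_convergent hs) (integrable_GammaSeq_integrand hs n),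
    ← GammaSeq_eq_setIntegral hs hn, Gamma_eq_integral hs, GammaIntegral]

/-- The defect is nonnegative and |x^(s-1)| ≤ 1 + x for 1 ≤ Re s ≤ 2, so the errors at the two
points 1 and 2 dominate the error in the whole strip. The resulting uniform convergence passes to
derivatives. -/
theorem norm_Gamma_sub_GammaSeq_le {s : ℂ} (h1 : 1 ≤ s.re) (h2 : s.re ≤ 2) {n : ℕ} (hn : n ≠ 0) :
    ‖Gamma s - GammaSeq s n‖ ≤ ‖(Gamma 1 - GammaSeq 1 n) + (Gamma 2 - GammaSeq 2 n)‖ := by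
  have e1 : (0 : ℝ) < (1 : ℂ).re := by simp
  have e2 : (0 : ℝ) < (2 : ℂ).re := by simp
  have i1 := integrable_gammaDefect_mul e1 n
  have i2 := integrable_gammaDefect_mul e2 n
  rw [← integral_gammaDefect_mul (by linarith : 0 < s.re) hn, ← integral_gammaDefect_mul e1 hn,
    ← integral_gammaDefect_mul e2 hn, ← integral_add i1 i2]
  have hreal : ∀ x : ℝ, (gammaDefect n x : ℂ) * (x : ℂ) ^ ((1 : ℂ) - 1) +
      (gammaDefect n x : ℂ) * (x : ℂ) ^ ((2 : ℂ) - 1) = ((gammaDefect n x * (1 + x) : ℝ) : ℂ) := by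
    intro x
    have : (2 : ℂ) - 1 = 1 := by norm_num
    rw [this]
    simp
    ring
  simp_rw [hreal]
  rw [integral_complex_ofReal, norm_real]
  refine le_trans ?_ (le_abs_self _)
  refine norm_integral_le_of_norm_le ?_ ?_
  · have := i1.add i2
    have h3 := this.re
    refine (integrable_congr (ae_of_all _ fun x => ?_)).1 h3
    have := hreal x
    simp only [Pi.add_apply]
    rw [this]
    simp
  · filter_upwards [ae_restrict_mem measurableSet_Ioi] with x hx
    have hx0 : (0 : ℝ) < x := hx
    rw [norm_mul, norm_cpow_eq_rpow_re_of_pos hx0, norm_real,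
      Real.norm_of_nonneg (gammaDefect_nonneg n x)]
    refine mul_le_mul_of_nonneg_left ?_ (gammaDefect_nonneg n x)
    rw [sub_re, one_re]
    rcases le_total 1 x with h | h
    · refine (Real.rpow_le_rpow_of_exponent_le h (by linarith : s.re - 1 ≤ 1)).trans ?_
      rw [Real.rpow_one]; linarith
    · refine (Real.rpow_le_one hx0.le h (by linarith)).trans (by linarith)

theorem tendstoLocallyUniformlyOn_GammaSeq :
    TendstoLocallyUniformlyOn (fun n s => GammaSeq s n) Gamma atTop {s : ℂ | 1 < s.re ∧ s.re < 2} := by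
  refine TendstoUniformlyOn.tendstoLocallyUniformlyOn ?_
  rw [Metric.tendstoUniformlyOn_iff]
  intro ε hε
  have h : Tendsto (fun n => ‖(Gamma 1 - GammaSeq 1 n) + (Gamma 2 - GammaSeq 2 n)‖) atTop (𝓝 0) := by
    have := ((tendsto_const_nhds (x := Gamma 1)).sub (GammaSeq_tendsto_Gamma 1)).add
      ((tendsto_const_nhds (x := Gamma 2)).sub (GammaSeq_tendsto_Gamma 2))
    simpa using this.norm
  filter_upwards [h.eventually_lt_const hε, eventually_ne_atTop 0] with n hn hn0 s hs
  rw [dist_eq_norm]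
  exact (norm_Gamma_sub_GammaSeq_le hs.1.le hs.2.le hn0).trans_lt hn

theorem add_natCast_ne_zero_of_re_pos {s : ℂ} (hs : 0 < s.re) (j : ℕ) : s + j ≠ 0 := by
  intro h
  have := congrArg re h
  simp at this
  have hj : (0 : ℝ) ≤ j := Nat.cast_nonneg j
  linarith

theorem hasDerivAt_GammaSeq {s : ℂ} (hs : 0 < s.re) {n : ℕ} (hn : n ≠ 0) :
    HasDerivAt (fun s => GammaSeq s n)
      (GammaSeq s n * (log n - ∑ j ∈ Finset.range (n + 1), 1 / (s + j))) s := by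
  have hP : ∀ j ∈ Finset.range (n + 1), HasDerivAt (fun s : ℂ => s + j) 1 s := fun j _ =>
    (hasDerivAt_id s).add_const _
  have hprod := HasDerivAt.fun_finsetProd hP
  have hne : ∏ j ∈ Finset.range (n + 1), (s + j) ≠ 0 :=
    Finset.prod_ne_zero_iff.2 fun j _ => add_natCast_ne_zero_of_re_pos hs j
  have hpow : HasDerivAt (fun s : ℂ => (n : ℂ) ^ s * (n.factorial : ℂ))
      ((n : ℂ) ^ s * log n * n.factorial) s := by
    have := ((hasDerivAt_id s).const_cpow (c := (n : ℂ)) (Or.inl (Nat.cast_ne_zero.2 hn)))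
    simpa using this.mul_const (n.factorial : ℂ)
  have hd := hpow.div hprod hne
  have hfun : (fun s => GammaSeq s n) =
      (fun s : ℂ => (n : ℂ) ^ s * (n.factorial : ℂ)) / fun s : ℂ => ∏ j ∈ Finset.range (n + 1), (s + j) := by
    ext s; simp [GammaSeq]
  rw [hfun]
  refine hd.congr_deriv ?_
  have hsum : ∑ i ∈ Finset.range (n + 1), (∏ j ∈ (Finset.range (n + 1)).erase i, (s + j)) • (1 : ℂ) =
      (∏ j ∈ Finset.range (n + 1), (s + j)) * ∑ j ∈ Finset.range (n + 1), 1 / (s + j) := by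
    rw [Finset.mul_sum]
    refine Finset.sum_congr rfl fun i hi => ?_
    rw [smul_eq_mul, mul_one, ← Finset.mul_prod_erase _ _ hi]
    have := add_natCast_ne_zero_of_re_pos hs i
    field_simp
  rw [hsum, GammaSeq]
  field_simp

theorem tendsto_digamma {s : ℂ} (h1 : 1 < s.re) (h2 : s.re < 2) :
    Tendsto (fun n : ℕ => log n - ∑ j ∈ Finset.range (n + 1), 1 / (s + j)) atTop
      (𝓝 (digamma s)) := by
  have hopen : IsOpen {s : ℂ | 1 < s.re ∧ s.re < 2} :=
    (isOpen_lt continuous_const continuous_re).inter (isOpen_lt continuous_re continuous_const)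
  have hs0 : 0 < s.re := by linarith
  have hder := (tendstoLocallyUniformlyOn_GammaSeq.deriv (by
    filter_upwards [eventually_ne_atTop 0] with n hn z hz
    exact (hasDerivAt_GammaSeq (by have := hz.1; linarith) hn).differentiableAt.differentiableWithinAt)
    hopen).tendsto_at (a := s) ⟨h1, h2⟩
  have hq := hder.div (GammaSeq_tendsto_Gamma s) (Gamma_ne_zero_of_re_pos hs0)
  rw [digamma_def, logDeriv_apply]
  refine hq.congr' ?_
  have hne := (GammaSeq_tendsto_Gamma s).eventually_ne (Gamma_ne_zero_of_re_pos hs0)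
  filter_upwards [eventually_ne_atTop 0, hne] with n hn hG
  simp only [Function.comp_apply, Pi.div_apply]
  rw [(hasDerivAt_GammaSeq hs0 hn).deriv, mul_div_cancel_left₀ _ hG]

theorem log_add_one_sub_log {w : ℂ} (hw : 0 < w.re) : log (w + 1) - log w = log (1 + 1 / w) := by
  have hw0 : w ≠ 0 := fun h => by simp [h] at hw
  have h1 : 0 < (1 + 1 / w).re := by
    have : (1 / w).re = w.re / normSq w := by simp [inv_re]
    rw [add_re, one_re, this]
    have := normSq_pos.2 hw0
    positivity
  have h2 : (1 + 1 / w) ≠ 0 := fun h => by rw [h] at h1; exact lt_irrefl _ h1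
  have e : w + 1 = w * (1 + 1 / w) := by field_simp
  rw [e, (log_mul_eq_add_log_iff hw0 h2).2, add_sub_cancel_left]
  have a1 := abs_lt.1 (abs_arg_lt_pi_div_two_iff.2 (Or.inl hw))
  have a2 := abs_lt.1 (abs_arg_lt_pi_div_two_iff.2 (Or.inl h1))
  constructor <;> linarith

/-- Telescoping log(s+n+1) - log s into a sum of log(1 + w), w = 1/(s+j), leaves the sum of log(1 +
w) - w, whose terms are O(1/(j+1)²). The line Re s = 3/2 keeps |w| ≤ 2/3. -/
theorem norm_digamma_sub_log_le {s : ℂ} (h : s.re = 3 / 2) : ‖digamma s - log s‖ ≤ 8 := by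
  have hlim := tendsto_digamma (s := s) (by rw [h]; norm_num) (by rw [h]; norm_num)
  have hs0 : 0 < s.re := by rw [h]; norm_num
  have htail : Tendsto (fun n : ℕ => log n - log (s + (n + 1 : ℕ))) atTop (𝓝 0) := by
    have h1 : Tendsto (fun n : ℕ => log (1 + (s + 1) / n)) atTop (𝓝 0) := by
      have : Tendsto (fun n : ℕ => 1 + (s + 1) / (n : ℂ)) atTop (𝓝 (1 + 0)) :=
        tendsto_const_nhds.add (tendsto_const_div_atTop_nhds_zero_nat (s + 1))
      have h2 := (continuousAt_clog (x := 1 + 0) (by simp)).tendsto.comp this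
      simpa [Function.comp_def] using h2
    have h2 := h1.neg
    rw [neg_zero] at h2
    refine h2.congr' ?_
    filter_upwards [eventually_ne_atTop 0] with n hn
    have hn' : (0 : ℝ) < n := Nat.cast_pos.2 (Nat.pos_of_ne_zero hn)
    have hnc : (n : ℂ) ≠ 0 := Nat.cast_ne_zero.2 hn
    have e : s + (n + 1 : ℕ) = ((n : ℝ) : ℂ) * (1 + (s + 1) / n) := by
      push_cast
      field_simp
      ring
    have hne : (1 + (s + 1) / n : ℂ) ≠ 0 := by
      intro h0
      rw [h0, mul_zero] at e
      exact add_natCast_ne_zero_of_re_pos hs0 (n + 1) e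
    rw [e, log_ofReal_mul hn' hne, ← natCast_log]
    simp
  have hlim2 : Tendsto (fun n : ℕ => (log n - ∑ j ∈ Finset.range (n + 1), 1 / (s + j)) -
      (log n - log (s + (n + 1 : ℕ))) - log s) atTop (𝓝 (digamma s - log s)) := by
    simpa using (hlim.sub htail).sub_const (log s)
  refine le_of_tendsto hlim2.norm (Eventually.of_forall fun n => ?_)
  have htel : log (s + (n + 1 : ℕ)) - log s =
      ∑ j ∈ Finset.range (n + 1), log (1 + 1 / (s + j)) := by
    have := Finset.sum_range_sub (fun j : ℕ => log (s + j)) (n + 1)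
    rw [Nat.cast_zero, add_zero] at this
    rw [← this]
    refine Finset.sum_congr rfl fun j _ => ?_
    rw [← log_add_one_sub_log (by simp; positivity)]
    push_cast
    rw [add_assoc]
  have e : (log n - ∑ j ∈ Finset.range (n + 1), 1 / (s + j)) - (log n - log (s + (n + 1 : ℕ))) - log s
      = ∑ j ∈ Finset.range (n + 1), (log (1 + 1 / (s + j)) - 1 / (s + j)) := by
    rw [Finset.sum_sub_distrib, ← htel]
    ring
  rw [e]
  have hterm : ∀ j ∈ Finset.range (n + 1), ‖log (1 + 1 / (s + j)) - 1 / (s + j)‖ ≤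
      2 * (1 / ((j : ℝ) + 1) ^ 2) := by
    intro j _
    have hj : (j : ℝ) + 3 / 2 ≤ ‖s + j‖ := by
      have := re_le_norm (s + j)
      simp [h] at this
      linarith
    have hpos : (0 : ℝ) ≤ j := Nat.cast_nonneg j
    have h1 : ‖1 / (s + j)‖ ≤ 1 / ((j : ℝ) + 1) := by
      rw [norm_div, norm_one]
      exact one_div_le_one_div_of_le (by positivity) (by linarith)
    have h2 : ‖1 / (s + j)‖ ≤ 2 / 3 := by
      rw [norm_div, norm_one, div_le_iff₀ (by linarith)]
      linarith
    refine (norm_log_one_add_sub_self_le (by linarith)).trans ?_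
    have h3 : (1 - ‖1 / (s + j)‖)⁻¹ ≤ 3 := by
      rw [inv_le_comm₀ (by linarith) (by norm_num)]
      linarith
    have h4 : ‖1 / (s + j)‖ ^ 2 ≤ 1 / ((j : ℝ) + 1) ^ 2 := by
      have := pow_le_pow_left₀ (norm_nonneg _) h1 2
      rwa [div_pow, one_pow] at this
    have h5 : ‖1 / (s + j)‖ ^ 2 * (1 - ‖1 / (s + j)‖)⁻¹ ≤ 1 / ((j : ℝ) + 1) ^ 2 * 3 :=
      mul_le_mul h4 h3 (inv_nonneg.2 (by linarith)) (by positivity)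
    have h6 : 0 ≤ 1 / ((j : ℝ) + 1) ^ 2 := by positivity
    linarith
  refine (norm_sum_le _ _).trans ((Finset.sum_le_sum hterm).trans ?_)
  rw [← Finset.mul_sum]
  have hsum0 : HasSum (fun n : ℕ => 1 / ((n : ℝ) + 1) ^ 2) (Real.pi ^ 2 / 6) := by
    have := (hasSum_nat_add_iff' (f := fun n : ℕ => 1 / (n : ℝ) ^ 2) 1).2 hasSum_zeta_two
    simpa using this
  have := sum_le_hasSum (Finset.range (n + 1)) (fun i _ => by positivity) hsum0
  nlinarith [Real.pi_lt_d2, Real.pi_pos]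

end Digamma


/-! ### The logarithmic derivative of zeta on the lines Re s = 3/2 and Re s = -1/2. -/

section BoundaryValues
open Complex MeasureTheory Set

theorem natCast_cpow_eq_exp {n : ℕ} (hn : n ≠ 0) (s : ℂ) : (n : ℂ) ^ s = exp (Real.log n * s) := by
  rw [cpow_def_of_ne_zero (by simpa using hn), natCast_log]

theorem hasSum_neg_logDeriv_riemannZeta {s : ℂ} (hs : 1 < s.re) :
    HasSum (fun n : ℕ => (ArithmeticFunction.vonMangoldt n : ℂ) * exp (-(Real.log n * s)))
      (-logDeriv riemannZeta s) := by
  have h := (ArithmeticFunction.LSeriesSummable_vonMangoldt hs).hasSum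
  rw [← LSeries, ArithmeticFunction.LSeries_vonMangoldt_eq_deriv_riemannZeta_div hs] at h
  rw [logDeriv_apply, ← neg_div]
  have e : LSeries.term (fun n => (ArithmeticFunction.vonMangoldt n : ℂ)) s =
      fun n : ℕ => (ArithmeticFunction.vonMangoldt n : ℂ) * exp (-(Real.log n * s)) := by
    ext n
    rw [LSeries.term_def]
    split_ifs with hn
    · simp [hn]
    · rw [natCast_cpow_eq_exp hn, exp_neg, div_eq_mul_inv]
  rwa [e] at h

theorem norm_vonMangoldt_mul_exp (n : ℕ) (s : ℂ) :
    ‖(ArithmeticFunction.vonMangoldt n : ℂ) * exp (-(Real.log n * s))‖ =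
      ArithmeticFunction.vonMangoldt n * Real.exp (-(Real.log n * s.re)) := by
  rw [norm_mul, norm_real, Real.norm_of_nonneg ArithmeticFunction.vonMangoldt_nonneg, norm_exp,
    neg_re, re_ofReal_mul]

theorem summable_vonMangoldt_mul_exp {σ : ℝ} (hσ : 1 < σ) :
    Summable fun n : ℕ => ArithmeticFunction.vonMangoldt n * Real.exp (-(Real.log n * σ)) := by
  have := (hasSum_neg_logDeriv_riemannZeta (s := σ) (by simpa using hσ)).summable.norm
  simpa only [norm_vonMangoldt_mul_exp, ofReal_re] using this

theorem norm_logDeriv_riemannZeta_le {s : ℂ} (hs : 1 < s.re) :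
    ‖logDeriv riemannZeta s‖ ≤
      ∑' n : ℕ, ArithmeticFunction.vonMangoldt n * Real.exp (-(Real.log n * s.re)) := by
  have h := hasSum_neg_logDeriv_riemannZeta hs
  rw [← norm_neg, ← h.tsum_eq]
  refine tsum_of_norm_bounded (summable_vonMangoldt_mul_exp hs).hasSum fun n => ?_
  rw [norm_vonMangoldt_mul_exp]

/-- On this line -conj z = z + π/2 - 2π. Consequently |tan z| = 1, and since Re(πs/2) = 3π/4 when Re
s = 3/2, the trigonometric factor of the functional equation needs no further estimate. -/
theorem cos_eq_neg_conj_sin {z : ℂ} (hz : z.re = 3 * Real.pi / 4) :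
    cos z = -(starRingEnd ℂ) (sin z) := by
  have h : -(starRingEnd ℂ) z = z + Real.pi / 2 - 2 * Real.pi := by
    apply Complex.ext
    · simp [hz]
      ring
    · simp
  rw [← sin_conj, ← sin_neg, h, sin_sub_two_pi, sin_add_pi_div_two]

theorem cos_ne_zero_of_re {z : ℂ} (hz : z.re = 3 * Real.pi / 4) : cos z ≠ 0 := by
  intro h
  have h1 := cos_eq_neg_conj_sin hz
  rw [h, eq_comm, neg_eq_zero, map_eq_zero] at h1
  have := sin_sq_add_cos_sq z
  rw [h, h1] at this
  norm_num at this

theorem norm_tan_of_re {z : ℂ} (hz : z.re = 3 * Real.pi / 4) : ‖tan z‖ = 1 := by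
  have h0 := cos_ne_zero_of_re hz
  rw [tan, norm_div, cos_eq_neg_conj_sin hz, norm_neg, RCLike.norm_conj, div_self]
  rw [cos_eq_neg_conj_sin hz, neg_ne_zero, map_ne_zero] at h0
  exact norm_ne_zero_iff.2 h0

/-- The logarithmic derivative of the functional equation on the line `Re s = 3 / 2`. -/
theorem logDeriv_riemannZeta_one_sub {s : ℂ} (hs : s.re = 3 / 2) :
    riemannZeta (1 - s) ≠ 0 ∧
    -logDeriv riemannZeta (1 - s) = -log (2 * Real.pi) + digamma s -
      Real.pi / 2 * tan (Real.pi * s / 2) + logDeriv riemannZeta s := by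
  have hre : ((Real.pi : ℂ) * s / 2).re = 3 * Real.pi / 4 := by
    have : (Real.pi : ℂ) * s / 2 = ((Real.pi / 2 : ℝ) : ℂ) * s := by push_cast; ring
    rw [this, re_ofReal_mul, hs]
    ring
  have hcos := cos_ne_zero_of_re hre
  have hpi : (2 * (Real.pi : ℂ)) ≠ 0 := by
    have := Real.pi_ne_zero
    simp [this]
  have hΓ : Gamma s ≠ 0 := Gamma_ne_zero_of_re_pos (by rw [hs]; norm_num)
  have hζ : riemannZeta s ≠ 0 := riemannZeta_ne_zero_of_one_le_re (by rw [hs]; norm_num)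
  have hs1 : s ≠ 1 := fun h => by rw [h] at hs; norm_num at hs
  have hs1' : 1 - s ≠ 1 := fun h => by
    have := congrArg re h
    simp [hs] at this
  have hsn : ∀ m : ℕ, s ≠ -m := fun m h => by
    rw [h] at hs
    simp at hs
    have : (0 : ℝ) ≤ m := Nat.cast_nonneg m
    linarith
  have hpow : (2 * (Real.pi : ℂ)) ^ (-s) ≠ 0 := by
    rw [cpow_ne_zero_iff]
    exact Or.inl hpi
  have hev : (fun s => riemannZeta (1 - s)) =ᶠ[𝓝 s] fun s =>
      (((2 * (2 * (Real.pi : ℂ)) ^ (-s)) * Gamma s) * cos (Real.pi * s / 2)) * riemannZeta s := by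
    have : {s : ℂ | 1 < s.re} ∈ 𝓝 s :=
      (isOpen_lt continuous_const continuous_re).mem_nhds (by rw [mem_ofPred_eq, hs]; norm_num)
    filter_upwards [this] with z hz
    refine riemannZeta_one_sub (fun n h => ?_) (fun h => ?_)
    · rw [h] at hz
      simp at hz
      have : (0 : ℝ) ≤ n := Nat.cast_nonneg n
      linarith
    · rw [h] at hz
      simp at hz
  have hA : 2 * (2 * (Real.pi : ℂ)) ^ (-s) ≠ 0 := mul_ne_zero two_ne_zero hpow
  have hd1 : HasDerivAt (fun s : ℂ => 2 * (2 * (Real.pi : ℂ)) ^ (-s))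
      (2 * ((2 * (Real.pi : ℂ)) ^ (-s) * log (2 * Real.pi) * -1)) s :=
    ((hasDerivAt_neg s).const_cpow (Or.inl hpi)).const_mul 2
  have hd2 : DifferentiableAt ℂ Gamma s := differentiableAt_Gamma s hsn
  have hd3 : HasDerivAt (fun s : ℂ => cos (Real.pi * s / 2))
      (-sin (Real.pi * s / 2) * (Real.pi * 1 / 2)) s :=
    (hasDerivAt_cos _).comp s (((hasDerivAt_id s).const_mul (Real.pi : ℂ)).div_const 2)
  refine ⟨?_, ?_⟩
  · have := hev.self_of_nhds
    simp only at this
    rw [this]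
    exact mul_ne_zero (mul_ne_zero (mul_ne_zero hA hΓ) hcos) hζ
  · have hL : logDeriv (fun s => riemannZeta (1 - s)) s = -logDeriv riemannZeta (1 - s) := by
      have h1 : HasDerivAt (fun s => riemannZeta (1 - s)) (deriv riemannZeta (1 - s) * -1) s :=
        (differentiableAt_riemannZeta hs1').hasDerivAt.comp s ((hasDerivAt_id s).const_sub 1)
      rw [logDeriv_apply, logDeriv_apply, h1.deriv]
      ring
    have hR : logDeriv (fun s => riemannZeta (1 - s)) s = logDeriv (fun s =>
        (((2 * (2 * (Real.pi : ℂ)) ^ (-s)) * Gamma s) * cos (Real.pi * s / 2)) * riemannZeta s) s := by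
      have := hev.self_of_nhds
      simp only at this
      rw [logDeriv_apply, logDeriv_apply, hev.deriv_eq, this]
    rw [← hL, hR, logDeriv_mul
      (f := fun s => ((2 * (2 * (Real.pi : ℂ)) ^ (-s)) * Gamma s) * cos (Real.pi * s / 2)) s
      (mul_ne_zero (mul_ne_zero hA hΓ) hcos) hζ
      ((hd1.differentiableAt.mul hd2).mul hd3.differentiableAt) (differentiableAt_riemannZeta hs1),
      logDeriv_mul (f := fun s => (2 * (2 * (Real.pi : ℂ)) ^ (-s)) * Gamma s)
      (g := fun s => cos (Real.pi * s / 2)) s (mul_ne_zero hA hΓ) hcos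
      (hd1.differentiableAt.mul hd2) hd3.differentiableAt,
      logDeriv_mul (f := fun s => 2 * (2 * (Real.pi : ℂ)) ^ (-s)) s hA hΓ hd1.differentiableAt hd2,
      logDeriv_apply (fun s : ℂ => 2 * (2 * (Real.pi : ℂ)) ^ (-s)), hd1.deriv,
      logDeriv_apply (fun s : ℂ => cos (Real.pi * s / 2)), hd3.deriv, digamma_def, tan]
    field_simp
    ring

/-- The functional equation carries the line to Re s = 3/2, where ζ'/ζ is bounded by its Dirichlet
series, the tangent term is bounded, and the digamma function is log s + O(1). Note that 9/4 + t² =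
|3/2 - it|². -/
theorem exists_norm_logDeriv_riemannZeta_left_le :
    ∃ C : ℝ, 0 ≤ C ∧ ∀ t : ℝ, riemannZeta (-1 / 2 + t * I) ≠ 0 ∧
      ‖logDeriv riemannZeta (-1 / 2 + t * I) + (Real.log (9 / 4 + t ^ 2) / 2 : ℝ)‖ ≤ C := by
  set A := ∑' n : ℕ, ArithmeticFunction.vonMangoldt n * Real.exp (-(Real.log n * (3 / 2)))
  have hA : 0 ≤ A := tsum_nonneg fun n =>
    mul_nonneg ArithmeticFunction.vonMangoldt_nonneg (Real.exp_pos _).le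
  refine ⟨18 + A, by linarith, fun t => ?_⟩
  set s : ℂ := 3 / 2 - t * I with hsdef
  have hsre : s.re = 3 / 2 := by simp [hsdef]
  have hsim : s.im = -t := by simp [hsdef]
  have hw : (-1 / 2 + t * I : ℂ) = 1 - s := by rw [hsdef]; ring
  obtain ⟨h0, h1⟩ := logDeriv_riemannZeta_one_sub hsre
  refine ⟨by rwa [hw], ?_⟩
  have hre : ((Real.pi : ℂ) * s / 2).re = 3 * Real.pi / 4 := by
    have : (Real.pi : ℂ) * s / 2 = ((Real.pi / 2 : ℝ) : ℂ) * s := by push_cast; ring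
    rw [this, re_ofReal_mul, hsre]
    ring
  have hlog : Real.log (9 / 4 + t ^ 2) / 2 = Real.log ‖s‖ := by
    have : 9 / 4 + t ^ 2 = ‖s‖ ^ 2 := by
      rw [← normSq_eq_norm_sq, normSq_apply, hsre, hsim]
      ring
    rw [this, Real.log_pow]
    push_cast
    ring
  rw [hw, hlog]
  have e : logDeriv riemannZeta (1 - s) + (Real.log ‖s‖ : ℝ) =
      log (2 * Real.pi) - (digamma s - log s) + Real.pi / 2 * tan (Real.pi * s / 2) -
        logDeriv riemannZeta s - s.arg * I := by
    rw [log, log] at *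
    linear_combination -h1
  have n1 : ‖log (2 * Real.pi : ℂ)‖ ≤ 2 := by
    have : (2 * Real.pi : ℂ) = ((2 * Real.pi : ℝ) : ℂ) := by push_cast; rfl
    rw [this, ← ofReal_log (by positivity), norm_real, Real.norm_of_nonneg
      (Real.log_nonneg (by linarith [Real.pi_gt_three]))]
    rw [Real.log_le_iff_le_exp (by positivity)]
    have h2 : Real.exp 2 = Real.exp 1 ^ 2 := by rw [← Real.exp_nat_mul]; norm_num
    rw [h2]
    nlinarith [Real.exp_one_gt_d9, Real.pi_lt_d2]
  have n2 := norm_digamma_sub_log_le hsre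
  have n3 : ‖(Real.pi / 2 * tan (Real.pi * s / 2) : ℂ)‖ ≤ 2 := by
    rw [norm_mul, norm_tan_of_re hre, mul_one, norm_div, norm_real,
      Real.norm_of_nonneg Real.pi_pos.le, RCLike.norm_two]
    linarith [Real.pi_lt_four]
  have n4 : ‖logDeriv riemannZeta s‖ ≤ A := by
    have := norm_logDeriv_riemannZeta_le (s := s) (by rw [hsre]; norm_num)
    rwa [hsre] at this
  have n5 : ‖(s.arg * I : ℂ)‖ ≤ 4 := by
    rw [norm_mul, norm_I, mul_one, norm_real, Real.norm_eq_abs]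
    exact (abs_arg_le_pi s).trans Real.pi_lt_four.le
  rw [e]
  have m1 := norm_sub_le (log (2 * Real.pi) - (digamma s - log s) +
    Real.pi / 2 * tan (Real.pi * s / 2) - logDeriv riemannZeta s) (s.arg * I)
  have m2 := norm_sub_le (log (2 * Real.pi) - (digamma s - log s) +
    Real.pi / 2 * tan (Real.pi * s / 2)) (logDeriv riemannZeta s)
  have m3 := norm_add_le (log (2 * Real.pi) - (digamma s - log s))
    (Real.pi / 2 * tan (Real.pi * s / 2))
  have m4 := norm_sub_le (log (2 * Real.pi : ℂ)) (digamma s - log s)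
  linarith

end BoundaryValues

/-! ### Local zero counts, and horizontal lines that avoid the zeros. -/

section ZeroCounting
open Complex MeasureTheory Set

/-- The natural-number order takes the default value 0 when the order is infinite, so the identity
theorem, applied to `zetaEntire`, has to exclude that case. -/
theorem one_le_zetaMult {ρ : ℂ} (hρ : riemannZeta ρ = 0) : 1 ≤ zetaMult ρ := by
  have h1 : ρ ≠ 1 := by rintro rfl; exact riemannZeta_one_ne_zero hρ
  rw [← analyticOrderNatAt_zetaEntire h1, Nat.one_le_iff_ne_zero]
  have hz : zetaEntire ρ = 0 := zetaEntire_eq_zero_iff.2 hρ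
  intro h0
  have hA := differentiable_zetaEntire.analyticAt ρ
  have htop : analyticOrderAt zetaEntire ρ ≠ ⊤ := by
    refine AnalyticOnNhd.analyticOrderAt_ne_top_of_isPreconnected (x := 1) (U := univ)
      (fun z _ => differentiable_zetaEntire.analyticAt z) isPreconnected_univ
      (mem_univ _) (mem_univ _) ?_
    rw [(differentiable_zetaEntire.analyticAt 1).analyticOrderAt_eq_zero.2 (by simp [zetaEntire_one])]
    exact ENat.zero_ne_top
  have h2 : analyticOrderAt zetaEntire ρ = 0 := by
    rw [← Nat.cast_analyticOrderNatAt htop, h0, Nat.cast_zero]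
  exact hA.analyticOrderAt_eq_zero.1 h2 hz

theorem exists_sum_zetaMult_le :
    ∃ C : ℝ, 1 ≤ C ∧ ∀ y : ℝ, 20 ≤ |y| → ∀ S : Finset ℂ,
      (∀ ρ ∈ S, ρ ∈ Metric.closedBall (2 + y * I : ℂ) 4) → (∑ ρ ∈ S, (zetaMult ρ : ℝ)) ≤ C * |y| := by
  obtain ⟨C, hC1, hC⟩ := exists_norm_zetaEntire_le
  refine ⟨2 * C, by linarith, fun y hy S hS => ?_⟩
  have hc : zetaEntire (2 + y * I) ≠ 0 := by
    rw [Ne, zetaEntire_eq_zero_iff]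
    exact riemannZeta_ne_zero_of_one_le_re (by simp)
  have h := two_pow_sum_order_le differentiable_zetaEntire hc (hC y hy) hS
  have hne : ∀ ρ ∈ S, ρ ≠ 1 := by
    rintro ρ hρ rfl
    have h1 := (abs_im_le_norm _).trans (mem_closedBall_iff_norm.1 (hS 1 hρ))
    simp at h1
    linarith
  have hsum : ∑ ρ ∈ S, analyticOrderNatAt zetaEntire ρ = ∑ ρ ∈ S, zetaMult ρ :=
    Finset.sum_congr rfl fun ρ hρ => analyticOrderNatAt_zetaEntire (hne ρ hρ)
  rw [hsum] at h
  set n := ∑ ρ ∈ S, zetaMult ρ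
  have h2 : (n : ℝ) * Real.log 2 ≤ C * |y| := by
    rw [← Real.log_pow, Real.log_le_iff_le_exp (by positivity)]
    exact h
  have h3 : (∑ ρ ∈ S, (zetaMult ρ : ℝ)) = n := by simp [n]
  rw [h3]
  nlinarith [Real.log_two_gt_d9, Nat.cast_nonneg (α := ℝ) n]

/-- Pigeonhole with n zeros and the n + 1 points y + k/(n+1): if each were closer than 1/(2(n+1)) to
some ordinate, two of them would share a zero and be less than 1/(n+1) apart. -/
theorem exists_height_far_from (y : ℝ) (S : Finset ℂ) :
    ∃ Y ∈ Icc y (y + 1), ∀ ρ ∈ S, 1 / (2 * ((S.card : ℝ) + 1)) ≤ |Y - ρ.im| := by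
  by_contra! hcon
  set n := S.card
  have hpos : (0 : ℝ) < (n : ℝ) + 1 := by positivity
  have hmem : ∀ k ∈ Finset.range (n + 1), y + k / ((n : ℝ) + 1) ∈ Icc y (y + 1) := by
    intro k hk
    have hk' : (k : ℝ) ≤ n := by exact_mod_cast Nat.lt_succ_iff.1 (Finset.mem_range.1 hk)
    refine ⟨le_add_of_nonneg_right (by positivity), ?_⟩
    have : (k : ℝ) / (n + 1) ≤ 1 := (div_le_one hpos).2 (by linarith)
    linarith
  choose! f hfS hf using fun (k : ℕ) (hk : k ∈ Finset.range (n + 1)) => hcon _ (hmem k hk)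
  obtain ⟨j, hj, k, hk, hjk, hfjk⟩ := Finset.exists_ne_map_eq_of_card_lt_of_maps_to
    (s := Finset.range (n + 1)) (t := S) (f := f) (by simp [n]) (fun k hk => hfS k hk)
  have h1 := hf j hj
  have h2 := hf k hk
  rw [hfjk] at h1
  have h3 : |(j : ℝ) - k| / (n + 1) < 1 / (n + 1) := by
    have e : ((j : ℝ) - k) / (n + 1) =
        (y + j / ((n : ℝ) + 1) - (f k).im) - (y + k / ((n : ℝ) + 1) - (f k).im) := by
      field_simp
      ring
    rw [← abs_of_pos hpos, ← abs_div, abs_of_pos hpos, e]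
    refine (abs_sub _ _).trans_lt ?_
    have : 1 / ((n : ℝ) + 1) = 1 / (2 * ((n : ℝ) + 1)) + 1 / (2 * ((n : ℝ) + 1)) := by
      field_simp; norm_num
    rw [this]
    exact add_lt_add h1 h2
  rw [div_lt_div_iff_of_pos_right hpos] at h3
  have h4 : |(j : ℤ) - k| < 1 := by exact_mod_cast h3
  rw [Int.abs_lt_one_iff, sub_eq_zero] at h4
  exact hjk (by exact_mod_cast h4)

theorem mem_closedBall_three {σ y Y : ℝ} (h1 : -1 / 2 ≤ σ) (h2 : σ ≤ 3 / 2) (h3 : |Y - y| ≤ 1) :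
    (σ + Y * I : ℂ) ∈ Metric.closedBall (2 + y * I : ℂ) 3 := by
  rw [mem_closedBall_iff_norm]
  have h : ‖(σ + Y * I - (2 + y * I) : ℂ)‖ ^ 2 ≤ 3 ^ 2 := by
    rw [← normSq_eq_norm_sq, normSq_apply]
    simp
    have := abs_le.1 h3
    nlinarith
  exact le_of_sq_le_sq h (by norm_num)

/-- There are horizontal lines on which the logarithmic derivative is polynomially bounded. -/
theorem exists_height_norm_logDeriv_le :
    ∃ C : ℝ, 0 ≤ C ∧ ∀ y : ℝ, 21 ≤ |y| → ∃ Y ∈ Icc y (y + 1), ∀ σ : ℝ, -1 / 2 ≤ σ → σ ≤ 3 / 2 →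
      riemannZeta (σ + Y * I) ≠ 0 ∧ ‖logDeriv riemannZeta (σ + Y * I)‖ ≤ C * y ^ 2 := by
  obtain ⟨C₁, hC₁1, hC₁⟩ := exists_norm_zetaEntire_le
  obtain ⟨C₂, hC₂1, hC₂⟩ := exists_sum_zetaMult_le
  refine ⟨2 * C₂ * (C₂ + 1) + 28 * C₁ + 1, by positivity, fun y hy => ?_⟩
  have hfin := (isCompact_closedBall (2 + y * I : ℂ) 4).inter_riemannZetaZeros_finite
  set S := hfin.toFinset with hSdef
  have hS : ∀ ρ, ρ ∈ S ↔ ρ ∈ Metric.closedBall (2 + y * I : ℂ) 4 ∧ zetaEntire ρ = 0 := by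
    intro ρ
    rw [hSdef, Finite.mem_toFinset, mem_inter_iff, mem_riemannZetaZeros, zetaEntire_eq_zero_iff]
  obtain ⟨Y, hY, hfar⟩ := exists_height_far_from y S
  refine ⟨Y, hY, fun σ h1 h2 => ?_⟩
  have hYy : |Y - y| ≤ 1 := by
    rw [abs_le]
    constructor <;> linarith [hY.1, hY.2]
  set s : ℂ := σ + Y * I with hs
  have hsim : s.im = Y := by simp [hs]
  have hball := mem_closedBall_three h1 h2 hYy
  have hpos : (0 : ℝ) < 1 / (2 * ((S.card : ℝ) + 1)) := by positivity
  have hne : zetaEntire s ≠ 0 := by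
    intro h0
    have := hfar s ((hS s).2 ⟨Metric.closedBall_subset_closedBall (by norm_num) hball, h0⟩)
    rw [hsim, sub_self, abs_zero] at this
    linarith
  have hne' : riemannZeta s ≠ 0 := fun h => hne (zetaEntire_eq_zero_iff.2 h)
  have hc : zetaEntire (2 + y * I) ≠ 0 := by
    rw [Ne, zetaEntire_eq_zero_iff]
    exact riemannZeta_ne_zero_of_one_le_re (by simp)
  have hYabs : 20 ≤ |Y| := by
    have := abs_sub_abs_le_abs_sub y Y
    rw [abs_sub_comm] at this
    linarith
  have hs1 : 20 ≤ ‖s - 1‖ := by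
    have := abs_im_le_norm (s - 1)
    rw [sub_im, hsim, one_im, sub_zero] at this
    linarith
  have hs1' : s ≠ 1 := by rintro h; rw [h] at hs1; norm_num at hs1
  refine ⟨hne', ?_⟩
  have hmain := norm_logDeriv_le_sum_add differentiable_zetaEntire hc
    (by positivity : 0 < C₁ * |y|) (hC₁ y (by linarith)) hS hball hne
  have hρ1 : ∀ ρ ∈ S, ρ ≠ 1 := by
    rintro ρ hρ rfl
    have := ((hS 1).1 hρ).2
    rw [zetaEntire_one] at this
    exact one_ne_zero this
  have hcount : (∑ ρ ∈ S, (zetaMult ρ : ℝ)) ≤ C₂ * |y| :=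
    hC₂ y (by linarith) S fun ρ hρ => ((hS ρ).1 hρ).1
  have hcard : (S.card : ℝ) ≤ C₂ * |y| := by
    refine le_trans ?_ hcount
    rw [Finset.card_eq_sum_ones]
    push_cast
    refine Finset.sum_le_sum fun ρ hρ => ?_
    exact_mod_cast one_le_zetaMult (zetaEntire_eq_zero_iff.1 ((hS ρ).1 hρ).2)
  -- A linear number of zeros, at distances no smaller than the inverse of a linear quantity: hence
  -- a quadratic bound.
  have hsum : ∑ ρ ∈ S, (analyticOrderNatAt zetaEntire ρ : ℝ) / ‖s - ρ‖ ≤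
      C₂ * |y| * (2 * (C₂ * |y| + 1)) := by
    calc _ ≤ ∑ ρ ∈ S, (zetaMult ρ : ℝ) * (2 * ((S.card : ℝ) + 1)) := by
          refine Finset.sum_le_sum fun ρ hρ => ?_
          rw [analyticOrderNatAt_zetaEntire (hρ1 ρ hρ), div_eq_mul_inv]
          refine mul_le_mul_of_nonneg_left ?_ (Nat.cast_nonneg _)
          have h3 := hfar ρ hρ
          have h4 : |Y - ρ.im| ≤ ‖s - ρ‖ := by
            have := abs_im_le_norm (s - ρ)
            rwa [sub_im, hsim] at this
          rw [inv_le_comm₀ (hpos.trans_le (h3.trans h4)) (by positivity), ← one_div]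
          exact h3.trans h4
      _ = (∑ ρ ∈ S, (zetaMult ρ : ℝ)) * (2 * ((S.card : ℝ) + 1)) := by rw [Finset.sum_mul]
      _ ≤ _ := by gcongr
  have hlog := logDeriv_zetaEntire hs1' hne'
  have heq : logDeriv riemannZeta s = logDeriv zetaEntire s - 1 / (s - 1) := by
    rw [hlog]; ring
  have h1s : ‖1 / (s - 1)‖ ≤ 1 := by
    rw [norm_div, norm_one, div_le_one (by linarith)]
    linarith
  rw [heq]
  refine (norm_sub_le _ _).trans ?_
  have hy1 : 1 ≤ |y| := by linarith
  have hy2 : |y| ≤ |y| ^ 2 := by nlinarith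
  rw [← sq_abs y]
  have hC20 : 0 ≤ C₂ := by linarith
  have hC10 : 0 ≤ C₁ := by linarith
  nlinarith [mul_le_mul_of_nonneg_left hy2 hC20, mul_le_mul_of_nonneg_left hy2 hC10]

end ZeroCounting


/-! ### Absolutely convergent sums over zeros, and the residue theorem in the strip. -/

section StripResidue
open Complex MeasureTheory Set

open Classical in
/-- The multiplicity of a zero of `ζ` in the strip `-1 / 2 < Re s < 3 / 2`, and zero elsewhere. -/
noncomputable def stripMult (ρ : ℂ) : ℝ :=
  if riemannZeta ρ = 0 ∧ -1 / 2 < ρ.re ∧ ρ.re < 3 / 2 then zetaMult ρ else 0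

theorem stripMult_of_mem {ρ : ℂ} (h : riemannZeta ρ = 0 ∧ -1 / 2 < ρ.re ∧ ρ.re < 3 / 2) :
    stripMult ρ = zetaMult ρ := if_pos h

theorem stripMult_of_notMem {ρ : ℂ} (h : ¬ (riemannZeta ρ = 0 ∧ -1 / 2 < ρ.re ∧ ρ.re < 3 / 2)) :
    stripMult ρ = 0 := if_neg h

theorem stripMult_nonneg (ρ : ℂ) : 0 ≤ stripMult ρ := by
  unfold stripMult
  split_ifs <;> positivity

theorem summable_int_inv_one_add_sq : Summable fun k : ℤ => (1 + (k : ℝ) ^ 2)⁻¹ := by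
  have h1 : Summable fun k : ℤ => 1 / (k : ℝ) ^ 2 := Real.summable_one_div_int_pow.2 one_lt_two
  have h2 : Summable fun k : ℤ => if k = 0 then (1 : ℝ) else 0 :=
    summable_of_ne_finset_zero (s := {0}) fun k hk => by simpa using hk
  refine Summable.of_nonneg_of_le (fun k => by positivity) (fun k => ?_) (h1.add h2)
  by_cases hk : k = 0
  · simp [hk]
  · have : (0 : ℝ) < (k : ℝ) ^ 2 := by positivity
    simp only [hk, if_false, add_zero, ← one_div]
    exact one_div_le_one_div_of_le this (by linarith)

/-- The zeros in the strip at heights in a unit interval number at most linearly many. -/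
theorem exists_sum_stripMult_floor_le :
    ∃ C : ℝ, 0 ≤ C ∧ ∀ (k : ℤ) (S : Finset ℂ), (∀ ρ ∈ S, ⌊ρ.im⌋ = k) →
      ∑ ρ ∈ S, stripMult ρ ≤ C * (1 + |(k : ℝ)|) := by
  classical
  obtain ⟨C, hC1, hC⟩ := exists_sum_zetaMult_le
  have hK : IsCompact (Icc (-1 / 2 : ℝ) (3 / 2) ×ℂ Icc (-21 : ℝ) 21) :=
    isCompact_Icc.reProdIm isCompact_Icc
  set B := ∑ ρ ∈ hK.inter_riemannZetaZeros_finite.toFinset, (zetaMult ρ : ℝ)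
  have hB : 0 ≤ B := Finset.sum_nonneg fun _ _ => Nat.cast_nonneg _
  refine ⟨C + B, by linarith, fun k S hS => ?_⟩
  set S' := S.filter fun ρ => riemannZeta ρ = 0 ∧ -1 / 2 < ρ.re ∧ ρ.re < 3 / 2
  have hSS : ∑ ρ ∈ S, stripMult ρ = ∑ ρ ∈ S', (zetaMult ρ : ℝ) := by
    rw [Finset.sum_filter]
    refine Finset.sum_congr rfl fun ρ _ => ?_
    unfold stripMult
    split_ifs <;> rfl
  have him : ∀ ρ ∈ S', (k : ℝ) ≤ ρ.im ∧ ρ.im < k + 1 := fun ρ hρ => by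
    have := Int.floor_eq_iff.1 (hS ρ (Finset.mem_filter.1 hρ).1)
    exact this
  rw [hSS]
  by_cases hk : 20 ≤ |(k : ℝ)|
  · have := hC k hk S' fun ρ hρ => by
      obtain ⟨-, -, h1, h2⟩ := Finset.mem_filter.1 hρ
      obtain ⟨h3, h4⟩ := him ρ hρ
      have := mem_closedBall_three h1.le h2.le (y := k) (Y := ρ.im) (by
        rw [abs_le]; constructor <;> linarith)
      rw [re_add_im] at this
      exact Metric.closedBall_subset_closedBall (by norm_num) this
    refine this.trans ?_
    nlinarith [abs_nonneg (k : ℝ)]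
  · have hle : ∑ ρ ∈ S', (zetaMult ρ : ℝ) ≤ B := by
      refine Finset.sum_le_sum_of_subset_of_nonneg (fun ρ hρ => ?_) fun _ _ _ => Nat.cast_nonneg _
      obtain ⟨-, h0, h1, h2⟩ := Finset.mem_filter.1 hρ
      obtain ⟨h3, h4⟩ := him ρ hρ
      push Not at hk
      have hk' := abs_lt.1 hk
      rw [Finite.mem_toFinset]
      exact ⟨⟨⟨h1.le, h2.le⟩, ⟨by linarith, by linarith⟩⟩, h0⟩
    refine hle.trans ?_
    nlinarith [abs_nonneg (k : ℝ)]

/-- At most C(1 + |k|) zeros at heights in [k, k+1) against a weight of order (1 + k²)^(-2). The sum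
serves both for convergence and, later, as a crude count of zeros up to a given height. -/
theorem summable_stripMult :
    Summable fun ρ : ℂ => stripMult ρ * ((1 + ρ.im ^ 2) ^ 2)⁻¹ := by
  classical
  obtain ⟨C, hC0, hC⟩ := exists_sum_stripMult_floor_le
  refine summable_of_sum_le (c := ∑' k : ℤ, 18 * C * (1 + (k : ℝ) ^ 2)⁻¹)
    (fun ρ => mul_nonneg (stripMult_nonneg ρ) (by positivity)) fun S => ?_
  rw [← Finset.sum_fiberwise_of_maps_to (t := S.image fun ρ => ⌊ρ.im⌋) (g := fun ρ => ⌊ρ.im⌋)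
    (fun ρ hρ => Finset.mem_image_of_mem _ hρ)]
  refine le_trans (Finset.sum_le_sum fun k _ => ?_)
    ((summable_int_inv_one_add_sq.mul_left (18 * C)).sum_le_tsum _ fun k _ => by positivity)
  have hfib : ∀ ρ ∈ S.filter (fun ρ => ⌊ρ.im⌋ = k), ⌊ρ.im⌋ = k := fun ρ hρ =>
    (Finset.mem_filter.1 hρ).2
  calc ∑ ρ ∈ S.filter (fun ρ => ⌊ρ.im⌋ = k), stripMult ρ * ((1 + ρ.im ^ 2) ^ 2)⁻¹
      ≤ ∑ ρ ∈ S.filter (fun ρ => ⌊ρ.im⌋ = k), stripMult ρ * (9 * ((1 + (k : ℝ) ^ 2) ^ 2)⁻¹) := by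
        refine Finset.sum_le_sum fun ρ hρ => mul_le_mul_of_nonneg_left ?_ (stripMult_nonneg ρ)
        have h := Int.floor_eq_iff.1 (hfib ρ hρ)
        have h0 : (ρ.im - k) ^ 2 ≤ 1 := by
          rw [sq_le_one_iff_abs_le_one, abs_le]
          constructor <;> linarith
        have h1 : 1 + (k : ℝ) ^ 2 ≤ 3 * (1 + ρ.im ^ 2) := by
          nlinarith [sq_nonneg (2 * ρ.im - k), sq_nonneg ρ.im]
        have h2 : (1 + (k : ℝ) ^ 2) ^ 2 ≤ 9 * (1 + ρ.im ^ 2) ^ 2 := by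
          have := pow_le_pow_left₀ (by positivity) h1 2
          linarith
        rw [← div_eq_mul_inv, le_div_iff₀ (by positivity), inv_mul_le_iff₀ (by positivity)]
        linarith
    _ = (∑ ρ ∈ S.filter (fun ρ => ⌊ρ.im⌋ = k), stripMult ρ) * (9 * ((1 + (k : ℝ) ^ 2) ^ 2)⁻¹) := by
        rw [Finset.sum_mul]
    _ ≤ (C * (1 + |(k : ℝ)|)) * (9 * ((1 + (k : ℝ) ^ 2) ^ 2)⁻¹) := by
        gcongr
        exact hC k _ hfib
    _ ≤ (C * (2 * (1 + (k : ℝ) ^ 2))) * (9 * ((1 + (k : ℝ) ^ 2) ^ 2)⁻¹) := by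
        gcongr
        rw [← sq_abs (k : ℝ)]
        nlinarith [sq_nonneg (|(k : ℝ)| - 1), abs_nonneg (k : ℝ)]
    _ = 18 * C * (1 + (k : ℝ) ^ 2)⁻¹ := by
        field_simp
        ring

/-- Quartic decay in the closed strip `-1 / 2 ≤ Re s ≤ 3 / 2`. -/
def StripDecay (φ : ℂ → ℂ) : Prop :=
  ∃ K : ℝ, 0 ≤ K ∧ ∀ s : ℂ, -1 / 2 ≤ s.re → s.re ≤ 3 / 2 → ‖φ s‖ ≤ K * ((1 + s.im ^ 2) ^ 2)⁻¹

theorem StripDecay.summable {φ : ℂ → ℂ} (hφ : StripDecay φ) :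
    Summable fun ρ : ℂ => (stripMult ρ : ℂ) * φ ρ := by
  obtain ⟨K, hK0, hK⟩ := hφ
  refine Summable.of_norm_bounded (summable_stripMult.mul_left K) fun ρ => ?_
  rw [norm_mul, norm_real, Real.norm_of_nonneg (stripMult_nonneg ρ)]
  by_cases h : riemannZeta ρ = 0 ∧ -1 / 2 < ρ.re ∧ ρ.re < 3 / 2
  · have := mul_le_mul_of_nonneg_left (hK ρ h.2.1.le h.2.2.le) (stripMult_nonneg ρ)
    linarith
  · simp [stripMult_of_notMem h]

theorem continuous_logDeriv_riemannZeta_vertical {σ : ℝ} (hσ : σ ≠ 1)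
    (h0 : ∀ t : ℝ, riemannZeta (σ + t * I) ≠ 0) :
    Continuous fun t : ℝ => logDeriv riemannZeta (σ + t * I) := by
  have hne : ∀ t : ℝ, (σ + t * I : ℂ) ≠ 1 := fun t h => hσ (by simpa using congrArg re h)
  rw [continuous_iff_continuousAt]
  intro t
  refine ContinuousAt.comp' (f := fun t : ℝ => (σ + t * I : ℂ)) (g := logDeriv riemannZeta) ?_
    (by fun_prop)
  have hA : AnalyticAt ℂ riemannZeta (σ + t * I) := analyticOn_riemannZeta _ (hne t)
  exact hA.deriv.continuousAt.div hA.continuousAt (h0 t)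

theorem integrable_inv_one_add_sq_sq : Integrable fun t : ℝ => ((1 + t ^ 2) ^ 2)⁻¹ := by
  refine integrable_inv_one_add_sq.mono' (by fun_prop) (ae_of_all _ fun t => ?_)
  rw [Real.norm_of_nonneg (by positivity)]
  refine inv_anti₀ (by positivity) ?_
  nlinarith [sq_nonneg t, sq_nonneg (t ^ 2)]

theorem riemannZeta_ne_zero_right (t : ℝ) : riemannZeta ((3 / 2 : ℝ) + t * I) ≠ 0 :=
  riemannZeta_ne_zero_of_one_le_re (by simp; norm_num)

theorem riemannZeta_ne_zero_left (t : ℝ) : riemannZeta ((-1 / 2 : ℝ) + t * I) ≠ 0 := by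
  obtain ⟨C, -, hC⟩ := exists_norm_logDeriv_riemannZeta_left_le
  have := (hC t).1
  push_cast
  exact this

theorem StripDecay.integrable_right {φ : ℂ → ℂ} (hφ : StripDecay φ) (hd : Differentiable ℂ φ) :
    Integrable fun t : ℝ => φ ((3 / 2 : ℝ) + t * I) * logDeriv riemannZeta ((3 / 2 : ℝ) + t * I) := by
  obtain ⟨K, hK0, hK⟩ := hφ
  set A := ∑' n : ℕ, ArithmeticFunction.vonMangoldt n * Real.exp (-(Real.log n * (3 / 2)))
  have hcont : Continuous fun t : ℝ =>
      φ ((3 / 2 : ℝ) + t * I) * logDeriv riemannZeta ((3 / 2 : ℝ) + t * I) :=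
    (hd.continuous.comp (by fun_prop)).mul
      (continuous_logDeriv_riemannZeta_vertical (by norm_num) riemannZeta_ne_zero_right)
  refine (integrable_inv_one_add_sq_sq.const_mul (K * A)).mono' hcont.aestronglyMeasurable
    (ae_of_all _ fun t => ?_)
  rw [norm_mul]
  have h1 := hK ((3 / 2 : ℝ) + t * I) (by simp; norm_num) (by simp)
  have h2 := norm_logDeriv_riemannZeta_le (s := (3 / 2 : ℝ) + t * I) (by simp; norm_num)
  have e1 : (((3 / 2 : ℝ) : ℂ) + t * I).re = 3 / 2 := by simp
  have e2 : (((3 / 2 : ℝ) : ℂ) + t * I).im = t := by simp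
  rw [e1] at h2
  rw [e2] at h1
  calc _ ≤ (K * ((1 + t ^ 2) ^ 2)⁻¹) * A := mul_le_mul h1 h2 (norm_nonneg _) (by positivity)
    _ = _ := by ring

theorem StripDecay.integrable_left {φ : ℂ → ℂ} (hφ : StripDecay φ) (hd : Differentiable ℂ φ) :
    Integrable fun t : ℝ => φ ((-1 / 2 : ℝ) + t * I) * logDeriv riemannZeta ((-1 / 2 : ℝ) + t * I) := by
  obtain ⟨K, hK0, hK⟩ := hφ
  obtain ⟨C, hC0, hC⟩ := exists_norm_logDeriv_riemannZeta_left_le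
  have hcont : Continuous fun t : ℝ =>
      φ ((-1 / 2 : ℝ) + t * I) * logDeriv riemannZeta ((-1 / 2 : ℝ) + t * I) :=
    (hd.continuous.comp (by fun_prop)).mul
      (continuous_logDeriv_riemannZeta_vertical (by norm_num) riemannZeta_ne_zero_left)
  refine (integrable_inv_one_add_sq.const_mul (K * (C + 3))).mono' hcont.aestronglyMeasurable
    (ae_of_all _ fun t => ?_)
  rw [norm_mul]
  have h1 := hK ((-1 / 2 : ℝ) + t * I) (by simp) (by simp; norm_num)
  have e2 : (((-1 / 2 : ℝ) : ℂ) + t * I).im = t := by simp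
  rw [e2] at h1
  have h2 : ‖logDeriv riemannZeta ((-1 / 2 : ℝ) + t * I)‖ ≤ (C + 3) * (1 + t ^ 2) := by
    have h3 := (hC t).2
    push_cast at h3 ⊢
    have h4 : ‖((Real.log (9 / 4 + t ^ 2) / 2 : ℝ) : ℂ)‖ ≤ 9 / 4 + t ^ 2 := by
      rw [norm_real, Real.norm_of_nonneg (div_nonneg (Real.log_nonneg (by nlinarith)) two_pos.le)]
      have := Real.log_le_sub_one_of_pos (by positivity : 0 < 9 / 4 + t ^ 2)
      nlinarith [sq_nonneg t]
    push_cast at h4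
    have h5 := norm_le_norm_add_norm_sub' (logDeriv riemannZeta (-1 / 2 + t * I))
      (-((Real.log (9 / 4 + t ^ 2) : ℂ) / 2))
    rw [sub_neg_eq_add, norm_neg] at h5
    nlinarith [sq_nonneg t]
  calc _ ≤ (K * ((1 + t ^ 2) ^ 2)⁻¹) * ((C + 3) * (1 + t ^ 2)) :=
        mul_le_mul h1 h2 (norm_nonneg _) (by positivity)
    _ = _ := by field_simp

/-- The residue theorem for `φ ζ' / ζ` in the strip `-1 / 2 < Re s < 3 / 2`. -/
theorem tsum_stripMult_mul {φ : ℂ → ℂ} (hd : Differentiable ℂ φ) (hφ : StripDecay φ) :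
    2 * Real.pi * (∑' ρ : ℂ, (stripMult ρ : ℂ) * φ ρ - φ 1) =
      (∫ t : ℝ, φ ((3 / 2 : ℝ) + t * I) * logDeriv riemannZeta ((3 / 2 : ℝ) + t * I)) -
      ∫ t : ℝ, φ ((-1 / 2 : ℝ) + t * I) * logDeriv riemannZeta ((-1 / 2 : ℝ) + t * I) := by
  classical
  obtain ⟨C, hC0, hC⟩ := exists_height_norm_logDeriv_le
  have hup : ∀ n : ℕ, ∃ Y ∈ Icc ((n : ℝ) + 21) (n + 21 + 1), ∀ σ : ℝ, -1 / 2 ≤ σ → σ ≤ 3 / 2 →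
      riemannZeta (σ + Y * I) ≠ 0 ∧
        ‖logDeriv riemannZeta (σ + Y * I)‖ ≤ C * ((n : ℝ) + 21) ^ 2 := fun n => by
    refine hC _ ?_
    rw [abs_of_nonneg (by positivity)]
    linarith [Nat.cast_nonneg (α := ℝ) n]
  -- The shift to n + 22 makes the upper end of the interval -(n + 21), so both edges are at
  -- distance at least n + 21 from the real axis.
  have hdown : ∀ n : ℕ, ∃ Y ∈ Icc (-((n : ℝ) + 22)) (-((n : ℝ) + 22) + 1), ∀ σ : ℝ,
      -1 / 2 ≤ σ → σ ≤ 3 / 2 → riemannZeta (σ + Y * I) ≠ 0 ∧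
        ‖logDeriv riemannZeta (σ + Y * I)‖ ≤ C * (-((n : ℝ) + 22)) ^ 2 := fun n => by
    refine hC _ ?_
    rw [abs_neg, abs_of_nonneg (by positivity)]
    linarith [Nat.cast_nonneg (α := ℝ) n]
  choose U hUI hU using hup
  choose V hVI hV using hdown
  have hUn : ∀ n : ℕ, (n : ℝ) + 21 ≤ U n := fun n => (hUI n).1
  have hVn : ∀ n : ℕ, V n ≤ -((n : ℝ) + 21) := fun n => by linarith [(hVI n).2]
  have hn0 : ∀ n : ℕ, (0 : ℝ) ≤ n := fun n => Nat.cast_nonneg n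
  have hfin : ∀ n, (((Icc (-1 / 2 : ℝ) (3 / 2) ×ℂ Icc (V n) (U n))) ∩ riemannZetaZeros).Finite :=
    fun n => (isCompact_Icc.reProdIm isCompact_Icc).inter_riemannZetaZeros_finite
  set S : ℕ → Finset ℂ := fun n => (hfin n).toFinset.filter fun ρ =>
    -1 / 2 < ρ.re ∧ ρ.re < 3 / 2 ∧ V n < ρ.im ∧ ρ.im < U n with hSdef
  have hS : ∀ n ρ, ρ ∈ S n ↔
      (-1 / 2 < ρ.re ∧ ρ.re < 3 / 2 ∧ V n < ρ.im ∧ ρ.im < U n) ∧ zetaEntire ρ = 0 := by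
    intro n ρ
    simp only [hSdef, Finset.mem_filter, Finite.mem_toFinset, zetaEntire_eq_zero_iff]
    constructor
    · rintro ⟨⟨-, h⟩, h'⟩
      exact ⟨h', h⟩
    · rintro ⟨h', h⟩
      exact ⟨⟨⟨⟨h'.1.le, h'.2.1.le⟩, ⟨h'.2.2.1.le, h'.2.2.2.le⟩⟩, h⟩, h'⟩
  have hbd : ∀ n, ∀ s : ℂ, -1 / 2 ≤ s.re → s.re ≤ 3 / 2 → V n ≤ s.im → s.im ≤ U n →
      (s.re = -1 / 2 ∨ s.re = 3 / 2 ∨ s.im = V n ∨ s.im = U n) →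
      riemannZeta s ≠ 0 ∧ s ≠ 1 := by
    intro n s h1 h2 h3 h4 h
    have hs : s = (s.re : ℂ) + s.im * I := (re_add_im s).symm
    refine ⟨?_, ?_⟩
    · rcases h with h | h | h | h
      · rw [hs, h]; exact riemannZeta_ne_zero_left _
      · rw [hs, h]; exact riemannZeta_ne_zero_right _
      · rw [hs, h]; exact (hV n _ h1 h2).1
      · rw [hs, h]; exact (hU n _ h1 h2).1
    · rintro rfl
      simp only [one_re, one_im] at h
      rcases h with h | h | h | h
      · norm_num at h
      · norm_num at h
      · linarith [hVn n, hn0 n]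
      · linarith [hUn n, hn0 n]
  -- On the boundary ζ'/ζ is the logarithmic derivative of `zetaEntire` minus 1/(s - 1); the
  -- subtracted term produces -φ(1).
  have hrect : ∀ n, rectIntegral (fun s => φ s * logDeriv riemannZeta s) (-1 / 2) (3 / 2)
      (V n) (U n) = 2 * Real.pi * I * (∑ ρ ∈ S n, (stripMult ρ : ℂ) * φ ρ - φ 1) := by
    intro n
    have hcd : V n ≤ U n := by linarith [hVn n, hUn n, hn0 n]
    have hab : (-1 / 2 : ℝ) ≤ 3 / 2 := by norm_num
    have h1 := rectIntegral_mul_logDeriv differentiable_zetaEntire hd hab hcd (hS n)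
      fun s h1 h2 h3 h4 h => fun h0 => (hbd n s h1 h2 h3 h4 h).1 (zetaEntire_eq_zero_iff.1 h0)
    have ha1 : (-1 / 2 : ℝ) < (1 : ℂ).re := by norm_num
    have hb1 : (1 : ℂ).re < 3 / 2 := by norm_num
    have hc1 : V n < (1 : ℂ).im := by simp; linarith [hVn n, hn0 n]
    have hd1 : (1 : ℂ).im < U n := by simp; linarith [hUn n, hn0 n]
    have h2 := rectIntegral_div_sub hd ha1 hb1 hc1 hd1
    have h2c := rectContinuous_div_sub hd ha1 hb1 hc1 hd1
    rw [rectIntegral_congr (g := fun s => φ s * logDeriv zetaEntire s + (-1) * (φ s / (s - 1)))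
      hab hcd, rectIntegral_add _ (h2c.const_mul (-1)), rectIntegral_const_mul, h1, h2]
    · have : ∑ ρ ∈ S n, (analyticOrderNatAt zetaEntire ρ : ℂ) * φ ρ =
          ∑ ρ ∈ S n, (stripMult ρ : ℂ) * φ ρ := by
        refine Finset.sum_congr rfl fun ρ hρ => ?_
        have h3 := (hS n ρ).1 hρ
        have h4 := zetaEntire_eq_zero_iff.1 h3.2
        rw [analyticOrderNatAt_zetaEntire (by rintro rfl; exact riemannZeta_one_ne_zero h4),
          stripMult_of_mem ⟨h4, h3.1.1, h3.1.2.1⟩]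
        push_cast
        rfl
      rw [this]
      ring
    · refine RectContinuous.of_continuousAt hab hcd fun s h1 h2 h3 h4 h => ?_
      have hA := differentiable_zetaEntire.analyticAt s
      exact (hd s).continuousAt.mul (hA.deriv.continuousAt.div hA.continuousAt
        fun h0 => (hbd n s h1 h2 h3 h4 h).1 (zetaEntire_eq_zero_iff.1 h0))
    · intro s h1 h2 h3 h4 h
      obtain ⟨h5, h6⟩ := hbd n s h1 h2 h3 h4 h
      rw [logDeriv_zetaEntire h6 h5]
      ring
  obtain ⟨K, hK0, hK⟩ := id hφ
  have hUt : Tendsto U atTop atTop := tendsto_atTop_mono (fun n => by linarith [hUn n, hn0 n])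
    tendsto_natCast_atTop_atTop
  have hVt : Tendsto V atTop atBot := by
    refine tendsto_atBot_mono (fun n => (by linarith [hVn n, hn0 n] : V n ≤ -(n : ℝ))) ?_
    exact tendsto_neg_atTop_atBot.comp tendsto_natCast_atTop_atTop
  -- Quartic decay of φ against the quadratic bound for ζ'/ζ on the selected heights makes the
  -- horizontal edges vanish in the limit.
  have hhor : ∀ W : ℕ → ℝ, (∀ n : ℕ, (n : ℝ) + 21 ≤ |W n|) →
      (∀ n : ℕ, ∀ σ : ℝ, -1 / 2 ≤ σ → σ ≤ 3 / 2 →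
        ‖logDeriv riemannZeta (σ + W n * I)‖ ≤ C * ((n : ℝ) + 22) ^ 2) →
      Tendsto (fun n => ∫ x : ℝ in (-1 / 2 : ℝ)..(3 / 2), φ (x + W n * I) *
        logDeriv riemannZeta (x + W n * I)) atTop (𝓝 0) := by
    intro W hW1 hW2
    have hlim : Tendsto (fun n : ℕ => K * C * 8 * (1 / ((n : ℝ) + 1))) atTop (𝓝 0) := by
      simpa using tendsto_one_div_add_atTop_nhds_zero_nat.const_mul (K * C * 8)
    refine squeeze_zero_norm (fun n => ?_) hlim
    have hb : ∀ x ∈ Set.uIoc (-1 / 2 : ℝ) (3 / 2), ‖φ (x + W n * I) *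
        logDeriv riemannZeta (x + W n * I)‖ ≤ K * C * 4 * (1 / ((n : ℝ) + 1)) := by
      intro x hx
      rw [uIoc_of_le (by norm_num)] at hx
      have h1 := hK (x + W n * I) (by simpa using hx.1.le) (by simpa using hx.2)
      have h2 := hW2 n x hx.1.le hx.2
      have e : (x + W n * I : ℂ).im = W n := by simp
      rw [e] at h1
      rw [norm_mul]
      have h3 : ((n : ℝ) + 21) ^ 2 ≤ W n ^ 2 := by
        rw [← sq_abs (W n)]
        exact pow_le_pow_left₀ (by positivity) (hW1 n) 2
      have h4 : ((1 + W n ^ 2) ^ 2)⁻¹ ≤ ((1 + ((n : ℝ) + 21) ^ 2) ^ 2)⁻¹ := by gcongr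
      calc _ ≤ (K * ((1 + ((n : ℝ) + 21) ^ 2) ^ 2)⁻¹) * (C * ((n : ℝ) + 22) ^ 2) :=
            mul_le_mul (h1.trans (by gcongr)) h2 (norm_nonneg _) (by positivity)
        _ = K * C * (((n : ℝ) + 22) ^ 2 / (1 + ((n : ℝ) + 21) ^ 2) ^ 2) := by
            rw [div_eq_mul_inv]; ring
        _ ≤ K * C * (4 * (1 / ((n : ℝ) + 1))) := by
            gcongr
            rw [div_le_iff₀ (by positivity), mul_one_div, div_mul_eq_mul_div,
              le_div_iff₀ (by positivity)]
            have := hn0 n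
            have h5 : ((n : ℝ) + 22) ^ 2 ≤ 2 * (1 + ((n : ℝ) + 21) ^ 2) := by nlinarith
            have h6 : (n : ℝ) + 1 ≤ 1 + ((n : ℝ) + 21) ^ 2 := by nlinarith
            have h7 : ((n : ℝ) + 22) ^ 2 * (n + 1) ≤
                (2 * (1 + ((n : ℝ) + 21) ^ 2)) * (1 + ((n : ℝ) + 21) ^ 2) :=
              mul_le_mul h5 h6 (by positivity) (by positivity)
            nlinarith
        _ = _ := by ring
    refine (intervalIntegral.norm_integral_le_of_norm_le_const hb).trans (le_of_eq ?_)
    norm_num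
    ring
  have hleft := intervalIntegral_tendsto_integral (hφ.integrable_left hd) hVt hUt
  have hright := intervalIntegral_tendsto_integral (hφ.integrable_right hd) hVt hUt
  have hbot := hhor V (fun n => by
    rw [abs_of_nonpos (by linarith [hVn n, hn0 n])]; linarith [hVn n]) fun n σ h1 h2 => by
      have := (hV n σ h1 h2).2
      rwa [neg_sq] at this
  have htop := hhor U (fun n => by
    rw [abs_of_nonneg (by linarith [hUn n, hn0 n])]; exact hUn n) fun n σ h1 h2 => by
      refine (hU n σ h1 h2).2.trans ?_
      have := hn0 n
      gcongr
      norm_num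
  have hlim1 := ((hbot.sub htop).add (hright.const_smul I)).sub (hleft.const_smul I)
  have hSlim : Tendsto (fun n => ∑ ρ ∈ S n, (stripMult ρ : ℂ) * φ ρ) atTop
      (𝓝 (∑' ρ : ℂ, (stripMult ρ : ℂ) * φ ρ)) := by
    have := tendsto_tsum_of_dominated_convergence (𝓕 := atTop) hφ.summable.norm
      (f := fun n ρ => (S n : Set ℂ).indicator (fun ρ => (stripMult ρ : ℂ) * φ ρ) ρ)
      (g := fun ρ => (stripMult ρ : ℂ) * φ ρ) (fun ρ => ?_)
      (Eventually.of_forall fun n ρ => norm_indicator_le_norm_self _ _)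
    · refine this.congr fun n => ?_
      rw [tsum_eq_sum (s := S n) fun ρ hρ => indicator_of_notMem (by simpa using hρ) _]
      exact Finset.sum_congr rfl fun ρ hρ => indicator_of_mem (by simpa using hρ) _
    · refine tendsto_nhds_of_eventually_eq ?_
      filter_upwards [hUt.eventually_gt_atTop ρ.im, hVt.eventually_lt_atBot ρ.im] with n h1 h2
      by_cases h : riemannZeta ρ = 0 ∧ -1 / 2 < ρ.re ∧ ρ.re < 3 / 2
      · exact indicator_of_mem
          ((hS n ρ).2 ⟨⟨h.2.1, h.2.2, h2, h1⟩, zetaEntire_eq_zero_iff.2 h.1⟩) _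
      · rw [indicator_apply]
        simp [stripMult_of_notMem h]
  have hlim2 := (hSlim.sub_const (φ 1)).const_mul (2 * Real.pi * I)
  have huniq := tendsto_nhds_unique (hlim2.congr fun n => (hrect n).symm) hlim1
  simp only [smul_eq_mul, sub_zero, zero_add] at huniq
  apply mul_left_cancel₀ I_ne_zero
  linear_combination huniq

end StripResidue


/-! ### The explicit formula for Gaussian test functions. -/

section ExplicitFormula
open Complex MeasureTheory Set

/-- The Gaussian test function centred at height `T`, of width `Δ`, twisted by the frequency `x`. -/
noncomputable def gaussTest (Δ T x : ℝ) (s : ℂ) : ℂ :=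
  exp ((s - 1 / 2 - T * I) ^ 2 / Δ ^ 2 + x * (s - 1 / 2))

/-- The Fourier transform of `gaussTest` along vertical lines. -/
noncomputable def gaussKer (Δ T y : ℝ) : ℂ :=
  ((Real.sqrt Real.pi * Δ * Real.exp (-(Δ ^ 2 * y ^ 2 / 4)) : ℝ) : ℂ) * exp ((T * y : ℝ) * I)

/-- The weight on the line `Re s = -1 / 2` in the explicit formula for `gaussTest`. -/
noncomputable def leftWeight (Δ T L t : ℝ) : ℂ :=
  exp ((-1 + (t - T) * I) ^ 2 / Δ ^ 2) * (-logDeriv riemannZeta (-1 / 2 + t * I) - L)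

theorem norm_gaussTest (Δ T x : ℝ) (s : ℂ) : ‖gaussTest Δ T x s‖ =
    Real.exp (((s.re - 1 / 2) ^ 2 - (s.im - T) ^ 2) / Δ ^ 2 + x * (s.re - 1 / 2)) := by
  rw [gaussTest, norm_exp]
  congr 1
  have h1 : ((s - 1 / 2 - T * I) ^ 2 / (Δ : ℂ) ^ 2).re =
      ((s.re - 1 / 2) ^ 2 - (s.im - T) ^ 2) / Δ ^ 2 := by
    rw [show ((Δ : ℂ) ^ 2) = ((Δ ^ 2 : ℝ) : ℂ) by push_cast; rfl, div_ofReal_re]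
    congr 1
    rw [sq, mul_re]
    simp
    ring
  rw [add_re, h1, re_ofReal_mul]
  simp

theorem norm_gaussKer {Δ : ℝ} (hΔ : 0 < Δ) (T y : ℝ) :
    ‖gaussKer Δ T y‖ = Real.sqrt Real.pi * Δ * Real.exp (-(Δ ^ 2 * y ^ 2 / 4)) := by
  rw [gaussKer, norm_mul, norm_exp_ofReal_mul_I, mul_one, norm_real,
    Real.norm_of_nonneg (by positivity)]

theorem differentiable_gaussTest (Δ T x : ℝ) : Differentiable ℂ (gaussTest Δ T x) := by
  unfold gaussTest
  fun_prop

/-- Converts a Gaussian centred at T into the quartic decay about 0 demanded by `StripDecay`, at a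
cost polynomial in T and D. -/
theorem exp_neg_sq_div_le {D : ℝ} (hD : 0 < D) (T t : ℝ) :
    Real.exp (-(t - T) ^ 2 / D) ≤ 2 * (1 + 2 * T ^ 2 + 2 * D) ^ 2 * ((1 + t ^ 2) ^ 2)⁻¹ := by
  set w := (t - T) ^ 2 / D with hw
  have hw0 : 0 ≤ w := by positivity
  have hwD : w * D = (t - T) ^ 2 := by rw [hw]; field_simp
  have h1 : 1 + t ^ 2 ≤ (1 + 2 * T ^ 2 + 2 * D) * (1 + w) := by
    nlinarith [sq_nonneg (t - 2 * T), mul_nonneg hw0 (sq_nonneg T)]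
  have h2 : (1 + w) ^ 2 ≤ 2 * Real.exp w := by
    nlinarith [Real.quadratic_le_exp_of_nonneg hw0]
  have h3 : (1 + t ^ 2) ^ 2 ≤ (1 + 2 * T ^ 2 + 2 * D) ^ 2 * (2 * Real.exp w) := by
    calc (1 + t ^ 2) ^ 2 ≤ ((1 + 2 * T ^ 2 + 2 * D) * (1 + w)) ^ 2 :=
          pow_le_pow_left₀ (by positivity) h1 2
      _ = (1 + 2 * T ^ 2 + 2 * D) ^ 2 * (1 + w) ^ 2 := by ring
      _ ≤ _ := by gcongr
  rw [show -(t - T) ^ 2 / D = -w by rw [hw]; ring, Real.exp_neg, ← div_eq_mul_inv,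
    le_div_iff₀ (by positivity), inv_mul_le_iff₀ (by positivity)]
  linarith

theorem stripDecay_gaussTest {Δ : ℝ} (hΔ : 0 < Δ) (T x : ℝ) : StripDecay (gaussTest Δ T x) := by
  refine ⟨Real.exp (1 / Δ ^ 2 + |x|) * (2 * (1 + 2 * T ^ 2 + 2 * Δ ^ 2) ^ 2), by positivity,
    fun s h1 h2 => ?_⟩
  rw [norm_gaussTest]
  have ha : |s.re - 1 / 2| ≤ 1 := by rw [abs_le]; constructor <;> linarith
  have hx : x * (s.re - 1 / 2) ≤ |x| := by
    refine (le_abs_self _).trans ?_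
    rw [abs_mul]
    exact mul_le_of_le_one_right (abs_nonneg _) ha
  have hsq : (s.re - 1 / 2) ^ 2 ≤ 1 := by rwa [sq_le_one_iff_abs_le_one]
  calc _ ≤ Real.exp ((1 / Δ ^ 2 + |x|) + (-(s.im - T) ^ 2 / Δ ^ 2)) := by
        refine Real.exp_le_exp.2 ?_
        have : ((s.re - 1 / 2) ^ 2 - (s.im - T) ^ 2) / Δ ^ 2 ≤
          1 / Δ ^ 2 + (-(s.im - T) ^ 2 / Δ ^ 2) := by
          rw [← add_div]
          gcongr
          linarith
        linarith
    _ ≤ _ := by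
        rw [Real.exp_add, mul_assoc]
        gcongr
        exact exp_neg_sq_div_le (by positivity) T s.im

/-- Completing the square removes every trace of σ, so the same kernel serves on the lines Re s =
3/2 and Re s = -1/2. -/
theorem integral_gaussTest {Δ : ℝ} (hΔ : 0 < Δ) (T y σ : ℝ) :
    ∫ t : ℝ, gaussTest Δ T y (σ + t * I) = gaussKer Δ T y := by
  have hΔc : (Δ : ℂ) ≠ 0 := ofReal_ne_zero.2 hΔ.ne'
  have hb : (((-(1 / Δ ^ 2) : ℝ)) : ℂ).re < 0 := by
    rw [ofReal_re]
    have : 0 < 1 / Δ ^ 2 := by positivity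
    linarith
  have h := integral_cexp_quadratic hb
    (2 * I * (σ - 1 / 2 - T * I) / Δ ^ 2 + I * y) ((σ - 1 / 2 - T * I) ^ 2 / Δ ^ 2 + y * (σ - 1 / 2))
  have e1 : ∀ t : ℝ, gaussTest Δ T y (σ + t * I) = exp (((-(1 / Δ ^ 2) : ℝ) : ℂ) * t ^ 2 +
      (2 * I * (σ - 1 / 2 - T * I) / Δ ^ 2 + I * y) * t +
      ((σ - 1 / 2 - T * I) ^ 2 / Δ ^ 2 + y * (σ - 1 / 2))) := fun t => by
    rw [gaussTest]
    congr 1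
    push_cast
    field_simp
    linear_combination (4 * (t : ℂ) ^ 2) * I_sq
  simp_rw [e1]
  rw [h, gaussKer]
  have e2 : ((Real.pi : ℂ) / -((-(1 / Δ ^ 2) : ℝ) : ℂ)) ^ (1 / 2 : ℂ) =
      ((Real.sqrt Real.pi * Δ : ℝ) : ℂ) := by
    have : (Real.pi : ℂ) / -((-(1 / Δ ^ 2) : ℝ) : ℂ) = ((Real.pi * Δ ^ 2 : ℝ) : ℂ) := by
      push_cast
      field_simp
    rw [this, show (1 / 2 : ℂ) = ((1 / 2 : ℝ) : ℂ) by push_cast; rfl,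
      ← ofReal_cpow (by positivity), ← Real.sqrt_eq_rpow, Real.sqrt_mul Real.pi_pos.le,
      Real.sqrt_sq hΔ.le]
  rw [e2, ofReal_mul (_ * _) (Real.exp _), ofReal_exp,
    mul_assoc ((Real.sqrt Real.pi * Δ : ℝ) : ℂ), ← exp_add]
  congr 2
  push_cast
  field_simp
  ring_nf
  simp only [I_sq, I_pow_three, I_pow_four]
  ring

/-- With l = log n: a factor n^(-s) merely moves the frequency from x to x - log n and contributes
n^(-1/2), because the twist is normalised at s = 1/2. -/
theorem gaussTest_mul_exp (Δ T x l : ℝ) (s : ℂ) : gaussTest Δ T x s * exp (-(l * s)) =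
    (Real.exp (-l / 2) : ℂ) * gaussTest Δ T (x - l) s := by
  rw [gaussTest, gaussTest, ofReal_exp, ← exp_add, ← exp_add]
  congr 1
  push_cast
  ring

theorem integrable_gaussTest {Δ : ℝ} (hΔ : 0 < Δ) (T x : ℝ) {σ : ℝ} (h1 : -1 / 2 ≤ σ)
    (h2 : σ ≤ 3 / 2) : Integrable fun t : ℝ => gaussTest Δ T x (σ + t * I) := by
  obtain ⟨K, hK0, hK⟩ := stripDecay_gaussTest hΔ T x
  refine (integrable_inv_one_add_sq_sq.const_mul K).mono'
    (((differentiable_gaussTest Δ T x).continuous.comp (by fun_prop)).aestronglyMeasurable)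
    (ae_of_all _ fun t => ?_)
  simpa using hK (σ + t * I) (by simpa using h1) (by simpa using h2)

theorem integral_gaussTest_right {Δ : ℝ} (hΔ : 0 < Δ) (T x : ℝ) :
    ∫ t : ℝ, gaussTest Δ T x ((3 / 2 : ℝ) + t * I) * logDeriv riemannZeta ((3 / 2 : ℝ) + t * I) =
      -∑' n : ℕ, ((ArithmeticFunction.vonMangoldt n * Real.exp (-Real.log n / 2) : ℝ) : ℂ) *
        gaussKer Δ T (x - Real.log n) := by
  set F : ℕ → ℝ → ℂ := fun n t => gaussTest Δ T x ((3 / 2 : ℝ) + t * I) *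
    ((ArithmeticFunction.vonMangoldt n : ℂ) * exp (-(Real.log n * ((3 / 2 : ℝ) + t * I)))) with hF
  have hre : ∀ t : ℝ, (((3 / 2 : ℝ) : ℂ) + t * I).re = 3 / 2 := fun t => by simp
  have hsum : ∀ t : ℝ, HasSum (fun n => F n t) (-(gaussTest Δ T x ((3 / 2 : ℝ) + t * I) *
      logDeriv riemannZeta ((3 / 2 : ℝ) + t * I))) := fun t => by
    have := (hasSum_neg_logDeriv_riemannZeta (s := (3 / 2 : ℝ) + t * I)
      (by rw [hre]; norm_num)).mul_left (gaussTest Δ T x ((3 / 2 : ℝ) + t * I))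
    rwa [mul_neg] at this
  have hintg := integrable_gaussTest hΔ T x (σ := 3 / 2) (by norm_num) le_rfl
  have hFn : ∀ n t, ‖F n t‖ = ‖gaussTest Δ T x ((3 / 2 : ℝ) + t * I)‖ *
      (ArithmeticFunction.vonMangoldt n * Real.exp (-(Real.log n * (3 / 2)))) := fun n t => by
    rw [hF]
    simp only
    rw [norm_mul, norm_vonMangoldt_mul_exp, hre]
  have hFI : ∀ n, Integrable (F n) := fun n => by
    refine (hintg.norm.mul_const _).mono' ?_ (ae_of_all _ fun t => (hFn n t).le)
    refine Continuous.aestronglyMeasurable ?_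
    exact ((differentiable_gaussTest Δ T x).continuous.comp (by fun_prop)).mul (by fun_prop)
  have hS : Summable fun n => ∫ t, ‖F n t‖ := by
    simp_rw [hFn, integral_mul_const]
    exact (summable_vonMangoldt_mul_exp (by norm_num)).mul_left _
  have h := (hasSum_integral_of_summable_integral_norm hFI hS).tsum_eq
  have e : ∀ n, ∫ t, F n t = ((ArithmeticFunction.vonMangoldt n * Real.exp (-Real.log n / 2) : ℝ) : ℂ) *
        gaussKer Δ T (x - Real.log n) := fun n => by
    rw [← integral_gaussTest hΔ T _ (3 / 2), ← integral_const_mul]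
    refine integral_congr_ae (ae_of_all _ fun t => ?_)
    simp only [hF]
    rw [mul_left_comm, gaussTest_mul_exp]
    push_cast
    ring
  simp_rw [e, (hsum _).tsum_eq, integral_neg] at h
  rw [h, neg_neg]

/-- Here s - 1/2 = -1 + it, so the frequency enters only through the damping exp(-x) and a Fourier
phase. The remaining weight does not depend on x, and the left line contributes the Fourier
transform of one fixed function. -/
theorem gaussTest_left (Δ T x L t : ℝ) :
    gaussTest Δ T x ((-1 / 2 : ℝ) + t * I) * (-logDeriv riemannZeta ((-1 / 2 : ℝ) + t * I) - L) =
      (Real.exp (-x) : ℂ) * (leftWeight Δ T L t * exp ((x * t : ℝ) * I)) := by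
  rw [gaussTest, leftWeight, ofReal_exp, mul_right_comm, ← mul_assoc, mul_left_comm, ← exp_add,
    ← exp_add]
  push_cast
  congr 3
  all_goals ring

/-- The explicit formula for the Gaussian test function. -/
theorem tsum_stripMult_gaussTest {Δ : ℝ} (hΔ : 0 < Δ) (T x L : ℝ) :
    2 * Real.pi * ∑' ρ : ℂ, (stripMult ρ : ℂ) * gaussTest Δ T x ρ =
      2 * Real.pi * gaussTest Δ T x 1 + (L * gaussKer Δ T x -
      ∑' n : ℕ, ((ArithmeticFunction.vonMangoldt n * Real.exp (-Real.log n / 2) : ℝ) : ℂ) *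
        gaussKer Δ T (x - Real.log n)) +
      (Real.exp (-x) : ℂ) * ∫ t : ℝ, leftWeight Δ T L t * exp ((x * t : ℝ) * I) := by
  have hdec := stripDecay_gaussTest hΔ T x
  have hd := differentiable_gaussTest Δ T x
  have h := tsum_stripMult_mul hd hdec
  rw [integral_gaussTest_right hΔ] at h
  -- L is free here. Subtracting it on the left line will remove the bulk of -ζ'/ζ when L = log Y,
  -- and it reappears as L times the kernel since the integral of the test function is the same on
  -- all vertical lines.
  have hl : (Real.exp (-x) : ℂ) * ∫ t : ℝ, leftWeight Δ T L t * exp ((x * t : ℝ) * I) =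
      -(∫ t : ℝ, gaussTest Δ T x ((-1 / 2 : ℝ) + t * I) *
        logDeriv riemannZeta ((-1 / 2 : ℝ) + t * I)) - L * gaussKer Δ T x := by
    have hA : Integrable fun t : ℝ => -(gaussTest Δ T x ((-1 / 2 : ℝ) + t * I) *
        logDeriv riemannZeta ((-1 / 2 : ℝ) + t * I)) := (hdec.integrable_left hd).neg
    have hB : Integrable fun t : ℝ => (L : ℂ) * gaussTest Δ T x ((-1 / 2 : ℝ) + t * I) :=
      (integrable_gaussTest hΔ T x le_rfl (by norm_num)).const_mul _
    rw [← integral_const_mul, ← integral_gaussTest hΔ T x (-1 / 2), ← integral_const_mul,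
      ← integral_neg, ← integral_sub hA hB]
    refine integral_congr_ae (ae_of_all _ fun t => ?_)
    simp only
    rw [← gaussTest_left]
    ring
  rw [hl]
  linear_combination h

end ExplicitFormula


/-! ### Mertens' theorem and the Fejér-weighted prime sum. -/

section Mertens
open MeasureTheory Finset
open scoped ArithmeticFunction.vonMangoldt ArithmeticFunction.zeta

theorem sum_log_eq_sum_vonMangoldt (N : ℕ) :
    ∑ n ∈ Ioc 0 N, Real.log n = ∑ n ∈ Ioc 0 N, Λ n * ((N / n : ℕ) : ℝ) := by
  rw [← ArithmeticFunction.sum_Ioc_mul_zeta_eq_sum, ArithmeticFunction.vonMangoldt_mul_zeta]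
  rfl

theorem sum_log_eq_log_factorial (N : ℕ) : ∑ n ∈ Ioc 0 N, Real.log n = Real.log N.factorial := by
  induction N with
  | zero => simp
  | succ k ih =>
    rw [← Finset.insert_Ioc_right_eq_Ioc_add_one (Nat.zero_le k), sum_insert (by simp), ih, Nat.factorial_succ, Nat.cast_mul,
      Real.log_mul (by positivity) (by positivity)]

/-- Mertens' first theorem for the von Mangoldt function. -/
theorem exists_abs_sum_vonMangoldt_div_sub_log_le : ∃ C : ℝ, 0 ≤ C ∧ ∀ t : ℝ, 1 ≤ t →
    |∑ n ∈ Icc 0 ⌊t⌋₊, Λ n / n - Real.log t| ≤ C := by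
  refine ⟨Real.log 4 + 4 + 1, by positivity, fun t ht => ?_⟩
  set N := ⌊t⌋₊ with hN
  have hN1 : 1 ≤ N := (Nat.one_le_floor_iff t).2 ht
  have hN0 : (0 : ℝ) < N := by exact_mod_cast hN1
  have hNt : (N : ℝ) ≤ t := Nat.floor_le (by linarith)
  have htN : t < N + 1 := Nat.lt_floor_add_one t
  have hA : ∑ n ∈ Icc 0 N, Λ n / n = ∑ n ∈ Ioc 0 N, Λ n / n := by
    rw [Icc_eq_cons_Ioc (Nat.zero_le N), sum_cons]
    simp
  have hψ : ∑ n ∈ Ioc 0 N, Λ n ≤ (Real.log 4 + 4) * N := by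
    have := Chebyshev.psi_le_const_mul_self (x := N) hN0.le
    rwa [Chebyshev.psi, Nat.floor_natCast] at this
  -- The sum of Λ(n)⌊N/n⌋ is log N!, which factorial bounds give as N log N + O(N); removing the
  -- floor costs at most ψ(N) = O(N) by Chebyshev.
  have hs := (sum_log_eq_sum_vonMangoldt N).symm.trans (sum_log_eq_log_factorial N)
  have hup : Real.log N.factorial ≤ N * Real.log N := by
    rw [← Real.log_pow]
    refine Real.log_le_log (by positivity) ?_
    exact_mod_cast Nat.factorial_le_pow N
  have hlow : N * Real.log N - N ≤ Real.log N.factorial := by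
    have h1 : ((N : ℝ) / Real.exp 1) ^ N ≤ N.factorial := by
      have h2 := Stirling.le_factorial_stirling N
      have h3 : (1 : ℝ) ≤ Real.sqrt (2 * Real.pi * N) := by
        rw [Real.one_le_sqrt]
        have : (1 : ℝ) ≤ N := by exact_mod_cast hN1
        nlinarith [Real.pi_gt_three]
      have h4 : (0 : ℝ) ≤ ((N : ℝ) / Real.exp 1) ^ N := by positivity
      nlinarith
    have h2 := Real.log_le_log (by positivity) h1
    rw [Real.log_pow, Real.log_div hN0.ne' (Real.exp_pos 1).ne', Real.log_exp] at h2
    linarith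
  have hle : Real.log N.factorial ≤ N * ∑ n ∈ Ioc 0 N, Λ n / n := by
    rw [← hs, mul_sum]
    refine sum_le_sum fun n hn => ?_
    rw [mul_div_left_comm]
    exact mul_le_mul_of_nonneg_left Nat.cast_div_le ArithmeticFunction.vonMangoldt_nonneg
  have hge : N * ∑ n ∈ Ioc 0 N, Λ n / n ≤ Real.log N.factorial + ∑ n ∈ Ioc 0 N, Λ n := by
    rw [← hs, mul_sum, ← sum_add_distrib]
    refine sum_le_sum fun n hn => ?_
    have hn0 : (0 : ℝ) < n := by exact_mod_cast (mem_Ioc.1 hn).1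
    have : (N : ℝ) / n ≤ ((N / n : ℕ) : ℝ) + 1 := by
      rw [← Nat.floor_div_eq_div (K := ℝ)]
      exact (Nat.lt_floor_add_one _).le
    have h2 := mul_le_mul_of_nonneg_left this (ArithmeticFunction.vonMangoldt_nonneg (n := n))
    rw [mul_div_left_comm]
    linarith
  have hlogt : Real.log N ≤ Real.log t := Real.log_le_log hN0 hNt
  have hlogt2 : Real.log t ≤ Real.log N + 1 := by
    have h2 : t ≤ N * 2 := by
      have : (1 : ℝ) ≤ N := by exact_mod_cast hN1
      linarith
    have := Real.log_le_log (by linarith) h2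
    rw [Real.log_mul hN0.ne' two_ne_zero] at this
    linarith [Real.log_two_lt_d9]
  rw [hA, abs_le]
  have h4 : 0 ≤ Real.log 4 := Real.log_nonneg (by norm_num)
  constructor
  · have : N * (Real.log N - 1) ≤ N * ∑ n ∈ Ioc 0 N, Λ n / n := by linarith
    have := le_of_mul_le_mul_left this hN0
    linarith
  · have : N * ∑ n ∈ Ioc 0 N, Λ n / n ≤ N * (Real.log N + (Real.log 4 + 4)) := by linarith
    have := le_of_mul_le_mul_left this hN0
    linarith

/-- Partial summation against Mertens' theorem; the boundary term vanishes because the Fejér factor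
is 0 at e^X. With v = log t the main term is the integral of (2v/X - 1)v over [0, X], that is 2X²/3
- X²/2 = X²/6, and |1 - 2v/X| ≤ 1 bounds the error by CX. -/
theorem exists_sum_vonMangoldt_mul_log_le : ∃ C : ℝ, 0 ≤ C ∧ ∀ X : ℝ, 0 < X →
    ∑ n ∈ Icc 0 ⌊Real.exp X⌋₊, (Real.log n * (1 - Real.log n / X)) * (Λ n / n) ≤
      X ^ 2 / 6 + C * X := by
  obtain ⟨C, hC0, hC⟩ := exists_abs_sum_vonMangoldt_div_sub_log_le
  refine ⟨C, hC0, fun X hX => ?_⟩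
  set f : ℝ → ℝ := fun t => Real.log t * (1 - Real.log t / X) with hf
  have hfd : ∀ t : ℝ, 1 ≤ t → HasDerivAt f ((1 - 2 * Real.log t / X) / t) t := fun t ht => by
    have ht0 : t ≠ 0 := by linarith
    have h1 := Real.hasDerivAt_log ht0
    have := h1.mul ((h1.div_const X).const_sub 1)
    refine this.congr_deriv ?_
    field_simp
    ring
  have hfderiv : ∀ t ∈ Set.Icc 1 (Real.exp X), deriv f t = (1 - 2 * Real.log t / X) / t :=
    fun t ht => (hfd t ht.1).deriv
  have hfc : ContinuousOn (fun t : ℝ => (1 - 2 * Real.log t / X) / t) (Set.Icc 1 (Real.exp X)) := by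
    have : ContinuousOn Real.log (Set.Icc 1 (Real.exp X)) :=
      Real.continuousOn_log.mono fun t ht => by
        have : (1 : ℝ) ≤ t := ht.1
        simp only [Set.mem_compl_iff, Set.mem_singleton_iff]
        linarith
    refine ContinuousOn.div (by fun_prop) continuousOn_id fun t ht => ?_
    have : (1 : ℝ) ≤ t := ht.1
    linarith
  have hintg : IntegrableOn (deriv f) (Set.Icc 1 (Real.exp X)) :=
    (hfc.integrableOn_Icc).congr_fun (fun t ht => (hfderiv t ht).symm) measurableSet_Icc
  have habel := sum_mul_eq_sub_integral_mul₀ (f := f) (fun n : ℕ => Λ n / n) (by simp)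
    (Real.exp X) (fun t ht => (hfd t ht.1).differentiableAt) hintg
  have hfb : f (Real.exp X) = 0 := by
    simp only [hf, Real.log_exp]
    field_simp
    ring
  rw [hfb, zero_mul, zero_sub] at habel
  rw [habel, ← integral_neg]
  have h1X : 1 ≤ Real.exp X := Real.one_le_exp hX.le
  have hint2 : IntegrableOn (fun t => deriv f t * ∑ k ∈ Icc 0 ⌊t⌋₊, Λ k / k)
      (Set.Ioc 1 (Real.exp X)) :=
    (integrableOn_mul_sum_Icc (fun n : ℕ => Λ n / n) zero_le_one hintg).mono_set
      Set.Ioc_subset_Icc_self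
  set P : ℝ → ℝ := fun t => 2 / (3 * X) * Real.log t ^ 3 - Real.log t ^ 2 / 2 + C * Real.log t
  set p : ℝ → ℝ := fun t => (-(1 - 2 * Real.log t / X) * Real.log t + C) / t
  have hP : ∀ t : ℝ, 1 ≤ t → HasDerivAt P (p t) t := fun t ht => by
    have ht0 : t ≠ 0 := by linarith
    have h1 := Real.hasDerivAt_log ht0
    have := (((h1.pow 3).const_mul (2 / (3 * X))).sub ((h1.pow 2).div_const 2)).add (h1.const_mul C)
    refine this.congr_deriv ?_
    simp only [p]
    field_simp
    ring
  have hpc : ContinuousOn p (Set.uIcc 1 (Real.exp X)) := by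
    rw [Set.uIcc_of_le h1X]
    have : ContinuousOn Real.log (Set.Icc 1 (Real.exp X)) :=
      Real.continuousOn_log.mono fun t ht => by
        have : (1 : ℝ) ≤ t := ht.1
        simp only [Set.mem_compl_iff, Set.mem_singleton_iff]
        linarith
    refine ContinuousOn.div (by fun_prop) continuousOn_id fun t ht => ?_
    have : (1 : ℝ) ≤ t := ht.1
    linarith
  have hFTC := intervalIntegral.integral_eq_sub_of_hasDerivAt (f := P) (f' := p) (a := 1)
    (b := Real.exp X) (fun t ht => by
      rw [Set.uIcc_of_le h1X] at ht
      exact hP t ht.1) hpc.intervalIntegrable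
  rw [intervalIntegral.integral_of_le h1X] at hFTC
  have hval : P (Real.exp X) - P 1 = X ^ 2 / 6 + C * X := by
    simp only [P, Real.log_exp, Real.log_one]
    field_simp
    ring
  rw [← hval, ← hFTC]
  refine setIntegral_mono_on hint2.neg ?_ measurableSet_Ioc fun t ht => ?_
  · have := hpc.intervalIntegrable (μ := volume)
    rwa [intervalIntegrable_iff_integrableOn_Ioc_of_le h1X] at this
  · have ht1 : (1 : ℝ) ≤ t := ht.1.le
    have ht0 : 0 < t := by linarith
    rw [hfderiv t ⟨ht1, ht.2⟩]
    have hl0 := Real.log_nonneg ht1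
    have hlX : Real.log t ≤ X := by
      have := Real.log_le_log ht0 ht.2
      rwa [Real.log_exp] at this
    have hq : |1 - 2 * Real.log t / X| ≤ 1 := by
      have h1 : 2 * Real.log t / X ≤ 2 := by rw [div_le_iff₀ hX]; linarith
      have h2 : 0 ≤ 2 * Real.log t / X := by positivity
      rw [abs_le]
      constructor <;> linarith
    set q := 1 - 2 * Real.log t / X
    set A := ∑ k ∈ Icc 0 ⌊t⌋₊, Λ k / k
    have hb : |q * (A - Real.log t)| ≤ C := by
      rw [abs_mul]
      exact (mul_le_of_le_one_left (abs_nonneg _) hq).trans (hC t ht1)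
    have h3 := (abs_le.1 hb).1
    simp only [p]
    rw [← neg_mul, ← neg_div, div_mul_eq_mul_div]
    refine div_le_div_of_nonneg_right ?_ ht0.le
    linarith

end Mertens


/-! ### Gaussian integrals and a mean square bound for Fourier transforms. -/

section Bessel
open Complex MeasureTheory Set

theorem integrable_exp_neg_sq_div {D : ℝ} (hD : 0 < D) (T : ℝ) :
    Integrable fun t : ℝ => Real.exp (-(t - T) ^ 2 / D) := by
  have h := (integrable_exp_neg_mul_sq (b := 1 / D) (by positivity)).comp_sub_right T
  refine h.congr (ae_of_all _ fun t => ?_)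
  simp only
  congr 1
  ring

theorem integral_exp_neg_sq_div {D : ℝ} (hD : 0 < D) (T : ℝ) :
    ∫ t : ℝ, Real.exp (-(t - T) ^ 2 / D) = Real.sqrt (Real.pi * D) := by
  have h := integral_sub_right_eq_self (μ := volume) (fun t : ℝ => Real.exp (-(1 / D) * t ^ 2)) T
  rw [integral_gaussian] at h
  rw [show Real.pi * D = Real.pi / (1 / D) by field_simp, ← h]
  refine integral_congr_ae (ae_of_all _ fun t => ?_)
  simp only
  congr 1
  ring

theorem integral_exp_neg_sq_div' {D : ℝ} (hD : 0 < D) (T : ℝ) :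
    ∫ t : ℝ, Real.exp (-(T - t) ^ 2 / D) = Real.sqrt (Real.pi * D) := by
  rw [← integral_exp_neg_sq_div hD T]
  refine integral_congr_ae (ae_of_all _ fun t => ?_)
  simp only
  congr 1
  ring

theorem integral_gaussian_mul_exp {X : ℝ} (hX : 0 < X) (v : ℝ) :
    ∫ x : ℝ, (Real.exp (-x ^ 2 / X ^ 2) : ℂ) * exp ((x * v : ℝ) * I) =
      ((Real.sqrt Real.pi * X * Real.exp (-v ^ 2 / (4 / X ^ 2)) : ℝ) : ℂ) := by
  have hXc : (X : ℂ) ≠ 0 := ofReal_ne_zero.2 hX.ne'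
  have h := integral_gaussTest hX 0 v (1 / 2)
  have e : gaussKer X 0 v =
      ((Real.sqrt Real.pi * X * Real.exp (-v ^ 2 / (4 / X ^ 2)) : ℝ) : ℂ) := by
    rw [gaussKer]
    have : -(X ^ 2 * v ^ 2 / 4) = -v ^ 2 / (4 / X ^ 2) := by field_simp
    simp [this]
  rw [← e, ← h]
  refine integral_congr_ae (ae_of_all _ fun x => ?_)
  simp only [gaussTest]
  rw [ofReal_exp, ← exp_add]
  congr 1
  push_cast
  field_simp
  ring_nf
  simp only [I_sq]
  ring

variable {F : ℝ → ℂ} {T Δ C : ℝ}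

theorem integrable_of_norm_le_gaussian (hF : Continuous F) (hΔ : 0 < Δ)
    (hb : ∀ t, ‖F t‖ ≤ C * Real.exp (-(t - T) ^ 2 / (2 * Δ ^ 2))) : Integrable F :=
  ((integrable_exp_neg_sq_div (by positivity) T).const_mul C).mono' hF.aestronglyMeasurable
    (ae_of_all _ hb)

theorem continuous_fourier (hF : Continuous F) (hI : Integrable F) :
    Continuous fun x : ℝ => ∫ t : ℝ, F t * exp ((x * t : ℝ) * I) := by
  refine continuous_of_dominated (bound := fun t => ‖F t‖) (fun x => ?_)
    (fun x => ae_of_all _ fun t => ?_) hI.norm (ae_of_all _ fun t => by fun_prop)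
  · exact Continuous.aestronglyMeasurable (by fun_prop)
  · rw [norm_mul, norm_exp_ofReal_mul_I, mul_one]

/-- A large sieve type inequality for the Fourier transform of a function dominated by a
Gaussian. -/
theorem integral_norm_sq_fourier_le (hF : Continuous F) (hΔ : 0 < Δ)
    (hb : ∀ t, ‖F t‖ ≤ C * Real.exp (-(t - T) ^ 2 / (2 * Δ ^ 2))) {X : ℝ} (hX : 0 < X) :
    ∫ x in (0 : ℝ)..X, ‖∫ t : ℝ, F t * exp ((x * t : ℝ) * I)‖ ^ 2 ≤
      Real.exp 1 * (2 * Real.pi * Real.sqrt (2 * Real.pi) * C ^ 2 * Δ) := by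
  have hI := integrable_of_norm_le_gaussian hF hΔ hb
  have hC : 0 ≤ C := by
    have := (norm_nonneg _).trans (hb T)
    simpa using this
  set Fh : ℝ → ℂ := fun x => ∫ t : ℝ, F t * exp ((x * t : ℝ) * I) with hFh
  have hFc : Continuous Fh := continuous_fourier hF hI
  -- W is at least 1/e on [0, X] and, unlike the indicator of that interval, has a positive Fourier
  -- transform K, of total mass 2π whatever X is.
  set W : ℝ → ℝ := fun x => Real.exp (-x ^ 2 / X ^ 2) with hW
  have hWI : Integrable W := by
    have := integrable_exp_neg_sq_div (D := X ^ 2) (by positivity) 0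
    simpa only [sub_zero] using this
  have hWI' : Integrable fun x => (W x : ℂ) := hWI.ofReal
  set Q : ℝ → ℝ × ℝ → ℂ := fun x p => (W x : ℂ) *
    ((F p.1 * exp ((x * p.1 : ℝ) * I)) * (starRingEnd ℂ) (F p.2 * exp ((x * p.2 : ℝ) * I))) with hQ
  have hFF : Integrable (fun p : ℝ × ℝ => ‖F p.1‖ * ‖F p.2‖) (volume.prod volume) :=
    hI.norm.mul_prod hI.norm
  have hQI : Integrable (Function.uncurry Q) (volume.prod (volume.prod volume)) := by
    refine (hWI.mul_prod hFF).mono' ?_ (ae_of_all _ fun z => ?_)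
    · refine Continuous.aestronglyMeasurable ?_
      simp only [Function.uncurry_def, hQ, hW]
      fun_prop
    · obtain ⟨x, p⟩ := z
      simp only [Function.uncurry, hQ, norm_mul, norm_real, RCLike.norm_conj,
        norm_exp_ofReal_mul_I, mul_one]
      rw [Real.norm_of_nonneg (Real.exp_pos _).le]
  have hsq : ∀ x, ∫ p, Q x p ∂(volume.prod volume) = ((W x * ‖Fh x‖ ^ 2 : ℝ) : ℂ) := fun x => by
    simp only [hQ]
    rw [integral_const_mul, integral_prod_mul (fun t => F t * exp ((x * t : ℝ) * I))
      (fun t => (starRingEnd ℂ) (F t * exp ((x * t : ℝ) * I))), integral_conj,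
      mul_conj, normSq_eq_norm_sq, ← ofReal_mul]
  have hinner : ∀ p : ℝ × ℝ, ∫ x, Q x p = (F p.1 * (starRingEnd ℂ) (F p.2)) *
      ((Real.sqrt Real.pi * X * Real.exp (-(p.1 - p.2) ^ 2 / (4 / X ^ 2)) : ℝ) : ℂ) := fun p => by
    rw [← integral_gaussian_mul_exp hX, ← integral_const_mul]
    refine integral_congr_ae (ae_of_all _ fun x => ?_)
    simp only [hQ]
    have : exp ((x * (p.1 - p.2) : ℝ) * I) =
        exp ((x * p.1 : ℝ) * I) * (starRingEnd ℂ) (exp ((x * p.2 : ℝ) * I)) := by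
      rw [← exp_conj, ← exp_add]
      congr 1
      simp only [map_mul, conj_ofReal, conj_I]
      push_cast
      ring
    rw [this, map_mul]
    ring
  have hswap := integral_integral_swap hQI
  simp_rw [hsq, hinner] at hswap
  rw [integral_complex_ofReal] at hswap
  have hWFI : Integrable fun x => W x * ‖Fh x‖ ^ 2 := by
    have := hQI.integral_prod_left.norm
    refine this.congr (ae_of_all _ fun x => ?_)
    have h2 := hsq x
    simp only [Function.uncurry] at h2 ⊢
    rw [h2, norm_real, Real.norm_of_nonneg (by positivity)]
  set K : ℝ → ℝ := fun v => Real.sqrt Real.pi * X * Real.exp (-v ^ 2 / (4 / X ^ 2)) with hK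
  have hK0 : ∀ v, 0 ≤ K v := fun v => by positivity
  have hKI : ∀ t, Integrable fun u => K (t - u) := fun t => by
    have := ((integrable_exp_neg_sq_div (D := 4 / X ^ 2) (by positivity) t).const_mul
      (Real.sqrt Real.pi * X))
    refine this.congr (ae_of_all _ fun u => ?_)
    simp only [hK]
    congr 2
    ring
  have hKint : ∀ t, ∫ u, K (t - u) = 2 * Real.pi := fun t => by
    simp only [hK]
    rw [integral_const_mul, integral_exp_neg_sq_div' (by positivity),
      Real.sqrt_mul Real.pi_pos.le, Real.sqrt_div (by norm_num), Real.sqrt_sq hX.le,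
      show (4 : ℝ) = 2 ^ 2 by norm_num, Real.sqrt_sq two_pos.le]
    have := Real.mul_self_sqrt Real.pi_pos.le
    field_simp
    linarith
  have hFKI : Integrable (fun p : ℝ × ℝ => ‖F p.1‖ * ‖F p.2‖ * K (p.1 - p.2))
      (volume.prod volume) := by
    refine (hFF.mul_const (Real.sqrt Real.pi * X)).mono' ?_ (ae_of_all _ fun p => ?_)
    · refine Continuous.aestronglyMeasurable ?_
      simp only [hK]
      fun_prop
    · rw [Real.norm_of_nonneg (mul_nonneg (by positivity) (hK0 _))]
      refine mul_le_mul_of_nonneg_left ?_ (by positivity)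
      refine mul_le_of_le_one_right (by positivity) (Real.exp_le_one_iff.2 ?_)
      exact div_nonpos_of_nonpos_of_nonneg (neg_nonpos.2 (sq_nonneg _)) (by positivity)
  have hJ : ∫ x, W x * ‖Fh x‖ ^ 2 ≤ 2 * Real.pi * Real.sqrt (2 * Real.pi) * C ^ 2 * Δ := by
    have h0 : 0 ≤ ∫ x, W x * ‖Fh x‖ ^ 2 := integral_nonneg fun x => by positivity
    have h1 : ∫ x, W x * ‖Fh x‖ ^ 2 = ‖((∫ x, W x * ‖Fh x‖ ^ 2 : ℝ) : ℂ)‖ := by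
      rw [norm_real, Real.norm_of_nonneg h0]
    rw [h1, hswap]
    refine (norm_integral_le_integral_norm _).trans ?_
    have h2 : ∀ p : ℝ × ℝ, ‖(F p.1 * (starRingEnd ℂ) (F p.2)) *
      ((Real.sqrt Real.pi * X * Real.exp (-(p.1 - p.2) ^ 2 / (4 / X ^ 2)) : ℝ) : ℂ)‖ =
        ‖F p.1‖ * ‖F p.2‖ * K (p.1 - p.2) := fun p => by
      rw [norm_mul, norm_mul, RCLike.norm_conj, norm_real, Real.norm_of_nonneg (by positivity)]
    simp_rw [h2]
    rw [integral_prod _ hFKI]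
    -- One factor of F is replaced by its supremum and K is integrated out; the other factor is then
    -- integrated. The outcome is of order Δ, not Δ².
    have h3 : ∀ t, ∫ u, ‖F t‖ * ‖F u‖ * K (t - u) ≤ ‖F t‖ * (C * (2 * Real.pi)) := fun t => by
      rw [← hKint t, ← integral_const_mul, ← integral_const_mul]
      refine integral_mono_of_nonneg (ae_of_all _ fun u => mul_nonneg (by positivity) (hK0 _))
        (((hKI t).const_mul C).const_mul _) (ae_of_all _ fun u => ?_)
      simp only
      rw [mul_assoc]
      refine mul_le_mul_of_nonneg_left (mul_le_mul_of_nonneg_right ?_ (hK0 _)) (norm_nonneg _)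
      refine (hb u).trans (mul_le_of_le_one_right hC (Real.exp_le_one_iff.2 ?_))
      exact div_nonpos_of_nonpos_of_nonneg (neg_nonpos.2 (sq_nonneg _)) (by positivity)
    have h4 : ∫ t, ‖F t‖ ≤ C * (Real.sqrt (2 * Real.pi) * Δ) := by
      have : Real.sqrt (2 * Real.pi) * Δ = Real.sqrt (Real.pi * (2 * Δ ^ 2)) := by
        rw [show Real.pi * (2 * Δ ^ 2) = (2 * Real.pi) * Δ ^ 2 by ring,
          Real.sqrt_mul (by positivity : 0 ≤ 2 * Real.pi) (Δ ^ 2), Real.sqrt_sq hΔ.le]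
      rw [this, ← integral_exp_neg_sq_div (by positivity) T, ← integral_const_mul]
      exact integral_mono hI.norm ((integrable_exp_neg_sq_div (by positivity) T).const_mul C) hb
    calc ∫ t, ∫ u, ‖F t‖ * ‖F u‖ * K (t - u) ≤ ∫ t, ‖F t‖ * (C * (2 * Real.pi)) :=
          integral_mono hFKI.integral_prod_left (hI.norm.mul_const _) h3
      _ = (∫ t, ‖F t‖) * (C * (2 * Real.pi)) := integral_mul_const _ _
      _ ≤ (C * (Real.sqrt (2 * Real.pi) * Δ)) * (C * (2 * Real.pi)) := by gcongr
      _ = _ := by ring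
  calc ∫ x in (0 : ℝ)..X, ‖Fh x‖ ^ 2 ≤ ∫ x in (0 : ℝ)..X, Real.exp 1 * (W x * ‖Fh x‖ ^ 2) := by
        refine intervalIntegral.integral_mono_on hX.le
          ((hFc.norm.pow 2).intervalIntegrable _ _) ?_ fun x hx => ?_
        · exact (hWFI.const_mul _).intervalIntegrable
        · rw [← mul_assoc]
          refine le_mul_of_one_le_left (by positivity) ?_
          rw [hW, ← Real.exp_add]
          refine Real.one_le_exp ?_
          have : x ^ 2 / X ^ 2 ≤ 1 := by
            rw [div_le_one (by positivity)]
            exact pow_le_pow_left₀ hx.1 hx.2 2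
          rw [neg_div]
          linarith
    _ = Real.exp 1 * ∫ x in (0 : ℝ)..X, W x * ‖Fh x‖ ^ 2 :=
        intervalIntegral.integral_const_mul _ _
    _ ≤ Real.exp 1 * ∫ x, W x * ‖Fh x‖ ^ 2 := by
        gcongr
        rw [intervalIntegral.integral_of_le hX.le]
        exact setIntegral_le_integral hWFI (ae_of_all _ fun x => by positivity)
    _ ≤ _ := by gcongr

end Bessel

/-! ### The contribution of the line Re s = -1/2. -/

section LeftWeight
open Complex MeasureTheory Set

theorem continuous_leftWeight (Δ T L : ℝ) : Continuous (leftWeight Δ T L) := by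
  unfold leftWeight
  have h := continuous_logDeriv_riemannZeta_vertical (σ := -1 / 2) (by norm_num)
    riemannZeta_ne_zero_left
  push_cast at h
  fun_prop

/-- For |v| ≤ L/4 one has t ≥ Y/4; for larger |v| the lower bound is trivial, as L < 4|v|. The upper
bound uses |t| ≤ Y(3 + |v|) throughout. A loss linear in |v| is harmless against a Gaussian in v. -/
theorem abs_log_sub_log_le {Y T t v : ℝ} (hY : 1 ≤ Y) (hL : 1 ≤ Real.log Y) (hT : Y / 2 ≤ T)
    (hT' : T ≤ 3 * Y) (hv : t = T + Y / Real.log Y * v) :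
    |Real.log (9 / 4 + t ^ 2) / 2 - Real.log Y| ≤ 4 + 4 * |v| := by
  set L := Real.log Y with hLdef
  have hv0 := abs_nonneg v
  have hΔY : Y / L ≤ Y := div_le_self (by linarith) hL
  have hΔ0 : 0 < Y / L := by positivity
  have hΔv : |Y / L * v| = Y / L * |v| := by rw [abs_mul, abs_of_pos hΔ0]
  rw [abs_le]
  constructor
  · by_cases h : |v| ≤ L / 4
    · have h1 : Y / L * |v| ≤ Y / 4 := by
        calc Y / L * |v| ≤ Y / L * (L / 4) := by gcongr
          _ = Y / 4 := by field_simp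
      have h2 : Y / 4 ≤ t := by
        have := (abs_le.1 (hΔv.le.trans h1)).1
        rw [hv]
        linarith
      have h3 : Real.log (Y / 4) ≤ Real.log (9 / 4 + t ^ 2) / 2 := by
        have : Real.log ((Y / 4) ^ 2) ≤ Real.log (9 / 4 + t ^ 2) := by
          refine Real.log_le_log (by positivity) ?_
          have := pow_le_pow_left₀ (by positivity) h2 2
          linarith
        rw [Real.log_pow] at this
        push_cast at this
        linarith
      rw [Real.log_div (by positivity) (by norm_num)] at h3
      have h4 : Real.log 4 ≤ 3 := by
        have := Real.log_le_sub_one_of_pos (x := 4) (by norm_num)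
        linarith
      linarith
    · push Not at h
      have : 0 ≤ Real.log (9 / 4 + t ^ 2) := Real.log_nonneg (by nlinarith [sq_nonneg t])
      linarith
  · have h1 : |t| ≤ Y * (3 + |v|) := by
      rw [hv]
      refine (abs_add_le _ _).trans ?_
      rw [hΔv, abs_of_nonneg (by linarith)]
      nlinarith [mul_le_mul_of_nonneg_right hΔY hv0]
    have h2 : 9 / 4 + t ^ 2 ≤ (Y * (5 + |v|)) ^ 2 := by
      have h3 := pow_le_pow_left₀ (abs_nonneg t) h1 2
      rw [sq_abs] at h3
      have h4 : 1 ≤ Y ^ 2 := one_le_pow₀ hY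
      nlinarith [mul_nonneg (by linarith : 0 ≤ Y ^ 2) hv0]
    have h5 := Real.log_le_log (by positivity) h2
    rw [Real.log_pow, Real.log_mul (by positivity) (by positivity), ← hLdef] at h5
    have h6 := Real.log_le_sub_one_of_pos (x := 5 + |v|) (by positivity)
    push_cast at h5
    linarith

theorem exists_norm_leftWeight_le : ∃ C : ℝ, 0 ≤ C ∧ ∀ Y T t : ℝ, Real.exp 1 ≤ Y → Y / 2 ≤ T →
    T ≤ 3 * Y → ‖leftWeight (Y / Real.log Y) T (Real.log Y) t‖ ≤
      C * Real.exp (-(t - T) ^ 2 / (2 * (Y / Real.log Y) ^ 2)) := by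
  obtain ⟨C, hC0, hC⟩ := exists_norm_logDeriv_riemannZeta_left_le
  refine ⟨Real.exp 1 * (2 * (C + 4)), by positivity, fun Y T t hY hT hT' => ?_⟩
  have hY1 : 1 ≤ Y := (Real.one_le_exp zero_le_one).trans hY
  have hL1 : 1 ≤ Real.log Y := by rwa [Real.le_log_iff_exp_le (by linarith)]
  set Δ := Y / Real.log Y with hΔ
  have hΔ1 : 1 ≤ Δ := by
    rw [hΔ, one_le_div (by linarith)]
    exact (Real.log_le_sub_one_of_pos (by linarith)).trans (by linarith)
  set v := (t - T) / Δ with hv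
  have hvt : t = T + Δ * v := by rw [hv]; field_simp; ring
  have h1 := abs_log_sub_log_le hY1 hL1 hT hT' hvt
  have h2 : ‖-logDeriv riemannZeta (-1 / 2 + t * I) - (Real.log Y : ℂ)‖ ≤ (C + 4) * (1 + |v|) := by
    have h3 := (hC t).2
    have h4 : -logDeriv riemannZeta (-1 / 2 + t * I) - (Real.log Y : ℂ) =
        -(logDeriv riemannZeta (-1 / 2 + t * I) + (Real.log (9 / 4 + t ^ 2) / 2 : ℝ)) +
        ((Real.log (9 / 4 + t ^ 2) / 2 - Real.log Y : ℝ) : ℂ) := by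
      push_cast
      ring
    rw [h4]
    refine (norm_add_le _ _).trans ?_
    rw [norm_neg, norm_real, Real.norm_eq_abs]
    nlinarith [abs_nonneg v]
  -- Half of the Gaussian exponent pays for the linear growth, which is why the final bound has 2Δ²
  -- in place of Δ².
  have h5 : 1 + |v| ≤ 2 * Real.exp (v ^ 2 / 2) := by
    have := Real.add_one_le_exp (v ^ 2 / 2)
    rw [← sq_abs] at this ⊢
    nlinarith [sq_nonneg (|v| - 1)]
  have h6 : ‖exp ((-1 + (t - T) * I) ^ 2 / (Δ : ℂ) ^ 2)‖ ≤ Real.exp 1 * Real.exp (-v ^ 2) := by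
    rw [norm_exp, ← Real.exp_add]
    refine Real.exp_le_exp.2 ?_
    have : ((-1 + ((t : ℂ) - T) * I) ^ 2 / (Δ : ℂ) ^ 2).re = (1 - (t - T) ^ 2) / Δ ^ 2 := by
      rw [show ((Δ : ℂ) ^ 2) = ((Δ ^ 2 : ℝ) : ℂ) by push_cast; rfl, div_ofReal_re]
      congr 1
      rw [sq, mul_re]
      simp
      ring
    have hv2 : v ^ 2 = (t - T) ^ 2 / Δ ^ 2 := div_pow _ _ _
    rw [this, sub_div, ← hv2]
    have : 1 / Δ ^ 2 ≤ 1 := by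
      rw [div_le_one (by positivity)]
      exact one_le_pow₀ hΔ1
    linarith
  rw [leftWeight, norm_mul]
  calc _ ≤ (Real.exp 1 * Real.exp (-v ^ 2)) * ((C + 4) * (2 * Real.exp (v ^ 2 / 2))) :=
        mul_le_mul h6 (h2.trans (by gcongr)) (norm_nonneg _) (by positivity)
    _ = Real.exp 1 * (2 * (C + 4)) * (Real.exp (-v ^ 2) * Real.exp (v ^ 2 / 2)) := by ring
    _ = _ := by
      rw [← Real.exp_add]
      congr 2
      rw [hv]
      field_simp
      ring

end LeftWeight


/-! ### The Dirichlet series of the explicit formula: truncation and near-orthogonality. -/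

section DirichletPolynomial
open Complex MeasureTheory Set
open scoped ArithmeticFunction.vonMangoldt

/-- The coefficients of the Dirichlet series in the explicit formula, the smooth density `L` of the
zeros being included as the term `n = 1`. -/
noncomputable def dirCoeff (L : ℝ) (n : ℕ) : ℝ :=
  (if n = 1 then L else 0) - Λ n * Real.exp (-Real.log n / 2)

theorem exp_neg_log_div_two {n : ℕ} (hn : n ≠ 0) :
    Real.exp (-Real.log n / 2) = (Real.sqrt n)⁻¹ := by
  have hn0 : (0 : ℝ) < n := by exact_mod_cast Nat.pos_of_ne_zero hn
  rw [show -Real.log n / 2 = -(Real.log n / 2) by ring, Real.exp_neg, Real.sqrt_eq_rpow,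
    Real.rpow_def_of_pos hn0]
  congr 2
  ring

theorem dirCoeff_zero (L : ℝ) : dirCoeff L 0 = 0 := by simp [dirCoeff]

theorem dirCoeff_one (L : ℝ) : dirCoeff L 1 = L := by simp [dirCoeff]

theorem abs_dirCoeff_le {n : ℕ} (hn : n ≠ 1) (L : ℝ) : |dirCoeff L n| ≤ 2 := by
  rw [dirCoeff, if_neg hn, zero_sub, abs_neg, abs_of_nonneg
    (mul_nonneg ArithmeticFunction.vonMangoldt_nonneg (Real.exp_pos _).le)]
  rcases Nat.eq_zero_or_pos n with rfl | h
  · simp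
  have hn0 : (0 : ℝ) < n := by exact_mod_cast h
  have hs : 0 < Real.sqrt n := Real.sqrt_pos.2 hn0
  rw [exp_neg_log_div_two h.ne', ← div_eq_mul_inv, div_le_iff₀ hs]
  refine ArithmeticFunction.vonMangoldt_le_log.trans ?_
  have h1 := Real.log_le_sub_one_of_pos hs
  rw [Real.log_sqrt hn0.le] at h1
  linarith

theorem abs_dirCoeff_le' (n : ℕ) {L : ℝ} (hL : 0 ≤ L) : |dirCoeff L n| ≤ L + 2 := by
  by_cases h : n = 1
  · rw [h, dirCoeff_one, abs_of_nonneg hL]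
    linarith
  · exact (abs_dirCoeff_le h L).trans (by linarith)

theorem dirCoeff_sq_le {n : ℕ} (hn : n ≠ 1) (L : ℝ) :
    dirCoeff L n ^ 2 ≤ Real.log n * (Λ n / n) := by
  rw [dirCoeff, if_neg hn, zero_sub, neg_sq]
  rcases Nat.eq_zero_or_pos n with rfl | h
  · simp
  have hn0 : (0 : ℝ) < n := by exact_mod_cast h
  rw [exp_neg_log_div_two h.ne', mul_pow, inv_pow, Real.sq_sqrt hn0.le, sq, mul_assoc,
    ← div_eq_mul_inv]
  exact mul_le_mul_of_nonneg_right ArithmeticFunction.vonMangoldt_le_log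
    (div_nonneg ArithmeticFunction.vonMangoldt_nonneg hn0.le)

theorem norm_dirCoeff_mul_gaussKer_le {Δ X x L T : ℝ} (hΔ : 16 ≤ Δ ^ 2) (hΔ0 : 0 < Δ)
    (hx : x ≤ X) (hX : 0 ≤ X) {n : ℕ} (hn : X + 1 / 2 ≤ Real.log n) :
    ‖(dirCoeff L n : ℂ) * gaussKer Δ T (x - Real.log n)‖ ≤
      (4 * Δ * Real.exp (2 * X + 1 - Δ ^ 2 / 16)) * (1 / (n : ℝ) ^ 2) := by
  have hn0 : n ≠ 0 := by rintro rfl; simp at hn; linarith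
  have hn1 : n ≠ 1 := by rintro rfl; simp at hn; linarith
  have hnp : (0 : ℝ) < n := by exact_mod_cast Nat.pos_of_ne_zero hn0
  rw [norm_mul, norm_real, Real.norm_eq_abs, norm_gaussKer hΔ0]
  have hexp : Real.exp (-(Δ ^ 2 * (x - Real.log n) ^ 2 / 4)) ≤
      Real.exp (2 * X + 1 - Δ ^ 2 / 16) * (1 / (n : ℝ) ^ 2) := by
    have : (1 : ℝ) / (n : ℝ) ^ 2 = Real.exp (-(2 * Real.log n)) := by
      rw [Real.exp_neg, mul_comm, Real.exp_mul, Real.exp_log hnp, one_div]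
      norm_num
    rw [this, ← Real.exp_add]
    refine Real.exp_le_exp.2 ?_
    set y := Real.log n - x
    have hy : 1 / 2 ≤ y := by simp only [y]; linarith
    have h1 : (x - Real.log n) ^ 2 = y ^ 2 := by simp only [y]; ring
    -- Since y ≥ 1/2 and Δ² ≥ 16, the right side is at least 4y² - 1 ≥ 2y - 1. The part 2y = 2 log n
    -- - 2x yields the summable factor n^(-2).
    have h2 : 2 * y - 1 ≤ Δ ^ 2 * y ^ 2 / 4 - Δ ^ 2 / 16 := by
      nlinarith [mul_nonneg (by linarith : 0 ≤ Δ ^ 2 - 16) (by nlinarith : 0 ≤ y ^ 2 - 1 / 4)]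
    rw [h1]
    simp only [y] at h2 ⊢
    linarith
  have hpi : Real.sqrt Real.pi ≤ 2 := by
    rw [Real.sqrt_le_left two_pos.le]
    linarith [Real.pi_lt_four]
  calc |dirCoeff L n| * (Real.sqrt Real.pi * Δ * Real.exp (-(Δ ^ 2 * (x - Real.log n) ^ 2 / 4)))
      ≤ 2 * (2 * Δ * (Real.exp (2 * X + 1 - Δ ^ 2 / 16) * (1 / (n : ℝ) ^ 2))) := by
        gcongr
        exact abs_dirCoeff_le hn1 L
    _ = _ := by ring

theorem tsum_one_div_sq_le : ∑' n : ℕ, 1 / (n : ℝ) ^ 2 ≤ 2 := by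
  rw [hasSum_zeta_two.tsum_eq]
  nlinarith [Real.pi_lt_d2, Real.pi_gt_three]

theorem log_ge_of_floor_lt {X : ℝ} {n : ℕ} (h : ⌊Real.exp (X + 1 / 2)⌋₊ < n) :
    X + 1 / 2 ≤ Real.log n := by
  have h1 := (Nat.floor_lt (Real.exp_pos _).le).1 h
  have hn : (0 : ℝ) < n := (Real.exp_pos _).trans h1
  rw [Real.le_log_iff_exp_le hn]
  exact h1.le

theorem summable_dirCoeff_mul_gaussKer {Δ x L T : ℝ} (hΔ : 16 ≤ Δ ^ 2) (hΔ0 : 0 < Δ) :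
    Summable fun n : ℕ => (dirCoeff L n : ℂ) * gaussKer Δ T (x - Real.log n) := by
  refine Summable.of_norm_bounded_eventually_nat
    ((Real.summable_one_div_nat_pow.2 one_lt_two).mul_left
      (4 * Δ * Real.exp (2 * max x 0 + 1 - Δ ^ 2 / 16))) ?_
  filter_upwards [eventually_gt_atTop ⌊Real.exp (max x 0 + 1 / 2)⌋₊] with n hn
  exact norm_dirCoeff_mul_gaussKer_le hΔ hΔ0 (le_max_left _ _) (le_max_right _ _)
    (log_ge_of_floor_lt hn)

/-- The terms of the Dirichlet series beyond the range of the frequency are negligible. -/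
theorem norm_tsum_dirCoeff_sub_sum_le {Δ X x L T : ℝ} (hΔ : 16 ≤ Δ ^ 2) (hΔ0 : 0 < Δ)
    (hx : x ≤ X) (hX : 0 ≤ X) {M : ℕ} (hM : ⌊Real.exp (X + 1 / 2)⌋₊ = M) :
    ‖∑' n : ℕ, (dirCoeff L n : ℂ) * gaussKer Δ T (x - Real.log n) -
      ∑ n ∈ Finset.range (M + 1), (dirCoeff L n : ℂ) * gaussKer Δ T (x - Real.log n)‖ ≤
      8 * Δ * Real.exp (2 * X + 1 - Δ ^ 2 / 16) := by
  have hs := summable_dirCoeff_mul_gaussKer (x := x) (L := L) (T := T) hΔ hΔ0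
  have hz : Summable fun n : ℕ => 1 / (n : ℝ) ^ 2 := Real.summable_one_div_nat_pow.2 one_lt_two
  set A := 4 * Δ * Real.exp (2 * X + 1 - Δ ^ 2 / 16) with hA
  have hA0 : 0 ≤ A := by positivity
  have hb : ∀ n : ℕ, ‖(dirCoeff L (n + (M + 1)) : ℂ) *
      gaussKer Δ T (x - Real.log ((n + (M + 1) : ℕ) : ℝ))‖ ≤
        A * (1 / ((n + (M + 1) : ℕ) : ℝ) ^ 2) := fun n => by
    refine norm_dirCoeff_mul_gaussKer_le hΔ hΔ0 hx hX (log_ge_of_floor_lt ?_)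
    rw [hM]
    omega
  have hz' : Summable fun n : ℕ => 1 / ((n + (M + 1) : ℕ) : ℝ) ^ 2 :=
    (summable_nat_add_iff (f := fun n : ℕ => 1 / (n : ℝ) ^ 2) (M + 1)).2 hz
  have h2 : ∑' n : ℕ, 1 / ((n + (M + 1) : ℕ) : ℝ) ^ 2 ≤ 2 := by
    refine le_trans ?_ tsum_one_div_sq_le
    rw [← hz.sum_add_tsum_nat_add (M + 1)]
    exact le_add_of_nonneg_left (Finset.sum_nonneg fun i _ => by positivity)
  rw [← hs.sum_add_tsum_nat_add (M + 1), add_sub_cancel_left]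
  refine (tsum_of_norm_bounded (hz'.mul_left A).hasSum hb).trans ?_
  rw [tsum_mul_left]
  calc _ ≤ A * 2 := by gcongr
    _ = _ := by rw [hA]; ring

/-- The spacing of the frequencies, to be compared with the bump width 1/Δ: cross terms are
negligible once Δ/M is large. -/
theorem one_div_le_abs_log_sub_log {m n M : ℕ} (hm : 0 < m) (hn : 0 < n) (hmM : m ≤ M)
    (hnM : n ≤ M) (hne : m ≠ n) : 1 / (M : ℝ) ≤ |Real.log m - Real.log n| := by
  wlog h : n < m generalizing m n
  · rw [abs_sub_comm]
    exact this hn hm hnM hmM hne.symm (by omega)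
  have hm0 : (0 : ℝ) < m := by exact_mod_cast hm
  have hn0 : (0 : ℝ) < n := by exact_mod_cast hn
  have h1 := Real.one_sub_inv_le_log_of_pos (x := (m : ℝ) / n) (by positivity)
  rw [Real.log_div hm0.ne' hn0.ne', inv_div] at h1
  refine le_trans ?_ (le_abs_self _)
  refine le_trans ?_ h1
  have h2 : (n : ℝ) + 1 ≤ m := by exact_mod_cast h
  have h3 : (m : ℝ) ≤ M := by exact_mod_cast hmM
  calc 1 / (M : ℝ) ≤ 1 / m := one_div_le_one_div_of_le hm0 h3
    _ ≤ 1 - n / m := by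
      rw [one_sub_div hm0.ne']
      gcongr
      linarith

theorem sq_sum_le_of_mul_le {ι : Type*} (s : Finset ι) (a c : ι → ℝ) {q : ℝ} (hq : 0 ≤ q)
    (hc : ∀ i ∈ s, 0 ≤ c i) (h : ∀ i ∈ s, ∀ j ∈ s, i ≠ j → a i * a j ≤ q * (c i * c j)) :
    (∑ i ∈ s, a i) ^ 2 ≤ ∑ i ∈ s, a i ^ 2 + q * (∑ i ∈ s, c i) ^ 2 := by
  classical
  rw [sq, Finset.sum_mul_sum, sq (∑ i ∈ s, c i), Finset.sum_mul_sum, Finset.mul_sum,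
    ← Finset.sum_add_distrib]
  refine Finset.sum_le_sum fun i hi => ?_
  rw [Finset.mul_sum]
  have : a i ^ 2 = ∑ j ∈ s, if i = j then a i ^ 2 else 0 := by simp [hi]
  rw [this, ← Finset.sum_add_distrib]
  refine Finset.sum_le_sum fun j hj => ?_
  have h0 : 0 ≤ q * (c i * c j) := mul_nonneg hq (mul_nonneg (hc i hi) (hc j hj))
  by_cases hij : i = j
  · subst hij
    simp only [if_true]
    nlinarith
  · simp only [hij, if_false, zero_add]
    exact h i hi j hj hij

/-- The estimate is pointwise in x. For two centres a, b at distance at least 1/M, (x-a)² + (x-b)² ≥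
(a-b)²/2, so a product of two different bumps carries the factor exp(-Δ²/(8M²)) and only the squares
survive. -/
theorem norm_sq_sum_dirCoeff_le {Δ x L T : ℝ} (hΔ : 0 < Δ) (hL : 0 ≤ L) (M : ℕ) :
    ‖∑ n ∈ Finset.range (M + 1), (dirCoeff L n : ℂ) * gaussKer Δ T (x - Real.log n)‖ ^ 2 ≤
      Real.pi * Δ ^ 2 * (∑ n ∈ Finset.range (M + 1),
        dirCoeff L n ^ 2 * Real.exp (-(x - Real.log n) ^ 2 / (2 / Δ ^ 2)) +
        Real.exp (-Δ ^ 2 / (8 * (M : ℝ) ^ 2)) * ((M + 1) * (L + 2)) ^ 2) := by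
  set E : ℕ → ℝ := fun n => Real.exp (-(Δ ^ 2 * (x - Real.log n) ^ 2 / 4))
  set a : ℕ → ℝ := fun n => |dirCoeff L n| * (Real.sqrt Real.pi * Δ * E n)
  set q : ℝ := Real.pi * Δ ^ 2 * Real.exp (-Δ ^ 2 / (8 * (M : ℝ) ^ 2))
  have hpi := Real.mul_self_sqrt Real.pi_pos.le
  have h1 : ‖∑ n ∈ Finset.range (M + 1), (dirCoeff L n : ℂ) * gaussKer Δ T (x - Real.log n)‖ ≤
      ∑ n ∈ Finset.range (M + 1), a n := by
    refine (norm_sum_le _ _).trans (le_of_eq (Finset.sum_congr rfl fun n _ => ?_))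
    rw [norm_mul, norm_real, Real.norm_eq_abs, norm_gaussKer hΔ]
  refine (pow_le_pow_left₀ (norm_nonneg _) h1 2).trans ?_
  refine (sq_sum_le_of_mul_le (q := q) _ a (fun n => |dirCoeff L n|) (by positivity)
    (fun _ _ => abs_nonneg _) fun m hm n hn hmn => ?_).trans ?_
  · by_cases hm0 : m = 0
    · simp [a, hm0, dirCoeff_zero]
    by_cases hn0 : n = 0
    · simp [a, hn0, dirCoeff_zero]
    have hmM : m ≤ M := by have := Finset.mem_range.1 hm; omega
    have hnM : n ≤ M := by have := Finset.mem_range.1 hn; omega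
    have hM0 : (0 : ℝ) < M := by exact_mod_cast lt_of_lt_of_le (Nat.pos_of_ne_zero hm0) hmM
    have hsep := one_div_le_abs_log_sub_log (Nat.pos_of_ne_zero hm0) (Nat.pos_of_ne_zero hn0)
      hmM hnM hmn
    have hEE : E m * E n ≤ Real.exp (-Δ ^ 2 / (8 * (M : ℝ) ^ 2)) := by
      simp only [E]
      rw [← Real.exp_add]
      refine Real.exp_le_exp.2 ?_
      have h2 := pow_le_pow_left₀ (by positivity) hsep 2
      rw [sq_abs] at h2
      have h3 : (Real.log m - Real.log n) ^ 2 / 2 ≤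
          (x - Real.log m) ^ 2 + (x - Real.log n) ^ 2 := by
        nlinarith [sq_nonneg ((x - Real.log m) + (x - Real.log n))]
      have h4 : Δ ^ 2 / (8 * (M : ℝ) ^ 2) = Δ ^ 2 / 8 * (1 / M) ^ 2 := by field_simp
      rw [neg_div, h4]
      have h5 : Δ ^ 2 / 8 * (1 / (M : ℝ)) ^ 2 ≤
          Δ ^ 2 / 8 * (2 * ((x - Real.log m) ^ 2 + (x - Real.log n) ^ 2)) := by
        gcongr
        linarith
      linarith
    have : a m * a n = (Real.pi * Δ ^ 2 * (E m * E n)) * (|dirCoeff L m| * |dirCoeff L n|) := by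
      simp only [a]
      linear_combination (|dirCoeff L m| * |dirCoeff L n| * Δ ^ 2 * E m * E n) * hpi
    rw [this]
    simp only [q]
    gcongr
  · have h2 : ∑ n ∈ Finset.range (M + 1), |dirCoeff L n| ≤ (M + 1) * (L + 2) := by
      refine (Finset.sum_le_card_nsmul _ _ (L + 2) fun n _ => abs_dirCoeff_le' n hL).trans ?_
      rw [Finset.card_range, nsmul_eq_mul]
      push_cast
      exact le_rfl
    have h3 : ∀ n, a n ^ 2 = Real.pi * Δ ^ 2 *
        (dirCoeff L n ^ 2 * Real.exp (-(x - Real.log n) ^ 2 / (2 / Δ ^ 2))) := fun n => by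
      have : E n ^ 2 = Real.exp (-(x - Real.log n) ^ 2 / (2 / Δ ^ 2)) := by
        simp only [E]
        rw [sq, ← Real.exp_add]
        congr 1
        field_simp
        ring
      rw [← this]
      simp only [a]
      rw [mul_pow, sq_abs]
      linear_combination (dirCoeff L n ^ 2 * Δ ^ 2 * E n ^ 2) * hpi
    simp_rw [h3]
    rw [mul_add, Finset.mul_sum, ← mul_assoc]
    simp only [q]
    have : 0 ≤ ∑ n ∈ Finset.range (M + 1), |dirCoeff L n| := Finset.sum_nonneg fun _ _ => abs_nonneg _
    gcongr

/-- Only the right half of the bump centred at 0 meets [0, X]. This factor 1/2 is why the density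
term contributes L²/2 and not L². -/
theorem integral_fejer_gaussian_zero_le {Δ X : ℝ} (hΔ : 0 < Δ) (hX : 0 < X) :
    ∫ x in (0 : ℝ)..X, (1 - x / X) * Real.exp (-x ^ 2 / (2 / Δ ^ 2)) ≤
      Real.sqrt (2 * Real.pi) / Δ / 2 := by
  have h1 := integral_gaussian_Ioi (Δ ^ 2 / 2)
  have h2 : Real.sqrt (Real.pi / (Δ ^ 2 / 2)) = Real.sqrt (2 * Real.pi) / Δ := by
    rw [show Real.pi / (Δ ^ 2 / 2) = (2 * Real.pi) / Δ ^ 2 by field_simp,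
      Real.sqrt_div (by positivity), Real.sqrt_sq hΔ.le]
  rw [h2] at h1
  rw [← h1, intervalIntegral.integral_of_le hX.le]
  have hI : IntegrableOn (fun x : ℝ => Real.exp (-(Δ ^ 2 / 2) * x ^ 2)) (Ioi 0) :=
    (integrable_exp_neg_mul_sq (by positivity)).integrableOn
  calc _ ≤ ∫ x in Ioc 0 X, Real.exp (-(Δ ^ 2 / 2) * x ^ 2) := by
        refine setIntegral_mono_on ?_ (hI.mono_set Ioc_subset_Ioi_self) measurableSet_Ioc
          fun x hx => ?_
        · exact (Continuous.integrableOn_Icc (by fun_prop)).mono_set Ioc_subset_Icc_self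
        · have e : -x ^ 2 / (2 / Δ ^ 2) = -(Δ ^ 2 / 2) * x ^ 2 := by field_simp
          rw [e]
          refine mul_le_of_le_one_left (Real.exp_pos _).le ?_
          have : 0 ≤ x / X := div_nonneg hx.1.le hX.le
          linarith
    _ ≤ _ := setIntegral_mono_set hI (ae_of_all _ fun x => (Real.exp_pos _).le)
        Ioc_subset_Ioi_self.eventuallyLE

/-- The weight is compared with its value at the centre l of the bump: 1 - x/X ≤ max(1 - l/X, 0) +
|x - l|/X, and |x - l| is of the order of the width 1/Δ. -/
theorem integral_fejer_gaussian_le {Δ X : ℝ} (hΔ : 0 < Δ) (hX : 0 < X) (l : ℝ) :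
    ∫ x in (0 : ℝ)..X, (1 - x / X) * Real.exp (-(x - l) ^ 2 / (2 / Δ ^ 2)) ≤
      max (1 - l / X) 0 * (Real.sqrt (2 * Real.pi) / Δ) + 4 / (X * Δ ^ 2) := by
  have hg := integral_exp_neg_sq_div (D := 2 / Δ ^ 2) (by positivity) l
  have hg' := integral_exp_neg_sq_div (D := 4 / Δ ^ 2) (by positivity) l
  have hI := integrable_exp_neg_sq_div (D := 2 / Δ ^ 2) (by positivity) l
  have hI' := integrable_exp_neg_sq_div (D := 4 / Δ ^ 2) (by positivity) l
  have h2 : Real.sqrt (Real.pi * (2 / Δ ^ 2)) = Real.sqrt (2 * Real.pi) / Δ := by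
    rw [show Real.pi * (2 / Δ ^ 2) = (2 * Real.pi) / Δ ^ 2 by field_simp,
      Real.sqrt_div (by positivity), Real.sqrt_sq hΔ.le]
  have h3 : Real.sqrt (Real.pi * (4 / Δ ^ 2)) ≤ 4 / Δ := by
    rw [show (4 / Δ : ℝ) = Real.sqrt ((4 / Δ) ^ 2) from (Real.sqrt_sq (by positivity)).symm]
    refine Real.sqrt_le_sqrt ?_
    rw [div_pow, mul_div_assoc']
    gcongr
    linarith [Real.pi_lt_four]
  have hsum : Integrable fun x : ℝ => max (1 - l / X) 0 * Real.exp (-(x - l) ^ 2 / (2 / Δ ^ 2)) +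
      1 / (X * Δ) * Real.exp (-(x - l) ^ 2 / (4 / Δ ^ 2)) := (hI.const_mul _).add (hI'.const_mul _)
  calc _ ≤ ∫ x in (0 : ℝ)..X, (max (1 - l / X) 0 * Real.exp (-(x - l) ^ 2 / (2 / Δ ^ 2)) +
        1 / (X * Δ) * Real.exp (-(x - l) ^ 2 / (4 / Δ ^ 2))) := by
        refine intervalIntegral.integral_mono_on hX.le
          (Continuous.intervalIntegrable (by fun_prop) _ _) hsum.intervalIntegrable fun x hx => ?_
        have h4 : 1 - x / X ≤ max (1 - l / X) 0 + |x - l| / X := by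
          have : 1 - x / X = (1 - l / X) + (l - x) / X := by ring
          rw [this]
          gcongr
          · exact le_max_left _ _
          · rw [abs_sub_comm]
            exact le_abs_self _
        have h5 : |x - l| * Real.exp (-(x - l) ^ 2 / (2 / Δ ^ 2)) ≤
            1 / Δ * Real.exp (-(x - l) ^ 2 / (4 / Δ ^ 2)) := by
          set w := Δ * |x - l| with hw
          have h6 : w ≤ Real.exp (w ^ 2 / 4) := by
            have := Real.add_one_le_exp (w ^ 2 / 4)
            nlinarith [sq_nonneg (w - 2)]
          have e1 : -(x - l) ^ 2 / (2 / Δ ^ 2) = -(w ^ 2 / 2) := by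
            rw [hw, mul_pow, sq_abs]; field_simp
          have e2 : -(x - l) ^ 2 / (4 / Δ ^ 2) = -(w ^ 2 / 4) := by
            rw [hw, mul_pow, sq_abs]; field_simp
          have e3 : |x - l| = 1 / Δ * w := by rw [hw]; field_simp
          rw [e1, e2, e3, mul_assoc]
          refine mul_le_mul_of_nonneg_left ?_ (by positivity)
          calc w * Real.exp (-(w ^ 2 / 2)) ≤ Real.exp (w ^ 2 / 4) * Real.exp (-(w ^ 2 / 2)) := by
                gcongr
            _ = _ := by rw [← Real.exp_add]; congr 1; ring
        calc _ ≤ (max (1 - l / X) 0 + |x - l| / X) * Real.exp (-(x - l) ^ 2 / (2 / Δ ^ 2)) := by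
              gcongr
          _ = max (1 - l / X) 0 * Real.exp (-(x - l) ^ 2 / (2 / Δ ^ 2)) +
              1 / X * (|x - l| * Real.exp (-(x - l) ^ 2 / (2 / Δ ^ 2))) := by ring
          _ ≤ max (1 - l / X) 0 * Real.exp (-(x - l) ^ 2 / (2 / Δ ^ 2)) +
              1 / X * (1 / Δ * Real.exp (-(x - l) ^ 2 / (4 / Δ ^ 2))) := by gcongr
          _ = _ := by field_simp
    _ ≤ ∫ x : ℝ, (max (1 - l / X) 0 * Real.exp (-(x - l) ^ 2 / (2 / Δ ^ 2)) +
        1 / (X * Δ) * Real.exp (-(x - l) ^ 2 / (4 / Δ ^ 2))) := by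
        rw [intervalIntegral.integral_of_le hX.le]
        exact setIntegral_le_integral hsum (ae_of_all _ fun x => by positivity)
    _ = max (1 - l / X) 0 * (Real.sqrt (2 * Real.pi) / Δ) +
        1 / (X * Δ) * Real.sqrt (Real.pi * (4 / Δ ^ 2)) := by
        rw [integral_add (hI.const_mul _) (hI'.const_mul _), integral_const_mul,
          integral_const_mul, hg, hg', h2]
    _ ≤ max (1 - l / X) 0 * (Real.sqrt (2 * Real.pi) / Δ) + 1 / (X * Δ) * (4 / Δ) := by gcongr
    _ = _ := by field_simp

end DirichletPolynomial


/-! ### The Fejér kernel and its majorant principle. -/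

section Fejer
open Complex MeasureTheory Set

/-- The Fejér kernel. -/
noncomputable def fejerKer (X u : ℝ) : ℝ := ∫ x in (0 : ℝ)..X, (1 - x / X) * Real.cos (x * u)

theorem fejerKer_zero {X : ℝ} (hX : 0 < X) : fejerKer X 0 = X / 2 := by
  have h : ∀ x ∈ uIcc 0 X, HasDerivAt (fun x : ℝ => x - x ^ 2 / (2 * X)) (1 - x / X) x :=
    fun x _ => by
      refine ((hasDerivAt_id x).sub ((hasDerivAt_pow 2 x).div_const (2 * X))).congr_deriv ?_
      norm_num
      field_simp
  have := intervalIntegral.integral_eq_sub_of_hasDerivAt h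
    (Continuous.intervalIntegrable (by fun_prop) _ _)
  simp only [fejerKer, mul_zero, Real.cos_zero, mul_one]
  rw [this]
  field_simp
  ring

/-- An explicit primitive gives the value (1 - cos(Xu))/(Xu²) for u ≠ 0. -/
theorem fejerKer_nonneg {X : ℝ} (hX : 0 < X) (u : ℝ) : 0 ≤ fejerKer X u := by
  by_cases hu : u = 0
  · rw [hu, fejerKer_zero hX]
    positivity
  have h : ∀ x ∈ uIcc 0 X, HasDerivAt
      (fun x : ℝ => (1 - x / X) * (Real.sin (x * u) / u) - Real.cos (x * u) / (X * u ^ 2))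
      ((1 - x / X) * Real.cos (x * u)) x := fun x _ => by
    have h1 : HasDerivAt (fun x : ℝ => x * u) u x := by simpa using (hasDerivAt_id x).mul_const u
    have h2 : HasDerivAt (fun x : ℝ => 1 - x / X) (-(1 / X)) x :=
      ((hasDerivAt_id x).div_const X).const_sub 1
    refine ((h2.mul (h1.sin.div_const u)).sub (h1.cos.div_const (X * u ^ 2))).congr_deriv ?_
    field_simp
    ring
  rw [fejerKer, intervalIntegral.integral_eq_sub_of_hasDerivAt h
    (Continuous.intervalIntegrable (by fun_prop) _ _), div_self hX.ne']
  simp only [sub_self, zero_mul, zero_sub, zero_div, Real.sin_zero, Real.cos_zero, mul_zero]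
  rw [neg_sub_neg, ← sub_div]
  exact div_nonneg (by linarith [Real.cos_le_one (X * u)]) (by positivity)

variable {ι : Type*} (S : Finset ι) (γ : ι → ℝ)

/-- The trigonometric polynomial with frequencies `γ` and coefficients `c`. -/
noncomputable def trigPoly (c : ι → ℂ) (x : ℝ) : ℂ := ∑ i ∈ S, c i * exp ((x * γ i : ℝ) * I)

theorem continuous_trigPoly (c : ι → ℂ) : Continuous (trigPoly S γ c) := by
  unfold trigPoly
  fun_prop

/-- Conjugating the coefficients has the effect on the modulus of replacing x by -x. Adding the two
squares therefore symmetrises an integral over [0, X], whose own exponential kernel would be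
complex, and leaves only cosines. -/
theorem norm_sq_trigPoly_add (c : ι → ℂ) (x : ℝ) :
    ‖trigPoly S γ c x‖ ^ 2 + ‖trigPoly S γ (fun i => (starRingEnd ℂ) (c i)) x‖ ^ 2 =
      ∑ i ∈ S, ∑ j ∈ S, 2 * (c i * (starRingEnd ℂ) (c j)).re * Real.cos (x * (γ i - γ j)) := by
  have h : ∀ d : ι → ℂ, ‖trigPoly S γ d x‖ ^ 2 = ∑ i ∈ S, ∑ j ∈ S,
      ((d i * (starRingEnd ℂ) (d j)) * exp ((x * (γ i - γ j) : ℝ) * I)).re := fun d => by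
    rw [← normSq_eq_norm_sq, ← ofReal_re (normSq _), ← mul_conj, trigPoly, map_sum,
      Finset.sum_mul_sum, re_sum]
    refine Finset.sum_congr rfl fun i _ => ?_
    rw [re_sum]
    refine Finset.sum_congr rfl fun j _ => ?_
    congr 1
    rw [map_mul, ← exp_conj, map_mul, conj_ofReal, conj_I,
      mul_mul_mul_comm, ← exp_add]
    congr 2
    push_cast
    ring
  rw [h, h, ← Finset.sum_add_distrib]
  refine Finset.sum_congr rfl fun i _ => ?_
  rw [← Finset.sum_add_distrib]
  refine Finset.sum_congr rfl fun j _ => ?_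
  rw [mul_re, mul_re]
  simp only [exp_ofReal_mul_I_re, exp_ofReal_mul_I_im, mul_re, mul_im, conj_re, conj_im, conj_conj]
  ring

theorem integral_fejer_trigPoly_add (X : ℝ) (c : ι → ℂ) :
    (∫ x in (0 : ℝ)..X, (1 - x / X) * ‖trigPoly S γ c x‖ ^ 2) +
      ∫ x in (0 : ℝ)..X, (1 - x / X) * ‖trigPoly S γ (fun i => (starRingEnd ℂ) (c i)) x‖ ^ 2 =
      ∑ i ∈ S, ∑ j ∈ S, 2 * (c i * (starRingEnd ℂ) (c j)).re * fejerKer X (γ i - γ j) := by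
  have hc := fun d : ι → ℂ => continuous_trigPoly S γ d
  have hi : ∀ d : ι → ℂ, IntervalIntegrable (fun x => (1 - x / X) * ‖trigPoly S γ d x‖ ^ 2)
      volume 0 X := fun d => by
    have := hc d
    exact Continuous.intervalIntegrable (by fun_prop) _ _
  rw [← intervalIntegral.integral_add (hi _) (hi _)]
  simp_rw [← mul_add, norm_sq_trigPoly_add, Finset.mul_sum]
  rw [intervalIntegral.integral_finsetSum
    fun i _ => Continuous.intervalIntegrable (by fun_prop) _ _]
  refine Finset.sum_congr rfl fun i _ => ?_
  rw [intervalIntegral.integral_finsetSum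
    fun i _ => Continuous.intervalIntegrable (by fun_prop) _ _]
  refine Finset.sum_congr rfl fun j _ => ?_
  rw [fejerKer, ← intervalIntegral.integral_const_mul]
  congr 1
  ext x
  ring

variable {S γ}

theorem integral_fejer_trigPoly_real (X : ℝ) (r : ι → ℝ) :
    ∫ x in (0 : ℝ)..X, (1 - x / X) * ‖trigPoly S γ (fun i => (r i : ℂ)) x‖ ^ 2 =
      ∑ i ∈ S, ∑ j ∈ S, r i * r j * fejerKer X (γ i - γ j) := by
  have h := integral_fejer_trigPoly_add S γ X fun i => (r i : ℂ)
  simp only [conj_ofReal, ← ofReal_mul, ofReal_re] at h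
  have h2 : ∑ i ∈ S, ∑ j ∈ S, 2 * (r i * r j) * fejerKer X (γ i - γ j) =
      2 * ∑ i ∈ S, ∑ j ∈ S, r i * r j * fejerKer X (γ i - γ j) := by
    simp_rw [Finset.mul_sum, mul_assoc]
  linarith

theorem integral_fejer_trigPoly_nonneg {X : ℝ} (hX : 0 < X) (f : ℝ → ℂ) :
    0 ≤ ∫ x in (0 : ℝ)..X, (1 - x / X) * ‖f x‖ ^ 2 := by
  refine intervalIntegral.integral_nonneg hX.le fun x hx => mul_nonneg ?_ (by positivity)
  rw [sub_nonneg, div_le_one hX]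
  exact hx.2

/-- Positivity of the Fejér kernel yields the majorant principle. -/
theorem integral_fejer_trigPoly_le {X : ℝ} (hX : 0 < X) {A : ℝ} {c : ι → ℂ} {r : ι → ℝ}
    (hr : ∀ i ∈ S, 0 ≤ r i) (hA : 0 ≤ A) (hc : ∀ i ∈ S, ‖c i‖ ≤ A * r i) :
    ∫ x in (0 : ℝ)..X, (1 - x / X) * ‖trigPoly S γ c x‖ ^ 2 ≤
      2 * A ^ 2 * ∫ x in (0 : ℝ)..X, (1 - x / X) * ‖trigPoly S γ (fun i => (r i : ℂ)) x‖ ^ 2 := by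
  have h := integral_fejer_trigPoly_add S γ X c
  have h0 := integral_fejer_trigPoly_nonneg hX
    (trigPoly S γ fun i => (starRingEnd ℂ) (c i))
  -- The reflected integral is nonnegative; inserting it is what costs the factor 2.
  refine (le_add_of_nonneg_right h0).trans (h.le.trans ?_)
  rw [integral_fejer_trigPoly_real, Finset.mul_sum]
  refine Finset.sum_le_sum fun i hi => ?_
  rw [Finset.mul_sum]
  refine Finset.sum_le_sum fun j hj => ?_
  rw [← mul_assoc]
  refine mul_le_mul_of_nonneg_right ?_ (fejerKer_nonneg hX _)
  have h1 : (c i * (starRingEnd ℂ) (c j)).re ≤ (A * r i) * (A * r j) := by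
    refine (re_le_norm _).trans ?_
    rw [norm_mul, RCLike.norm_conj]
    exact mul_le_mul (hc i hi) (hc j hj) (norm_nonneg _) (mul_nonneg hA (hr i hi))
  linarith

/-- Every term of the double sum is nonnegative, so all but the pairs of equal frequency may be
dropped, and there the kernel equals X/2. This is where multiple zeros and symmetric pairs off the
line are detected. -/
theorem half_mul_sum_diag_le {X : ℝ} (hX : 0 < X) {r : ι → ℝ}
    (hr : ∀ i ∈ S, 0 ≤ r i) :
    X / 2 * ∑ i ∈ S, ∑ j ∈ S with γ j = γ i, r i * r j ≤
      ∫ x in (0 : ℝ)..X, (1 - x / X) * ‖trigPoly S γ (fun i => (r i : ℂ)) x‖ ^ 2 := by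
  rw [integral_fejer_trigPoly_real, Finset.mul_sum]
  refine Finset.sum_le_sum fun i hi => ?_
  rw [Finset.mul_sum, Finset.sum_filter]
  refine Finset.sum_le_sum fun j hj => ?_
  split_ifs with h
  · rw [h, sub_self, fejerKer_zero hX]
    linarith
  · exact mul_nonneg (mul_nonneg (hr i hi) (hr j hj)) (fejerKer_nonneg hX _)

theorem sq_intervalIntegral_le {g : ℝ → ℝ} (hg : Continuous g) {X : ℝ} (hX : 0 < X) :
    (∫ y in (0 : ℝ)..X, g y) ^ 2 ≤ X * ∫ y in (0 : ℝ)..X, g y ^ 2 := by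
  set a := (∫ y in (0 : ℝ)..X, g y) / X with ha
  have haX : ∫ y in (0 : ℝ)..X, g y = a * X := by rw [ha]; field_simp
  have h0 : 0 ≤ ∫ y in (0 : ℝ)..X, (g y - a) ^ 2 :=
    intervalIntegral.integral_nonneg hX.le fun y _ => sq_nonneg _
  have h1 : ∫ y in (0 : ℝ)..X, (g y - a) ^ 2 =
      (∫ y in (0 : ℝ)..X, g y ^ 2) - 2 * a * (∫ y in (0 : ℝ)..X, g y) + a ^ 2 * X := by
    have e : ∀ y, (g y - a) ^ 2 = g y ^ 2 - 2 * a * g y + a ^ 2 := fun y => by ring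
    simp_rw [e]
    rw [intervalIntegral.integral_add (Continuous.intervalIntegrable (by fun_prop) _ _)
      (Continuous.intervalIntegrable (by fun_prop) _ _),
      intervalIntegral.integral_sub (Continuous.intervalIntegrable (by fun_prop) _ _)
      (Continuous.intervalIntegrable (by fun_prop) _ _), intervalIntegral.integral_const_mul]
    simp
    ring
  rw [h1, haX] at h0
  rw [haX]
  nlinarith

/-- Exponential twists of the coefficients by a small amount change the mean square little. -/
theorem integral_fejer_trigPoly_twist_le {X : ℝ} (hX : 0 < X) {A : ℝ} {z : ι → ℂ} {η r : ι → ℝ}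
    (hr : ∀ i ∈ S, 0 ≤ r i) (hA : 0 ≤ A)
    (hz : ∀ i ∈ S, ∀ y ∈ Icc 0 X, ‖z i‖ * |η i| * Real.exp (y * η i) ≤ A) :
    ∫ x in (0 : ℝ)..X, (1 - x / X) *
        ‖trigPoly S γ (fun i => r i * z i * (Real.exp (x * η i) - 1 : ℝ)) x‖ ^ 2 ≤
      2 * (A * X) ^ 2 *
        ∫ x in (0 : ℝ)..X, (1 - x / X) * ‖trigPoly S γ (fun i => (r i : ℂ)) x‖ ^ 2 := by
  -- The coefficients depend on x, so the majorant principle does not apply directly. Since exp(xη)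
  -- - 1 is the integral of η exp(yη) over 0 ≤ y ≤ x, Cauchy–Schwarz and Fubini reduce to
  -- coefficients frozen at y.
  obtain ⟨h, hh⟩ : ∃ h : ℝ → ℝ → ℂ, h = fun y x => trigPoly S γ
    (fun i => r i * z i * (η i * Real.exp (y * η i) : ℝ)) x := ⟨_, rfl⟩
  have hcont : Continuous (Function.uncurry h) := by
    simp only [hh, Function.uncurry_def, trigPoly]
    fun_prop
  have hcy : ∀ x, Continuous fun y => h y x := fun x => by
    exact hcont.comp (by fun_prop : Continuous fun y : ℝ => (y, x))
  have hFTC : ∀ x, trigPoly S γ (fun i => r i * z i * (Real.exp (x * η i) - 1 : ℝ)) x =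
      ∫ y in (0 : ℝ)..x, h y x := fun x => by
    simp only [hh, trigPoly]
    rw [intervalIntegral.integral_finsetSum
      fun i _ => Continuous.intervalIntegrable (by fun_prop) _ _]
    refine Finset.sum_congr rfl fun i _ => ?_
    have h1 : ∀ y ∈ uIcc 0 x, HasDerivAt (fun y : ℝ => Real.exp (y * η i))
        (η i * Real.exp (y * η i)) y := fun y _ => by
      have : HasDerivAt (fun x : ℝ => x * η i) (η i) y := by
        simpa using (hasDerivAt_id y).mul_const (η i)
      exact this.exp.congr_deriv (mul_comm _ _)
    have h2 := intervalIntegral.integral_eq_sub_of_hasDerivAt h1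
      (Continuous.intervalIntegrable (by fun_prop) _ _)
    rw [zero_mul, Real.exp_zero] at h2
    rw [intervalIntegral.integral_mul_const, intervalIntegral.integral_const_mul,
      intervalIntegral.integral_ofReal, h2]
  have hpt : ∀ x ∈ Icc 0 X, ‖trigPoly S γ (fun i => r i * z i * (Real.exp (x * η i) - 1 : ℝ)) x‖ ^ 2
      ≤ X * ∫ y in (0 : ℝ)..X, ‖h y x‖ ^ 2 := fun x hx => by
    have hn : Continuous fun y => ‖h y x‖ := (hcy x).norm
    refine le_trans ?_ (sq_intervalIntegral_le hn hX)
    refine pow_le_pow_left₀ (norm_nonneg _) ?_ 2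
    rw [hFTC]
    refine (intervalIntegral.norm_integral_le_integral_norm hx.1).trans ?_
    exact intervalIntegral.integral_mono_interval le_rfl hx.1 hx.2
      (ae_of_all _ fun y => norm_nonneg _) (hn.intervalIntegrable _ _)
  generalize hJ : ∫ x in (0 : ℝ)..X, (1 - x / X) * ‖trigPoly S γ (fun i => (r i : ℂ)) x‖ ^ 2 = J
  have hJy : ∀ y ∈ Icc 0 X, ∫ x in (0 : ℝ)..X, (1 - x / X) * ‖h y x‖ ^ 2 ≤ 2 * A ^ 2 * J :=
    fun y hy => by
      rw [hh, ← hJ]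
      refine integral_fejer_trigPoly_le hX hr hA fun i hi => ?_
      rw [norm_mul, norm_mul, norm_real, norm_real, Real.norm_of_nonneg (hr i hi), norm_mul,
        Real.norm_eq_abs, Real.norm_eq_abs, abs_of_pos (Real.exp_pos _)]
      have := mul_le_mul_of_nonneg_left (hz i hi y hy) (hr i hi)
      linarith
  have hc2 : Continuous (Function.uncurry fun x y : ℝ => (1 - x / X) * ‖h y x‖ ^ 2) := by
    have : Continuous fun p : ℝ × ℝ => h p.2 p.1 := hcont.comp continuous_swap
    simp only [Function.uncurry_def]
    fun_prop
  have hc3 : Continuous (Function.uncurry fun y x : ℝ => (1 - x / X) * ‖h y x‖ ^ 2) :=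
    hc2.comp continuous_swap
  have hswap : ∫ x in (0 : ℝ)..X, ∫ y in (0 : ℝ)..X, (1 - x / X) * ‖h y x‖ ^ 2 =
      ∫ y in (0 : ℝ)..X, ∫ x in (0 : ℝ)..X, (1 - x / X) * ‖h y x‖ ^ 2 := by
    simp_rw [intervalIntegral.integral_of_le hX.le]
    refine integral_integral_swap ?_
    rw [Measure.prod_restrict]
    refine IntegrableOn.mono_set ?_ (prod_mono Ioc_subset_Icc_self Ioc_subset_Icc_self)
    exact hc2.continuousOn.integrableOn_compact (isCompact_Icc.prod isCompact_Icc)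
  have hwx : ∀ x ∈ Icc 0 X, 0 ≤ 1 - x / X := fun x hx => by
    rw [sub_nonneg, div_le_one hX]
    exact hx.2
  have htw : Continuous fun x => trigPoly S γ (fun i => r i * z i * (Real.exp (x * η i) - 1 : ℝ)) x := by
    simp only [trigPoly]
    fun_prop
  have hin : Continuous fun x => ∫ y in (0 : ℝ)..X, (1 - x / X) * ‖h y x‖ ^ 2 :=
    intervalIntegral.continuous_parametric_intervalIntegral_of_continuous' hc2 0 X
  have hin' : Continuous fun y => ∫ x in (0 : ℝ)..X, (1 - x / X) * ‖h y x‖ ^ 2 :=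
    intervalIntegral.continuous_parametric_intervalIntegral_of_continuous' hc3 0 X
  calc _ ≤ ∫ x in (0 : ℝ)..X, X * ∫ y in (0 : ℝ)..X, (1 - x / X) * ‖h y x‖ ^ 2 := by
        refine intervalIntegral.integral_mono_on hX.le
          (Continuous.intervalIntegrable (by fun_prop) _ _)
          (Continuous.intervalIntegrable (by fun_prop) _ _) fun x hx => ?_
        rw [intervalIntegral.integral_const_mul, mul_left_comm]
        exact mul_le_mul_of_nonneg_left (hpt x hx) (hwx x hx)
    _ = X * ∫ y in (0 : ℝ)..X, ∫ x in (0 : ℝ)..X, (1 - x / X) * ‖h y x‖ ^ 2 := by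
        rw [intervalIntegral.integral_const_mul, hswap]
    _ ≤ X * ∫ y in (0 : ℝ)..X, 2 * A ^ 2 * J := by
        refine mul_le_mul_of_nonneg_left ?_ hX.le
        exact intervalIntegral.integral_mono_on hX.le (hin'.intervalIntegrable _ _)
          (Continuous.intervalIntegrable (by fun_prop) _ _) hJy
    _ = _ := by
        simp
        ring

end Fejer


/-! ### The Fejér-weighted mean square of the Dirichlet series. -/

section DirichletMeanSquare
open Complex MeasureTheory Set
open scoped ArithmeticFunction.vonMangoldt

/-- A pointwise majorant for the square of the truncated Dirichlet series. -/
noncomputable def dirMajorant (Δ L : ℝ) (M : ℕ) (x : ℝ) : ℝ :=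
  Real.pi * Δ ^ 2 * (∑ n ∈ Finset.range (M + 1),
    dirCoeff L n ^ 2 * Real.exp (-(x - Real.log n) ^ 2 / (2 / Δ ^ 2)) +
    Real.exp (-Δ ^ 2 / (8 * (M : ℝ) ^ 2)) * ((M + 1) * (L + 2)) ^ 2)

theorem continuous_dirMajorant (Δ L : ℝ) (M : ℕ) : Continuous (dirMajorant Δ L M) := by
  unfold dirMajorant
  fun_prop

theorem add_sq_le_mul_add_mul {a b κ : ℝ} (hκ : 0 < κ) :
    (a + b) ^ 2 ≤ (1 + κ) * a ^ 2 + (1 + 1 / κ) * b ^ 2 := by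
  have h : (1 + κ) * a ^ 2 + (1 + 1 / κ) * b ^ 2 - (a + b) ^ 2 = (κ * a - b) ^ 2 / κ := by
    field_simp
    ring
  have : 0 ≤ (κ * a - b) ^ 2 / κ := by positivity
  linarith

theorem norm_sq_add_le {E : Type*} [SeminormedAddCommGroup E] (a b : E) {κ : ℝ} (hκ : 0 < κ) :
    ‖a + b‖ ^ 2 ≤ (1 + κ) * ‖a‖ ^ 2 + (1 + 1 / κ) * ‖b‖ ^ 2 :=
  (pow_le_pow_left₀ (norm_nonneg _) (norm_add_le a b) 2).trans (add_sq_le_mul_add_mul hκ)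

theorem norm_sq_tsum_dirCoeff_le {Δ X x L T κ : ℝ} (hΔ : 16 ≤ Δ ^ 2) (hΔ0 : 0 < Δ)
    (hx : x ≤ X) (hX : 0 ≤ X) (hL : 0 ≤ L) (hκ : 0 < κ) {M : ℕ}
    (hM : ⌊Real.exp (X + 1 / 2)⌋₊ = M) :
    ‖∑' n : ℕ, (dirCoeff L n : ℂ) * gaussKer Δ T (x - Real.log n)‖ ^ 2 ≤
      (1 + κ) * dirMajorant Δ L M x +
        (1 + 1 / κ) * (8 * Δ * Real.exp (2 * X + 1 - Δ ^ 2 / 16)) ^ 2 := by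
  have h1 := norm_tsum_dirCoeff_sub_sum_le (L := L) (T := T) hΔ hΔ0 hx hX hM
  have h2 := norm_sq_sum_dirCoeff_le (x := x) (T := T) hΔ0 hL M
  have h3 := norm_sq_add_le (∑ n ∈ Finset.range (M + 1),
    (dirCoeff L n : ℂ) * gaussKer Δ T (x - Real.log n))
    (∑' n : ℕ, (dirCoeff L n : ℂ) * gaussKer Δ T (x - Real.log n) -
      ∑ n ∈ Finset.range (M + 1), (dirCoeff L n : ℂ) * gaussKer Δ T (x - Real.log n)) hκ
  rw [add_sub_cancel] at h3
  refine h3.trans ?_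
  unfold dirMajorant
  gcongr

/-- The term n = 1 is the half bump and gives L²/2. For n > 1, Λ(n)²/n ≤ Λ(n) log n / n meets the
weight max(1 - log n/X, 0) and sums to X²/6 + O(X). The finite width of the M + 1 bumps costs the
term in (M + 1)/X. -/
theorem exists_integral_fejer_dirMajorant_le : ∃ C : ℝ, 0 ≤ C ∧ ∀ (Δ X L : ℝ) (M : ℕ), 0 < Δ →
    0 < X → 0 ≤ L → ⌊Real.exp (X + 1 / 2)⌋₊ = M →
    ∫ x in (0 : ℝ)..X, (1 - x / X) * dirMajorant Δ L M x ≤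
      Real.pi * Real.sqrt (2 * Real.pi) * Δ * (L ^ 2 / 2 + X ^ 2 / 6 + C * X) +
      16 * Real.pi * (M + 1) / X + Real.pi * Δ ^ 2 * X *
        (Real.exp (-Δ ^ 2 / (8 * (M : ℝ) ^ 2)) * ((M + 1) * (L + 2)) ^ 2) := by
  obtain ⟨C, hC0, hC⟩ := exists_sum_vonMangoldt_mul_log_le
  refine ⟨C, hC0, fun Δ X L M hΔ hX hL hM => ?_⟩
  generalize hE : Real.exp (-Δ ^ 2 / (8 * (M : ℝ) ^ 2)) * ((M + 1) * (L + 2)) ^ 2 = E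
  have hE0 : 0 ≤ E := by rw [← hE]; positivity
  set J : ℝ → ℝ := fun l => ∫ x in (0 : ℝ)..X, (1 - x / X) * Real.exp (-(x - l) ^ 2 / (2 / Δ ^ 2))
    with hJ
  have hintg : ∫ x in (0 : ℝ)..X, (1 - x / X) * dirMajorant Δ L M x =
      Real.pi * Δ ^ 2 * (∑ n ∈ Finset.range (M + 1), dirCoeff L n ^ 2 * J (Real.log n) +
        E * (X / 2)) := by
    have e : ∀ x, (1 - x / X) * dirMajorant Δ L M x = Real.pi * Δ ^ 2 *
        (∑ n ∈ Finset.range (M + 1), dirCoeff L n ^ 2 *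
          ((1 - x / X) * Real.exp (-(x - Real.log n) ^ 2 / (2 / Δ ^ 2))) + E * (1 - x / X)) :=
      fun x => by
        rw [dirMajorant, hE]
        have : ∑ n ∈ Finset.range (M + 1), dirCoeff L n ^ 2 *
            ((1 - x / X) * Real.exp (-(x - Real.log n) ^ 2 / (2 / Δ ^ 2))) =
            (1 - x / X) * ∑ n ∈ Finset.range (M + 1), dirCoeff L n ^ 2 *
            Real.exp (-(x - Real.log n) ^ 2 / (2 / Δ ^ 2)) := by
          rw [Finset.mul_sum]
          exact Finset.sum_congr rfl fun n _ => by ring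
        rw [this]
        ring
    simp_rw [e]
    rw [intervalIntegral.integral_const_mul, intervalIntegral.integral_add
      (Continuous.intervalIntegrable (by fun_prop) _ _)
      (Continuous.intervalIntegrable (by fun_prop) _ _), intervalIntegral.integral_finsetSum
      fun i _ => Continuous.intervalIntegrable (by fun_prop) _ _,
      intervalIntegral.integral_const_mul]
    have h1 := fejerKer_zero hX
    simp only [fejerKer, mul_zero, Real.cos_zero, mul_one] at h1
    rw [h1]
    congr 2
    refine Finset.sum_congr rfl fun n _ => ?_
    rw [intervalIntegral.integral_const_mul]
  have hM1 : 1 ≤ M := by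
    rw [← hM, Nat.one_le_floor_iff]
    exact Real.one_le_exp (by linarith)
  set s := Real.sqrt (2 * Real.pi) / Δ with hs
  have hs0 : 0 ≤ s := by positivity
  have hterm : ∀ n ∈ Finset.range (M + 1), dirCoeff L n ^ 2 * J (Real.log n) ≤
      (if n = 1 then L ^ 2 * (s / 2) else 0) +
      s * (Real.log n * max (1 - Real.log n / X) 0 * (Λ n / n)) + 16 / (X * Δ ^ 2) := by
    intro n _
    have h16 : 0 ≤ 16 / (X * Δ ^ 2) := by positivity
    by_cases hn : n = 1
    · subst hn
      have h1 := integral_fejer_gaussian_zero_le hΔ hX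
      have h2 : J 0 ≤ s / 2 := by
        simp only [hJ, sub_zero]
        exact h1
      simp only [dirCoeff_one, Nat.cast_one, Real.log_one, if_true, zero_mul, mul_zero, add_zero]
      have := mul_le_mul_of_nonneg_left h2 (sq_nonneg L)
      linarith
    · have h1 := integral_fejer_gaussian_le hΔ hX (Real.log n)
      have h3 : dirCoeff L n ^ 2 ≤ 4 := by
        have := abs_dirCoeff_le hn L
        rw [← sq_abs]
        nlinarith [abs_nonneg (dirCoeff L n)]
      have h4 := dirCoeff_sq_le hn L
      simp only [hn, if_false, zero_add]
      have hm : 0 ≤ max (1 - Real.log n / X) 0 := le_max_right _ _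
      calc dirCoeff L n ^ 2 * J (Real.log n)
          ≤ dirCoeff L n ^ 2 * (max (1 - Real.log n / X) 0 * s + 4 / (X * Δ ^ 2)) :=
            mul_le_mul_of_nonneg_left h1 (sq_nonneg _)
        _ = dirCoeff L n ^ 2 * (max (1 - Real.log n / X) 0 * s) +
            dirCoeff L n ^ 2 * (4 / (X * Δ ^ 2)) := by ring
        _ ≤ (Real.log n * (Λ n / n)) * (max (1 - Real.log n / X) 0 * s) +
            4 * (4 / (X * Δ ^ 2)) := by gcongr
        _ = _ := by ring
  have hN : ⌊Real.exp X⌋₊ ≤ M := by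
    rw [← hM]
    exact Nat.floor_le_floor (Real.exp_le_exp.2 (by linarith))
  have hmert : ∑ n ∈ Finset.range (M + 1),
      Real.log n * max (1 - Real.log n / X) 0 * (Λ n / n) ≤ X ^ 2 / 6 + C * X := by
    refine le_trans (le_of_eq ?_) (hC X hX)
    symm
    refine (Finset.sum_congr rfl fun n hn => ?_).trans
      (Finset.sum_subset (s₁ := Finset.Icc 0 ⌊Real.exp X⌋₊) ?_ fun n _ hn => ?_)
    · have hn' : (n : ℝ) ≤ Real.exp X :=
        (Nat.le_floor_iff (Real.exp_pos X).le).1 (Finset.mem_Icc.1 hn).2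
      rcases Nat.eq_zero_or_pos n with rfl | h
      · simp
      have hl : Real.log n ≤ X := by
        have := Real.log_le_log (by exact_mod_cast h) hn'
        rwa [Real.log_exp] at this
      rw [max_eq_left]
      rw [sub_nonneg, div_le_one hX]
      exact hl
    · intro n hn
      have := (Finset.mem_Icc.1 hn).2
      exact Finset.mem_range.2 (by omega)
    · have hn' : ⌊Real.exp X⌋₊ < n := by
        by_contra! h
        exact hn (Finset.mem_Icc.2 ⟨Nat.zero_le _, h⟩)
      have h1 := (Nat.floor_lt (Real.exp_pos _).le).1 hn'
      have h2 : X ≤ Real.log n := by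
        rw [Real.le_log_iff_exp_le ((Real.exp_pos _).trans h1)]
        exact h1.le
      rw [max_eq_right]
      · ring
      · rw [sub_nonpos, one_le_div hX]
        exact h2
  have hsum : ∑ n ∈ Finset.range (M + 1), dirCoeff L n ^ 2 * J (Real.log n) ≤
      L ^ 2 * (s / 2) + s * (X ^ 2 / 6 + C * X) + (M + 1) * (16 / (X * Δ ^ 2)) := by
    refine (Finset.sum_le_sum hterm).trans ?_
    rw [Finset.sum_add_distrib, Finset.sum_add_distrib, ← Finset.mul_sum]
    have h1 : ∑ n ∈ Finset.range (M + 1), (if n = 1 then L ^ 2 * (s / 2) else 0) ≤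
        L ^ 2 * (s / 2) := by
      rw [Finset.sum_ite_eq']
      split_ifs
      · exact le_rfl
      · positivity
    have h2 : ∑ _n ∈ Finset.range (M + 1), 16 / (X * Δ ^ 2) = (M + 1) * (16 / (X * Δ ^ 2)) := by
      rw [Finset.sum_const, Finset.card_range, nsmul_eq_mul]
      push_cast
      rfl
    rw [h2]
    gcongr
  rw [hintg]
  have hEX : E * (X / 2) ≤ E * X := by
    refine mul_le_mul_of_nonneg_left (by linarith) hE0
  calc _ ≤ Real.pi * Δ ^ 2 * ((L ^ 2 * (s / 2) + s * (X ^ 2 / 6 + C * X) +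
        (M + 1) * (16 / (X * Δ ^ 2))) + E * X) := by gcongr
    _ = _ := by
      rw [hs]
      field_simp
      ring

end DirichletMeanSquare


/-! ### Zeros near height T, and their projection to the critical line. -/

section GoodZeros
open Complex MeasureTheory Set

theorem finite_zeros_Ioc {a : ℝ} (ha : 0 < a) (b : ℝ) :
    {ρ : ℂ | riemannZeta ρ = 0 ∧ a < ρ.im ∧ ρ.im ≤ b}.Finite := by
  have hK : IsCompact (Icc (0 : ℝ) 1 ×ℂ Icc a b) := isCompact_Icc.reProdIm isCompact_Icc
  refine hK.inter_riemannZetaZeros_finite.subset ?_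
  rintro s ⟨h0, h1, h2⟩
  have h := re_mem_of_zetaZero h0 (by linarith : 0 < s.im).ne'
  exact ⟨⟨⟨h.1.le, h.2.le⟩, ⟨h1.le, h2⟩⟩, h0⟩

open Classical in
/-- The zeros of `ζ` with imaginary part in `(a, b]`, for positive `a`. -/
noncomputable def zerosBetween (a b : ℝ) : Finset ℂ :=
  if h : 0 < a then (finite_zeros_Ioc h b).toFinset else ∅

theorem mem_zerosBetween {a b : ℝ} (ha : 0 < a) {ρ : ℂ} :
    ρ ∈ zerosBetween a b ↔ riemannZeta ρ = 0 ∧ a < ρ.im ∧ ρ.im ≤ b := by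
  rw [zerosBetween, dif_pos ha, Finite.mem_toFinset]
  rfl

theorem stripMult_eq_of_im_ne_zero {ρ : ℂ} (h0 : riemannZeta ρ = 0) (him : ρ.im ≠ 0) :
    stripMult ρ = zetaMult ρ := by
  have h := re_mem_of_zetaZero h0 him
  exact stripMult_of_mem ⟨h0, by linarith, by linarith⟩

/-- The Gaussian weight at height `t`. -/
noncomputable def gaussWeight (Δ T t : ℝ) : ℝ := Real.exp (-(t - T) ^ 2 / Δ ^ 2)

/-- The multiplicity of a zero weighted by the Gaussian. -/
noncomputable def zeroWeight (Δ T : ℝ) (ρ : ℂ) : ℝ := stripMult ρ * gaussWeight Δ T ρ.im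

theorem zeroWeight_nonneg (Δ T : ℝ) (ρ : ℂ) : 0 ≤ zeroWeight Δ T ρ :=
  mul_nonneg (stripMult_nonneg ρ) (Real.exp_pos _).le

/-- The discrepancy factor coming from the distance of the zero to the critical line. -/
noncomputable def offLineFactor (Δ T : ℝ) (ρ : ℂ) : ℂ :=
  exp ((((ρ.re - 1 / 2) ^ 2 / Δ ^ 2 : ℝ) : ℂ) +
    ((2 * (ρ.re - 1 / 2) * (ρ.im - T) / Δ ^ 2 : ℝ) : ℂ) * I)

theorem gaussTest_eq (Δ T x : ℝ) (ρ : ℂ) : gaussTest Δ T x ρ =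
    gaussWeight Δ T ρ.im * offLineFactor Δ T ρ * (Real.exp (x * (ρ.re - 1 / 2)) : ℝ) *
      exp ((x * ρ.im : ℝ) * I) := by
  rw [gaussTest, gaussWeight, offLineFactor, ofReal_exp, ofReal_exp, ← exp_add, ← exp_add,
    ← exp_add]
  congr 1
  have h : ρ = ρ.re + ρ.im * I := (re_add_im ρ).symm
  have h2 : (ρ - 1 / 2 - T * I) ^ 2 = ((ρ.re - 1 / 2 : ℂ)) ^ 2 - (ρ.im - T : ℂ) ^ 2 +
      2 * (ρ.re - 1 / 2 : ℂ) * (ρ.im - T) * I := by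
    nth_rw 1 [h]
    linear_combination ((ρ.im : ℂ) - T) ^ 2 * I_sq
  rw [h2]
  nth_rw 5 [h]
  push_cast
  ring

theorem norm_offLineFactor_sub_one_le {Δ T δ : ℝ} {ρ : ℂ} (hδ : δ ≤ 1)
    (h1 : (ρ.re - 1 / 2) ^ 2 / Δ ^ 2 ≤ δ / 2)
    (h2 : |2 * (ρ.re - 1 / 2) * (ρ.im - T) / Δ ^ 2| ≤ δ / 2) :
    ‖offLineFactor Δ T ρ - 1‖ ≤ 2 * δ := by
  have h : ‖(((ρ.re - 1 / 2) ^ 2 / Δ ^ 2 : ℝ) : ℂ) +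
      ((2 * (ρ.re - 1 / 2) * (ρ.im - T) / Δ ^ 2 : ℝ) : ℂ) * I‖ ≤ δ := by
    refine (norm_add_le _ _).trans ?_
    rw [norm_mul, norm_I, mul_one, norm_real, norm_real, Real.norm_of_nonneg (by positivity),
      Real.norm_eq_abs]
    linarith
  exact (norm_exp_sub_one_le (h.trans hδ)).trans (by linarith)

theorem sum_gaussTest_eq (S : Finset ℂ) (Δ T x : ℝ) :
    ∑ ρ ∈ S, (stripMult ρ : ℂ) * gaussTest Δ T x ρ =
      trigPoly S im (fun ρ => (zeroWeight Δ T ρ : ℂ)) x +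
      (trigPoly S im
        (fun ρ => zeroWeight Δ T ρ * (offLineFactor Δ T ρ - 1)) x +
      trigPoly S im
        (fun ρ => zeroWeight Δ T ρ * offLineFactor Δ T ρ *
          (Real.exp (x * (ρ.re - 1 / 2)) - 1 : ℝ)) x) := by
  simp only [trigPoly]
  rw [← Finset.sum_add_distrib, ← Finset.sum_add_distrib]
  refine Finset.sum_congr rfl fun ρ _ => ?_
  rw [gaussTest_eq, zeroWeight]
  push_cast
  ring

/-- The standing assumptions relating the height `Y`, the centre `T` and the distance `δ / log Y`
of the zeros to the critical line. -/
structure NearLine (Y T δ : ℝ) : Prop where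
  exp_le : Real.exp 1 ≤ Y
  log_sq_le : 36 * Real.log Y ^ 2 ≤ Y
  le_T : Y / 2 ≤ T
  T_le : T ≤ 3 * Y
  δ_nonneg : 0 ≤ δ
  δ_le : δ ≤ 1
  near : ∀ ρ ∈ zerosBetween (Y / 4) (4 * Y), |ρ.re - 1 / 2| * Real.log Y ≤ δ

namespace NearLine

variable {Y T δ : ℝ}

theorem one_le (h : NearLine Y T δ) : 1 ≤ Y := (Real.one_le_exp zero_le_one).trans h.exp_le

theorem one_le_log (h : NearLine Y T δ) : 1 ≤ Real.log Y := by
  have := h.one_le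
  rw [Real.le_log_iff_exp_le (by linarith)]
  exact h.exp_le

theorem width_ge (h : NearLine Y T δ) : 16 ≤ Y / Real.log Y := by
  have := h.one_le_log
  rw [le_div_iff₀ (by linarith)]
  nlinarith [h.log_sq_le]

theorem abs_re_le (h : NearLine Y T δ) {ρ : ℂ} (hρ : ρ ∈ zerosBetween (Y / 4) (4 * Y)) :
    |ρ.re - 1 / 2| ≤ δ := by
  have h1 := h.near ρ hρ
  have h2 := h.one_le_log
  nlinarith [abs_nonneg (ρ.re - 1 / 2)]

/-- The phase is at most 8δY/Δ², and 36 log²Y ≤ Y means Δ² ≥ 36Y, which leaves room to spare. -/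
theorem norm_offLineFactor_sub_one (h : NearLine Y T δ) {ρ : ℂ}
    (hρ : ρ ∈ zerosBetween (Y / 4) (4 * Y)) :
    ‖offLineFactor (Y / Real.log Y) T ρ - 1‖ ≤ 2 * δ := by
  have hL := h.one_le_log
  have hY := h.one_le
  have hLs := h.log_sq_le
  have hre := h.abs_re_le hρ
  have hδ := h.δ_nonneg
  have hδ1 := h.δ_le
  have hw := h.width_ge
  obtain ⟨-, h3, h4⟩ := (mem_zerosBetween (by linarith)).1 hρ
  set Δ := Y / Real.log Y with hΔ
  have hΔ2 : Y ^ 2 = Δ ^ 2 * Real.log Y ^ 2 := by rw [hΔ]; field_simp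
  have hΔ36 : 36 * Y ≤ Δ ^ 2 := by
    have : 36 * Y * Real.log Y ^ 2 ≤ Δ ^ 2 * Real.log Y ^ 2 := by
      rw [← hΔ2]
      nlinarith
    exact le_of_mul_le_mul_right this (by positivity)
  refine norm_offLineFactor_sub_one_le hδ1 ?_ ?_
  · rw [div_le_iff₀ (by positivity), ← sq_abs]
    nlinarith [abs_nonneg (ρ.re - 1 / 2)]
  · have h5 : |ρ.im - T| ≤ 4 * Y := by
      rw [abs_le]
      constructor <;> linarith [h.le_T, h.T_le]
    rw [abs_div, abs_mul, abs_mul, abs_of_pos (by positivity : (0 : ℝ) < Δ ^ 2),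
      div_le_iff₀ (by positivity), abs_of_pos (two_pos : (0 : ℝ) < 2)]
    calc 2 * |ρ.re - 1 / 2| * |ρ.im - T| ≤ 2 * δ * (4 * Y) := by gcongr
      _ ≤ δ / 2 * Δ ^ 2 := by nlinarith

theorem norm_offLineFactor_le (h : NearLine Y T δ) {ρ : ℂ}
    (hρ : ρ ∈ zerosBetween (Y / 4) (4 * Y)) :
    ‖offLineFactor (Y / Real.log Y) T ρ‖ ≤ 1 + 2 * δ := by
  have h1 := norm_le_norm_add_norm_sub' (offLineFactor (Y / Real.log Y) T ρ) 1
  rw [norm_one] at h1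
  linarith [h.norm_offLineFactor_sub_one hρ]

/-- Moving the zeros to the critical line changes the mean square little. -/
theorem integral_fejer_sub_le (h : NearLine Y T δ) {X : ℝ} (hX : 0 < X) (hXL : X ≤ Real.log Y) :
    ∫ x in (0 : ℝ)..X, (1 - x / X) *
      ‖trigPoly (zerosBetween (Y / 4) (4 * Y)) im
        (fun ρ => (zeroWeight (Y / Real.log Y) T ρ : ℂ)) x -
      ∑ ρ ∈ zerosBetween (Y / 4) (4 * Y), (stripMult ρ : ℂ) * gaussTest (Y / Real.log Y) T x ρ‖ ^ 2
      ≤ 340 * δ ^ 2 * ∫ x in (0 : ℝ)..X, (1 - x / X) *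
        ‖trigPoly (zerosBetween (Y / 4) (4 * Y)) im
          (fun ρ => (zeroWeight (Y / Real.log Y) T ρ : ℂ)) x‖ ^ 2 := by
  have hL := h.one_le_log
  have hδ := h.δ_nonneg
  have hδ1 := h.δ_le
  simp_rw [sum_gaussTest_eq]
  generalize hΔ : Y / Real.log Y = Δ
  have hz1 := fun ρ hρ => h.norm_offLineFactor_sub_one (ρ := ρ) hρ
  have hz2 := fun ρ hρ => h.norm_offLineFactor_le (ρ := ρ) hρ
  rw [hΔ] at hz1 hz2
  have hnear := h.near
  generalize zerosBetween (Y / 4) (4 * Y) = S at *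
  -- The discrepancy has two parts. This one is independent of x, of relative size 2δ.
  have h1 := integral_fejer_trigPoly_le (S := S) (γ := im) hX (A := 2 * δ)
    (c := fun ρ => zeroWeight Δ T ρ * (offLineFactor Δ T ρ - 1)) (r := zeroWeight Δ T)
    (fun ρ _ => zeroWeight_nonneg Δ T ρ) (by positivity) fun ρ hρ => by
      rw [norm_mul, norm_real, Real.norm_of_nonneg (zeroWeight_nonneg Δ T ρ), mul_comm]
      exact mul_le_mul_of_nonneg_right (hz1 ρ hρ) (zeroWeight_nonneg Δ T ρ)
  -- The x-dependent part. As y ≤ log Y, the exponent y(β - 1/2) is at most δ ≤ 1, so A is 3 for the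
  -- factor z, times δ/log Y, times 3 for the exponential. Together the two parts give 16δ² + 324δ²
  -- = 340δ².
  have h2 := integral_fejer_trigPoly_twist_le (S := S) (γ := im) hX (A := 9 * δ / Real.log Y)
    (z := offLineFactor Δ T) (η := fun ρ => ρ.re - 1 / 2) (r := zeroWeight Δ T)
    (fun ρ _ => zeroWeight_nonneg Δ T ρ) (by positivity) fun ρ hρ y hy => by
      have h3 := hnear ρ hρ
      have h4 : |ρ.re - 1 / 2| ≤ δ / Real.log Y := by rwa [le_div_iff₀ (by linarith)]
      have h5 : Real.exp (y * (ρ.re - 1 / 2)) ≤ 3 := by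
        refine (Real.exp_le_exp.2 (?_ : _ ≤ (1 : ℝ))).trans (by linarith [Real.exp_one_lt_d9])
        refine (le_abs_self _).trans ?_
        rw [abs_mul, abs_of_nonneg hy.1, mul_comm]
        have := mul_le_mul_of_nonneg_left (hy.2.trans hXL) (abs_nonneg (ρ.re - 1 / 2))
        linarith
      calc _ ≤ 3 * (δ / Real.log Y) * 3 := by
            gcongr
            linarith [hz2 ρ hρ]
        _ = _ := by ring
  set J := ∫ x in (0 : ℝ)..X, (1 - x / X) * ‖trigPoly S im (fun ρ => (zeroWeight Δ T ρ : ℂ)) x‖ ^ 2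
  have hJ0 : 0 ≤ J := integral_fejer_trigPoly_nonneg hX _
  have hAX : (9 * δ / Real.log Y * X) ^ 2 ≤ (9 * δ) ^ 2 := by
    refine pow_le_pow_left₀ (by positivity) ?_ 2
    rw [div_mul_eq_mul_div, div_le_iff₀ (by linarith)]
    gcongr
  set f := trigPoly S im (fun ρ => zeroWeight Δ T ρ * (offLineFactor Δ T ρ - 1))
  set g : ℝ → ℂ := fun x => trigPoly S im (fun ρ => zeroWeight Δ T ρ * offLineFactor Δ T ρ *
    (Real.exp (x * (ρ.re - 1 / 2)) - 1 : ℝ)) x with hg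
  have hfc : Continuous f := continuous_trigPoly _ _ _
  have hgc : Continuous g := by
    simp only [hg, trigPoly]
    fun_prop
  calc _ ≤ ∫ x in (0 : ℝ)..X, (2 * ((1 - x / X) * ‖f x‖ ^ 2) + 2 * ((1 - x / X) * ‖g x‖ ^ 2)) := by
        refine intervalIntegral.integral_mono_on hX.le ?_
          (Continuous.intervalIntegrable (by fun_prop) _ _) fun x hx => ?_
        · have : ∀ x, trigPoly S im (fun ρ => (zeroWeight Δ T ρ : ℂ)) x -
            (trigPoly S im (fun ρ => (zeroWeight Δ T ρ : ℂ)) x + (f x + g x)) = -(f x + g x) :=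
            fun x => by ring
          refine Continuous.intervalIntegrable ?_ _ _
          have h6 : Continuous fun x => (1 - x / X) * ‖-(f x + g x)‖ ^ 2 := by fun_prop
          refine h6.congr fun x => ?_
          rw [← this]
        · have hw : 0 ≤ 1 - x / X := by
            rw [sub_nonneg, div_le_one hX]
            exact hx.2
          have h3 := norm_sq_add_le (f x) (g x) (κ := 1) one_pos
          rw [sub_add_cancel_left, norm_neg]
          calc _ ≤ (1 - x / X) * ((1 + 1) * ‖f x‖ ^ 2 + (1 + 1 / 1) * ‖g x‖ ^ 2) :=
                mul_le_mul_of_nonneg_left h3 hw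
            _ = _ := by ring
    _ = 2 * (∫ x in (0 : ℝ)..X, (1 - x / X) * ‖f x‖ ^ 2) +
        2 * ∫ x in (0 : ℝ)..X, (1 - x / X) * ‖g x‖ ^ 2 := by
        rw [intervalIntegral.integral_add (Continuous.intervalIntegrable (by fun_prop) _ _)
          (Continuous.intervalIntegrable (by fun_prop) _ _), intervalIntegral.integral_const_mul,
          intervalIntegral.integral_const_mul]
    _ ≤ 2 * (2 * (2 * δ) ^ 2 * J) + 2 * (2 * (9 * δ) ^ 2 * J) := by
        have := h2.trans (mul_le_mul_of_nonneg_right (mul_le_mul_of_nonneg_left hAX two_pos.le) hJ0)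
        gcongr
    _ = _ := by ring

end NearLine

end GoodZeros


/-! ### Distant zeros and the pole. -/

section NegligibleTerms
open Complex MeasureTheory Set

/-- A distance of Y/4 is log Y/4 widths, so the Gaussian exponent is at least log²Y/16. Half of it
gives exp(-log²Y/32), which beats every power of Y; the other half gives summable decay. -/
theorem norm_gaussTest_le_of_far {Y T x : ℝ} {ρ : ℂ} (hY : 1 ≤ Y) (hL : 1 ≤ Real.log Y)
    (hT : Y / 2 ≤ T) (hT' : T ≤ 3 * Y) (hx : 0 ≤ x) (hxL : x ≤ Real.log Y)
    (hre : |ρ.re - 1 / 2| ≤ 1) (hfar : Y / 4 ≤ |ρ.im - T|) (hw : 1 ≤ Y / Real.log Y) :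
    ‖gaussTest (Y / Real.log Y) T x ρ‖ ≤
      3174 * (Y ^ 5 * Real.exp (-(Real.log Y ^ 2 / 32))) * ((1 + ρ.im ^ 2) ^ 2)⁻¹ := by
  rw [norm_gaussTest]
  have hΔY : Y / Real.log Y ≤ Y := div_le_self (by linarith) hL
  set L := Real.log Y with hLdef
  have hYL : Real.exp L = Y := Real.exp_log (by linarith)
  set Δ := Y / L with hΔ
  have hΔ0 : 0 < Δ := by linarith
  have hΔL : Y = Δ * L := by rw [hΔ]; field_simp
  set w := (ρ.im - T) ^ 2 / Δ ^ 2 with hw'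
  have hwL : L ^ 2 / 16 ≤ w := by
    rw [hw', le_div_iff₀ (by positivity), ← sq_abs (ρ.im - T)]
    have h1 := pow_le_pow_left₀ (by positivity) hfar 2
    have h2 : L ^ 2 / 16 * Δ ^ 2 = (Y / 4) ^ 2 := by rw [hΔL]; ring
    linarith
  have h1 : ((ρ.re - 1 / 2) ^ 2 - (ρ.im - T) ^ 2) / Δ ^ 2 + x * (ρ.re - 1 / 2) ≤
      1 + L + (-(L ^ 2 / 32)) + (-(ρ.im - T) ^ 2 / (2 * Δ ^ 2)) := by
    have e1 : ((ρ.re - 1 / 2) ^ 2 - (ρ.im - T) ^ 2) / Δ ^ 2 = (ρ.re - 1 / 2) ^ 2 / Δ ^ 2 - w := by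
      rw [hw']; ring
    have e2 : -(ρ.im - T) ^ 2 / (2 * Δ ^ 2) = -(w / 2) := by rw [hw']; field_simp
    have h2 : (ρ.re - 1 / 2) ^ 2 / Δ ^ 2 ≤ 1 := by
      rw [div_le_one (by positivity)]
      have := (sq_le_one_iff_abs_le_one _).2 hre
      nlinarith
    have h3 : x * (ρ.re - 1 / 2) ≤ L := by
      refine (le_abs_self _).trans ?_
      rw [abs_mul, abs_of_nonneg hx]
      exact (mul_le_of_le_one_right hx hre).trans hxL
    rw [e1, e2]
    linarith
  refine (Real.exp_le_exp.2 h1).trans ?_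
  rw [Real.exp_add, Real.exp_add, Real.exp_add, hYL]
  have h4 := exp_neg_sq_div_le (D := 2 * Δ ^ 2) (by positivity) T ρ.im
  have h5 : 2 * (1 + 2 * T ^ 2 + 2 * (2 * Δ ^ 2)) ^ 2 ≤ 1058 * Y ^ 4 := by
    have h6 : 1 + 2 * T ^ 2 + 2 * (2 * Δ ^ 2) ≤ 23 * Y ^ 2 := by nlinarith
    calc 2 * (1 + 2 * T ^ 2 + 2 * (2 * Δ ^ 2)) ^ 2 ≤ 2 * (23 * Y ^ 2) ^ 2 := by gcongr
      _ = _ := by ring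
  have h7 : Real.exp 1 ≤ 3 := by linarith [Real.exp_one_lt_d9]
  calc Real.exp 1 * Y * Real.exp (-(L ^ 2 / 32)) * Real.exp (-(ρ.im - T) ^ 2 / (2 * Δ ^ 2))
      ≤ 3 * Y * Real.exp (-(L ^ 2 / 32)) * (1058 * Y ^ 4 * ((1 + ρ.im ^ 2) ^ 2)⁻¹) := by
        gcongr
        exact h4.trans (by gcongr)
    _ = _ := by ring

/-- Zeros with ordinates outside (Y/4, 4Y] are at distance at least Y/4 from T, because Y/2 ≤ T ≤
3Y. For them only |β - 1/2| ≤ 1 is used, so nothing is assumed about their distance to the line. -/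
theorem exists_norm_tsum_sub_sum_le : ∃ C : ℝ, 0 ≤ C ∧ ∀ Y T δ x : ℝ, NearLine Y T δ → 0 ≤ x →
    x ≤ Real.log Y →
    ‖∑' ρ : ℂ, (stripMult ρ : ℂ) * gaussTest (Y / Real.log Y) T x ρ -
      ∑ ρ ∈ zerosBetween (Y / 4) (4 * Y),
        (stripMult ρ : ℂ) * gaussTest (Y / Real.log Y) T x ρ‖ ≤
      C * (Y ^ 5 * Real.exp (-(Real.log Y ^ 2 / 32))) := by
  set Z := ∑' ρ : ℂ, stripMult ρ * ((1 + ρ.im ^ 2) ^ 2)⁻¹ with hZ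
  have hpos : ∀ ρ : ℂ, 0 ≤ stripMult ρ * ((1 + ρ.im ^ 2) ^ 2)⁻¹ := fun ρ =>
    mul_nonneg (stripMult_nonneg ρ) (by positivity)
  have hZ0 : 0 ≤ Z := tsum_nonneg hpos
  refine ⟨3174 * Z, by positivity, fun Y T δ x h hx hxL => ?_⟩
  have hY := h.one_le
  have hL := h.one_le_log
  have hw := h.width_ge
  have hs := (stripDecay_gaussTest (Δ := Y / Real.log Y) (by linarith) T x).summable
  set E := Y ^ 5 * Real.exp (-(Real.log Y ^ 2 / 32)) with hE
  have hE0 : 0 ≤ E := by positivity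
  set S := zerosBetween (Y / 4) (4 * Y) with hS
  rw [← hs.sum_add_tsum_subtype_compl S, add_sub_cancel_left]
  have hb : ∀ ρ : {ρ : ℂ // ρ ∉ S}, ‖(stripMult ρ : ℂ) * gaussTest (Y / Real.log Y) T x ρ‖ ≤
      3174 * E * (stripMult ρ * ((1 + (ρ : ℂ).im ^ 2) ^ 2)⁻¹) := by
    rintro ⟨ρ, hρ⟩
    simp only
    rw [norm_mul, norm_real, Real.norm_of_nonneg (stripMult_nonneg ρ)]
    by_cases h0 : riemannZeta ρ = 0 ∧ -1 / 2 < ρ.re ∧ ρ.re < 3 / 2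
    · have hfar : Y / 4 ≤ |ρ.im - T| := by
        by_contra! hc
        have := abs_lt.1 hc
        refine hρ ((mem_zerosBetween (by linarith)).2 ⟨h0.1, ?_, ?_⟩) <;>
          linarith [h.le_T, h.T_le]
      have h1 := norm_gaussTest_le_of_far hY hL h.le_T h.T_le hx hxL
        (abs_le.2 ⟨by linarith [h0.2.1], by linarith [h0.2.2]⟩) hfar (by linarith)
      have := mul_le_mul_of_nonneg_left h1 (stripMult_nonneg ρ)
      linarith
    · simp [stripMult_of_notMem h0]
  have hsub : Summable fun ρ : {ρ : ℂ // ρ ∉ S} =>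
      stripMult ρ * ((1 + (ρ : ℂ).im ^ 2) ^ 2)⁻¹ := summable_stripMult.subtype {ρ : ℂ | ρ ∉ S}
  refine (tsum_of_norm_bounded (hsub.mul_left _).hasSum hb).trans ?_
  rw [tsum_mul_left]
  have : ∑' ρ : {ρ : ℂ // ρ ∉ S}, stripMult ρ * ((1 + (ρ : ℂ).im ^ 2) ^ 2)⁻¹ ≤ Z := by
    rw [hZ, ← summable_stripMult.sum_add_tsum_subtype_compl S]
    exact le_add_of_nonneg_left (Finset.sum_nonneg fun ρ _ => hpos ρ)
  calc _ ≤ 3174 * E * Z := by gcongr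
    _ = _ := by ring

theorem norm_gaussTest_one_le {Y T δ x : ℝ} (h : NearLine Y T δ) (hx : 0 ≤ x)
    (hxL : x ≤ Real.log Y) : ‖gaussTest (Y / Real.log Y) T x 1‖ ≤
      3174 * (Y ^ 5 * Real.exp (-(Real.log Y ^ 2 / 32))) := by
  have hw := h.width_ge
  have := norm_gaussTest_le_of_far (ρ := 1) h.one_le h.one_le_log h.le_T h.T_le hx hxL
    (by rw [abs_le]; norm_num) (by
      rw [one_im, zero_sub, abs_neg]
      refine le_trans ?_ (le_abs_self T)
      linarith [h.le_T, h.one_le]) (by linarith)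
  simpa using this

end NegligibleTerms

/-! ### Bounds for the left line, and the explicit formula in final form. -/

section MeanValues
open Complex MeasureTheory Set

/-- The pointwise bound is for counting zeros at x = 0, the mean square bound for the pair sum. Both
are smaller than the respective main terms: Y/log Y against Y, and against Y log Y. -/
theorem exists_integral_norm_leftWeight_le : ∃ C : ℝ, 0 ≤ C ∧ ∀ Y T δ : ℝ, NearLine Y T δ →
    (∀ x, ‖∫ t : ℝ, leftWeight (Y / Real.log Y) T (Real.log Y) t * exp ((x * t : ℝ) * I)‖ ≤
      C * (Y / Real.log Y)) ∧
    (Continuous fun x : ℝ => ∫ t : ℝ, leftWeight (Y / Real.log Y) T (Real.log Y) t *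
      exp ((x * t : ℝ) * I)) ∧
    ∀ X, 0 < X → ∫ x in (0 : ℝ)..X, ‖∫ t : ℝ, leftWeight (Y / Real.log Y) T (Real.log Y) t *
      exp ((x * t : ℝ) * I)‖ ^ 2 ≤ C * (Y / Real.log Y) := by
  obtain ⟨C, hC0, hC⟩ := exists_norm_leftWeight_le
  refine ⟨C * Real.sqrt (2 * Real.pi) +
    Real.exp 1 * (2 * Real.pi * Real.sqrt (2 * Real.pi) * C ^ 2), by positivity,
    fun Y T δ h => ?_⟩
  have hΔ : 0 < Y / Real.log Y := by linarith [h.width_ge]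
  have hb := fun t => hC Y T t h.exp_le h.le_T h.T_le
  have hc := continuous_leftWeight (Y / Real.log Y) T (Real.log Y)
  generalize Y / Real.log Y = Δ at *
  have hI := integrable_of_norm_le_gaussian hc hΔ hb
  refine ⟨fun x => ?_, continuous_fourier hc hI, fun X hX => ?_⟩
  · refine (norm_integral_le_integral_norm _).trans ?_
    calc _ ≤ ∫ t, C * Real.exp (-(t - T) ^ 2 / (2 * Δ ^ 2)) := by
          refine integral_mono_of_nonneg (ae_of_all _ fun t => norm_nonneg _)
            ((integrable_exp_neg_sq_div (by positivity) T).const_mul C) (ae_of_all _ fun t => ?_)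
          simp only
          rw [norm_mul, norm_exp_ofReal_mul_I, mul_one]
          exact hb t
      _ = C * (Real.sqrt (2 * Real.pi) * Δ) := by
          rw [integral_const_mul, integral_exp_neg_sq_div (by positivity),
            show Real.pi * (2 * Δ ^ 2) = (2 * Real.pi) * Δ ^ 2 by ring,
            Real.sqrt_mul (by positivity : 0 ≤ 2 * Real.pi) (Δ ^ 2), Real.sqrt_sq hΔ.le]
      _ ≤ _ := by
          rw [add_mul, ← mul_assoc]
          exact le_add_of_nonneg_right (by positivity)
  · refine (integral_norm_sq_fourier_le hc hΔ hb hX).trans ?_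
    rw [add_mul]
    have : 0 ≤ C * Real.sqrt (2 * Real.pi) * Δ := by positivity
    linarith

theorem two_pi_mul_tsum_gaussTest {Δ : ℝ} (hΔ : 0 < Δ) (hΔ' : 16 ≤ Δ ^ 2) (T x L : ℝ) :
    2 * Real.pi * ∑' ρ : ℂ, (stripMult ρ : ℂ) * gaussTest Δ T x ρ =
      2 * Real.pi * gaussTest Δ T x 1 +
      ∑' n : ℕ, (dirCoeff L n : ℂ) * gaussKer Δ T (x - Real.log n) +
      (Real.exp (-x) : ℂ) * ∫ t : ℝ, leftWeight Δ T L t * exp ((x * t : ℝ) * I) := by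
  rw [tsum_stripMult_gaussTest hΔ T x L]
  congr 2
  have hs := summable_dirCoeff_mul_gaussKer (x := x) (L := L) (T := T) hΔ' hΔ
  have h1 : HasSum (fun n : ℕ => ((if n = 1 then L else 0 : ℝ) : ℂ) * gaussKer Δ T (x - Real.log n))
      (L * gaussKer Δ T x) := by
    have := hasSum_ite_eq (1 : ℕ) ((L : ℂ) * gaussKer Δ T x)
    refine this.congr_fun ?_
    intro n
    split_ifs with hn
    · simp [hn]
    · simp
  have h2 := (h1.sub hs.hasSum).tsum_eq
  have h3 : ∀ n : ℕ, ((if n = 1 then L else 0 : ℝ) : ℂ) * gaussKer Δ T (x - Real.log n) -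
      (dirCoeff L n : ℂ) * gaussKer Δ T (x - Real.log n) =
      ((ArithmeticFunction.vonMangoldt n * Real.exp (-Real.log n / 2) : ℝ) : ℂ) *
        gaussKer Δ T (x - Real.log n) := fun n => by
    rw [dirCoeff]
    push_cast
    ring
  simp_rw [h3] at h2
  rw [h2]
  ring

end MeanValues


/-! ### Upper bound for the mean square of the zero sum. -/

section MeanSquare
open Complex MeasureTheory Set

/-- The total error in the mean square of the zero sum. -/
noncomputable def meanSquareError (C κ θ Y : ℝ) : ℝ :=
  (1 + κ) ^ 2 * (Real.pi * Real.sqrt (2 * Real.pi) * (Y / Real.log Y) * (C * (θ * Real.log Y)) +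
    16 * Real.pi * (⌊Real.exp (θ * Real.log Y + 1 / 2)⌋₊ + 1) / (θ * Real.log Y) +
    Real.pi * (Y / Real.log Y) ^ 2 * (θ * Real.log Y) *
      (Real.exp (-(Y / Real.log Y) ^ 2 / (8 * (⌊Real.exp (θ * Real.log Y + 1 / 2)⌋₊ : ℝ) ^ 2)) *
        ((⌊Real.exp (θ * Real.log Y + 1 / 2)⌋₊ + 1) * (Real.log Y + 2)) ^ 2)) +
  (1 + κ) * (1 + 1 / κ) * (θ * Real.log Y) * (8 * (Y / Real.log Y) *
    Real.exp (2 * (θ * Real.log Y) + 1 - (Y / Real.log Y) ^ 2 / 16)) ^ 2 +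
  4 * (1 + 1 / κ) * (8 * Real.pi ^ 2 * (C * (Y ^ 5 * Real.exp (-(Real.log Y ^ 2 / 32)))) ^ 2 *
    (θ * Real.log Y) + C * (Y / Real.log Y))

theorem norm_sq_add_four_le {E : Type*} [SeminormedAddCommGroup E] (a b c d : E) :
    ‖a + b + c + d‖ ^ 2 ≤ 4 * (‖a‖ ^ 2 + ‖b‖ ^ 2 + ‖c‖ ^ 2 + ‖d‖ ^ 2) := by
  have h := pow_le_pow_left₀ (norm_nonneg _) (norm_add₄_le (a := a) (b := b) (c := c) (d := d)) 2
  refine h.trans ?_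
  nlinarith [sq_nonneg (‖a‖ - ‖b‖), sq_nonneg (‖a‖ - ‖c‖), sq_nonneg (‖a‖ - ‖d‖),
    sq_nonneg (‖b‖ - ‖c‖), sq_nonneg (‖b‖ - ‖d‖), sq_nonneg (‖c‖ - ‖d‖)]

theorem integral_affine_combination {f g h : ℝ → ℝ} (hf : Continuous f) (hg : Continuous g)
    (hh : Continuous h) (A B P Q R X : ℝ) :
    ∫ x in (0 : ℝ)..X, (A * f x + B + P * (Q * g x + R + h x)) =
      A * (∫ x in (0 : ℝ)..X, f x) + B * X +
        P * (Q * (∫ x in (0 : ℝ)..X, g x) + R * X + ∫ x in (0 : ℝ)..X, h x) := by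
  rw [intervalIntegral.integral_add (Continuous.intervalIntegrable (by fun_prop) _ _)
    (Continuous.intervalIntegrable (by fun_prop) _ _), intervalIntegral.integral_add
    (Continuous.intervalIntegrable (by fun_prop) _ _)
    (Continuous.intervalIntegrable (by fun_prop) _ _), intervalIntegral.integral_const_mul,
    intervalIntegral.integral_const, intervalIntegral.integral_const_mul,
    intervalIntegral.integral_add (Continuous.intervalIntegrable (by fun_prop) _ _)
    (Continuous.intervalIntegrable (by fun_prop) _ _), intervalIntegral.integral_add
    (Continuous.intervalIntegrable (by fun_prop) _ _)
    (Continuous.intervalIntegrable (by fun_prop) _ _), intervalIntegral.integral_const_mul,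
    intervalIntegral.integral_const]
  simp only [smul_eq_mul, sub_zero]
  ring

set_option maxHeartbeats 1000000 in
-- The sum over projected zeros is the Dirichlet series plus four remainders: projection error,
-- distant zeros, pole, left line. The series gets the factor 1 + κ, the remainders 1 + 1/κ. The
-- projection error is at most 340δ² times the mean square being estimated, so it moves to the left
-- side, with 1360 = 4·340.
theorem exists_fejer_mean_square_le : ∃ C : ℝ, 0 ≤ C ∧ ∀ Y T δ θ κ : ℝ, NearLine Y T δ → 0 < θ →
    θ ≤ 1 → 0 < κ →
    4 * Real.pi ^ 2 * (1 - 1360 * (1 + 1 / κ) * δ ^ 2) *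
      (∫ x in (0 : ℝ)..(θ * Real.log Y), (1 - x / (θ * Real.log Y)) *
        ‖trigPoly (zerosBetween (Y / 4) (4 * Y)) im
          (fun ρ => (zeroWeight (Y / Real.log Y) T ρ : ℂ)) x‖ ^ 2) ≤
      (1 + κ) ^ 2 * (Real.pi * Real.sqrt (2 * Real.pi) * (1 / 2 + θ ^ 2 / 6)) * (Y * Real.log Y) +
        meanSquareError C κ θ Y := by
  obtain ⟨C₁, hC₁, hdir⟩ := exists_integral_fejer_dirMajorant_le
  obtain ⟨C₂, hC₂, hbad⟩ := exists_norm_tsum_sub_sum_le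
  obtain ⟨C₃, hC₃, hleft⟩ := exists_integral_norm_leftWeight_le
  refine ⟨C₁ + C₂ + C₃ + 3174, by positivity, fun Y T δ θ κ h hθ hθ1 hκ => ?_⟩
  have hL := h.one_le_log
  have hY := h.one_le
  have hw := h.width_ge
  obtain ⟨-, hEc, hEi⟩ := hleft Y T δ h
  have hlin := fun (X : ℝ) hX hXL => h.integral_fejer_sub_le (X := X) hX hXL
  have hb := fun x => hbad Y T δ x h
  have hone := fun x hx hxL => norm_gaussTest_one_le (x := x) h hx hxL
  have hΔL : Y / Real.log Y * Real.log Y ^ 2 = Y * Real.log Y := by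
    field_simp
  set C := C₁ + C₂ + C₃ + 3174 with hCdef
  have hC : 0 ≤ C := by positivity
  set β := C * (Y ^ 5 * Real.exp (-(Real.log Y ^ 2 / 32))) with hβ
  have hE0 : 0 ≤ Y ^ 5 * Real.exp (-(Real.log Y ^ 2 / 32)) := by positivity
  have hb' : ∀ x, 0 ≤ x → x ≤ Real.log Y → _ ≤ β := fun x h1 h2 => (hb x h1 h2).trans
    (mul_le_mul_of_nonneg_right (by linarith : C₂ ≤ C) hE0)
  have hone' : ∀ x, 0 ≤ x → x ≤ Real.log Y → _ ≤ β := fun x h1 h2 => (hone x h1 h2).trans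
    (mul_le_mul_of_nonneg_right (by linarith : 3174 ≤ C) hE0)
  clear hb hone hbad hleft
  unfold meanSquareError
  rw [← hβ]
  generalize zerosBetween (Y / 4) (4 * Y) = S at *
  generalize Y / Real.log Y = Δ at *
  generalize hLL : Real.log Y = L at *
  generalize hXX : θ * L = X at *
  have hX : 0 < X := by rw [← hXX]; positivity
  have hXL : X ≤ L := by rw [← hXX]; nlinarith
  have hΔ0 : 0 < Δ := by linarith
  have hΔ16 : 16 ≤ Δ ^ 2 := by nlinarith
  have hdirX := hdir Δ X L _ hΔ0 hX (by linarith) rfl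
  have hlinX := hlin X hX hXL
  have hEX := hEi X hX
  have hDp := fun x (hx : x ≤ X) => norm_sq_tsum_dirCoeff_le (T := T) hΔ16 hΔ0 hx hX.le
    (by linarith : 0 ≤ L) hκ rfl
  have hexpl := fun x => two_pi_mul_tsum_gaussTest hΔ0 hΔ16 T x L
  generalize ⌊Real.exp (X + 1 / 2)⌋₊ = M at *
  generalize hM0 : trigPoly S im (fun ρ => (zeroWeight Δ T ρ : ℂ)) = M0 at *
  have hM0c : Continuous M0 := by rw [← hM0]; exact continuous_trigPoly _ _ _
  obtain ⟨Mg, hMg⟩ : ∃ f : ℝ → ℂ, f = fun x => ∑ ρ ∈ S, (stripMult ρ : ℂ) * gaussTest Δ T x ρ :=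
    ⟨_, rfl⟩
  obtain ⟨Eh, hEh⟩ : ∃ f : ℝ → ℂ, f = fun x => ∫ t : ℝ, leftWeight Δ T L t * exp ((x * t : ℝ) * I) :=
    ⟨_, rfl⟩
  have hMgc : Continuous Mg := by
    rw [hMg]
    unfold gaussTest
    fun_prop
  have hEhc : Continuous Eh := by rw [hEh]; exact hEc
  have hDmc := continuous_dirMajorant Δ L M
  generalize hτ : 8 * Δ * Real.exp (2 * X + 1 - Δ ^ 2 / 16) = τ at *
  have hwx : ∀ x ∈ Icc 0 X, 0 ≤ 1 - x / X ∧ 1 - x / X ≤ 1 := fun x hx => by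
    rw [sub_nonneg, div_le_one hX]
    refine ⟨hx.2, ?_⟩
    have : 0 ≤ x / X := div_nonneg hx.1 hX.le
    linarith
  have hpt : ∀ x ∈ Icc 0 X, (1 - x / X) * (4 * Real.pi ^ 2 * ‖M0 x‖ ^ 2) ≤
      (1 + κ) ^ 2 * ((1 - x / X) * dirMajorant Δ L M x) + (1 + κ) * (1 + 1 / κ) * τ ^ 2 +
      4 * (1 + 1 / κ) * (4 * Real.pi ^ 2 * ((1 - x / X) * ‖M0 x - Mg x‖ ^ 2) +
        8 * Real.pi ^ 2 * β ^ 2 + ‖Eh x‖ ^ 2) := by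
    intro x hx
    obtain ⟨hw0, hw1⟩ := hwx x hx
    have hxL := hx.2.trans hXL
    set D := ∑' n : ℕ, (dirCoeff L n : ℂ) * gaussKer Δ T (x - Real.log n)
    set bad := ∑' ρ : ℂ, (stripMult ρ : ℂ) * gaussTest Δ T x ρ -
      ∑ ρ ∈ S, (stripMult ρ : ℂ) * gaussTest Δ T x ρ with hbaddef
    have h1 : 2 * Real.pi * M0 x = D + (2 * Real.pi * (M0 x - Mg x) + -(2 * Real.pi * bad) +
        2 * Real.pi * gaussTest Δ T x 1 + (Real.exp (-x) : ℂ) * Eh x) := by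
      have := hexpl x
      rw [hbaddef, hMg, hEh]
      linear_combination this
    have h2 : 4 * Real.pi ^ 2 * ‖M0 x‖ ^ 2 = ‖2 * Real.pi * M0 x‖ ^ 2 := by
      rw [norm_mul, norm_mul, RCLike.norm_two, norm_real, Real.norm_of_nonneg Real.pi_pos.le]
      ring
    have h3 : ∀ z : ℂ, ‖2 * Real.pi * z‖ ^ 2 = 4 * Real.pi ^ 2 * ‖z‖ ^ 2 := fun z => by
      rw [norm_mul, norm_mul, RCLike.norm_two, norm_real, Real.norm_of_nonneg Real.pi_pos.le]
      ring
    have h4 : ‖(Real.exp (-x) : ℂ) * Eh x‖ ^ 2 ≤ ‖Eh x‖ ^ 2 := by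
      rw [norm_mul, norm_real, Real.norm_of_nonneg (Real.exp_pos _).le]
      refine pow_le_pow_left₀ (by positivity) ?_ 2
      exact mul_le_of_le_one_left (norm_nonneg _) (Real.exp_le_one_iff.2 (by linarith [hx.1]))
    have h5 := norm_sq_add_four_le (2 * Real.pi * (M0 x - Mg x)) (-(2 * Real.pi * bad))
      (2 * Real.pi * gaussTest Δ T x 1) ((Real.exp (-x) : ℂ) * Eh x)
    rw [norm_neg, h3, h3, h3] at h5
    have h6 : ‖bad‖ ^ 2 ≤ β ^ 2 := pow_le_pow_left₀ (norm_nonneg _) (hb' x hx.1 hxL) 2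
    have h7 : ‖gaussTest Δ T x 1‖ ^ 2 ≤ β ^ 2 :=
      pow_le_pow_left₀ (norm_nonneg _) (hone' x hx.1 hxL) 2
    have h8 : ‖2 * Real.pi * M0 x‖ ^ 2 ≤ (1 + κ) * ((1 + κ) * dirMajorant Δ L M x +
        (1 + 1 / κ) * τ ^ 2) + (1 + 1 / κ) * (4 * (4 * Real.pi ^ 2 * ‖M0 x - Mg x‖ ^ 2 +
        8 * Real.pi ^ 2 * β ^ 2 + ‖Eh x‖ ^ 2)) := by
      rw [h1]
      refine (norm_sq_add_le _ _ hκ).trans ?_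
      have hpi : 0 ≤ Real.pi ^ 2 := by positivity
      gcongr
      · exact hDp x hx.2
      · have h9 := mul_le_mul_of_nonneg_left h6 (by positivity : 0 ≤ 4 * Real.pi ^ 2)
        have h10 := mul_le_mul_of_nonneg_left h7 (by positivity : 0 ≤ 4 * Real.pi ^ 2)
        refine h5.trans (mul_le_mul_of_nonneg_left ?_ (by norm_num))
        linarith only [h9, h10, h4]
    rw [h2]
    have hK : 0 ≤ 1 + 1 / κ := by positivity
    calc _ ≤ (1 - x / X) * ((1 + κ) * ((1 + κ) * dirMajorant Δ L M x +
        (1 + 1 / κ) * τ ^ 2) + (1 + 1 / κ) * (4 * (4 * Real.pi ^ 2 * ‖M0 x - Mg x‖ ^ 2 +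
        8 * Real.pi ^ 2 * β ^ 2 + ‖Eh x‖ ^ 2))) := mul_le_mul_of_nonneg_left h8 hw0
      _ = (1 + κ) ^ 2 * ((1 - x / X) * dirMajorant Δ L M x) +
          (1 - x / X) * ((1 + κ) * (1 + 1 / κ) * τ ^ 2) +
          4 * (1 + 1 / κ) * (4 * Real.pi ^ 2 * ((1 - x / X) * ‖M0 x - Mg x‖ ^ 2) +
          (1 - x / X) * (8 * Real.pi ^ 2 * β ^ 2) + (1 - x / X) * ‖Eh x‖ ^ 2) := by ring
      _ ≤ _ := add_le_add (add_le_add le_rfl (mul_le_of_le_one_left (by positivity) hw1))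
          (mul_le_mul_of_nonneg_left (add_le_add (add_le_add le_rfl
            (mul_le_of_le_one_left (by positivity) hw1))
            (mul_le_of_le_one_left (by positivity) hw1)) (by positivity))
  have hintg := intervalIntegral.integral_mono_on (μ := volume) hX.le
    (Continuous.intervalIntegrable (by fun_prop) _ _)
    (Continuous.intervalIntegrable (by fun_prop) _ _) hpt
  have hsplit : ∫ x in (0 : ℝ)..X, ((1 + κ) ^ 2 * ((1 - x / X) * dirMajorant Δ L M x) +
      (1 + κ) * (1 + 1 / κ) * τ ^ 2 +
      4 * (1 + 1 / κ) * (4 * Real.pi ^ 2 * ((1 - x / X) * ‖M0 x - Mg x‖ ^ 2) +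
        8 * Real.pi ^ 2 * β ^ 2 + ‖Eh x‖ ^ 2)) =
      (1 + κ) ^ 2 * (∫ x in (0 : ℝ)..X, (1 - x / X) * dirMajorant Δ L M x) +
      (1 + κ) * (1 + 1 / κ) * τ ^ 2 * X +
      4 * (1 + 1 / κ) * (4 * Real.pi ^ 2 * (∫ x in (0 : ℝ)..X, (1 - x / X) * ‖M0 x - Mg x‖ ^ 2) +
        8 * Real.pi ^ 2 * β ^ 2 * X + ∫ x in (0 : ℝ)..X, ‖Eh x‖ ^ 2) := by
    have := integral_affine_combination (f := fun x => (1 - x / X) * dirMajorant Δ L M x)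
      (g := fun x => (1 - x / X) * ‖M0 x - Mg x‖ ^ 2) (h := fun x => ‖Eh x‖ ^ 2) (by fun_prop)
      (by fun_prop) (by fun_prop) ((1 + κ) ^ 2) ((1 + κ) * (1 + 1 / κ) * τ ^ 2) (4 * (1 + 1 / κ))
      (4 * Real.pi ^ 2) (8 * Real.pi ^ 2 * β ^ 2) X
    exact this
  have hlhs : ∫ x in (0 : ℝ)..X, (1 - x / X) * (4 * Real.pi ^ 2 * ‖M0 x‖ ^ 2) =
      4 * Real.pi ^ 2 * ∫ x in (0 : ℝ)..X, (1 - x / X) * ‖M0 x‖ ^ 2 := by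
    rw [← intervalIntegral.integral_const_mul]
    congr 1
    ext x
    ring
  rw [hsplit, hlhs] at hintg
  have hlin' : ∫ x in (0 : ℝ)..X, (1 - x / X) * ‖M0 x - Mg x‖ ^ 2 ≤
      340 * δ ^ 2 * ∫ x in (0 : ℝ)..X, (1 - x / X) * ‖M0 x‖ ^ 2 := by
    rw [hMg]
    exact hlinX
  have hE' : ∫ x in (0 : ℝ)..X, ‖Eh x‖ ^ 2 ≤ C * Δ := by
    rw [hEh]
    exact hEX.trans (mul_le_mul_of_nonneg_right (by linarith) hΔ0.le)
  generalize ∫ x in (0 : ℝ)..X, (1 - x / X) * ‖M0 x - Mg x‖ ^ 2 = I₁ at *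
  generalize ∫ x in (0 : ℝ)..X, (1 - x / X) * ‖M0 x‖ ^ 2 = H at *
  generalize ∫ x in (0 : ℝ)..X, ‖Eh x‖ ^ 2 = I₂ at *
  have hK : 0 ≤ 1 + 1 / κ := by positivity
  have hCX : Real.pi * Real.sqrt (2 * Real.pi) * Δ * (L ^ 2 / 2 + X ^ 2 / 6 + C₁ * X) ≤
      Real.pi * Real.sqrt (2 * Real.pi) * (1 / 2 + θ ^ 2 / 6) * (Y * L) +
      Real.pi * Real.sqrt (2 * Real.pi) * Δ * (C * X) := by
    have h1 : L ^ 2 / 2 + X ^ 2 / 6 = (1 / 2 + θ ^ 2 / 6) * L ^ 2 := by rw [← hXX]; ring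
    rw [h1, ← hΔL]
    have h2 : C₁ * X ≤ C * X := mul_le_mul_of_nonneg_right (by linarith) hX.le
    have h3 := mul_le_mul_of_nonneg_left h2
      (by positivity : 0 ≤ Real.pi * Real.sqrt (2 * Real.pi) * Δ)
    linarith
  have hd2 := mul_le_mul_of_nonneg_left (hdirX.trans (add_le_add_left (add_le_add_left hCX _) _))
    (by positivity : 0 ≤ (1 + κ) ^ 2)
  have hf : 4 * (1 + 1 / κ) * (4 * Real.pi ^ 2 * I₁ + 8 * Real.pi ^ 2 * β ^ 2 * X + I₂) ≤
      4 * (1 + 1 / κ) * (4 * Real.pi ^ 2 * (340 * δ ^ 2 * H) + 8 * Real.pi ^ 2 * β ^ 2 * X +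
        C * Δ) := by gcongr
  linarith only [hintg, hd2, hf]

end MeanSquare


/-! ### The error terms are o(Y log Y). -/

section Asymptotics

theorem tendsto_pow_mul_exp_neg_log_sq (k : ℕ) {c : ℝ} (hc : 0 < c) :
    Tendsto (fun Y : ℝ => Y ^ k * Real.exp (-(c * Real.log Y ^ 2))) atTop (𝓝 0) := by
  have h1 : Tendsto (fun L : ℝ => L * (k - c * L)) atTop atBot := by
    refine tendsto_id.atTop_mul_atBot₀ ?_
    exact tendsto_atBot_add_const_left _ _ (tendsto_neg_atTop_atBot.comp
      (tendsto_id.const_mul_atTop hc))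
  refine (Real.tendsto_exp_atBot.comp (h1.comp Real.tendsto_log_atTop)).congr' ?_
  filter_upwards [eventually_gt_atTop 0] with Y hY
  simp only [Function.comp]
  rw [show Y ^ k = Real.exp (k * Real.log Y) by
    rw [mul_comm, Real.exp_mul, Real.exp_log hY, Real.rpow_natCast], ← Real.exp_add]
  congr 1
  ring

theorem tendsto_pow_mul_exp_neg_rpow (k : ℕ) {a c : ℝ} (ha : 0 < a) (hc : 0 < c) :
    Tendsto (fun Y : ℝ => Y ^ k * Real.exp (-(c * Y ^ a))) atTop (𝓝 0) := by
  refine ((tendsto_rpow_mul_exp_neg_mul_atTop_nhds_zero (k / a) c hc).comp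
    (tendsto_rpow_atTop ha)).congr' ?_
  filter_upwards [eventually_gt_atTop 0] with Y hY
  simp only [Function.comp]
  rw [← Real.rpow_mul hY.le, mul_div_cancel₀ _ ha.ne', Real.rpow_natCast, neg_mul]

theorem eventually_log_sq_le_rpow {a : ℝ} (ha : 0 < a) :
    ∀ᶠ Y : ℝ in atTop, Real.log Y ^ 2 ≤ Y ^ a := by
  filter_upwards [(isLittleO_log_rpow_atTop (half_pos ha)).bound one_pos,
    eventually_ge_atTop 1] with Y h1 hY
  have hY0 : 0 ≤ Y := by linarith
  rw [one_mul, Real.norm_of_nonneg (Real.log_nonneg hY),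
    Real.norm_of_nonneg (Real.rpow_nonneg hY0 _)] at h1
  calc Real.log Y ^ 2 ≤ (Y ^ (a / 2)) ^ 2 := pow_le_pow_left₀ (Real.log_nonneg hY) h1 2
    _ = Y ^ a := by
      rw [← Real.rpow_natCast, ← Real.rpow_mul hY0]
      congr 1
      push_cast
      ring

set_option maxHeartbeats 800000 in
-- This is where θ < 1 is needed: there are O(Y^θ) bumps, and their spacing exceeds the width 1/Δ by
-- a power of Y. The Mertens error and the left line save only a factor log Y.
theorem eventually_meanSquareError_le {C κ θ : ℝ} (hC : 0 ≤ C) (hκ : 0 < κ) (hθ : 0 < θ)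
    (hθ1 : θ < 1) {ε : ℝ} (hε : 0 < ε) :
    ∀ᶠ Y : ℝ in atTop, meanSquareError C κ θ Y ≤ ε * (Y * Real.log Y) := by
  set g : ℝ → ℝ := fun Y => (1 + κ) ^ 2 *
    (Real.pi * Real.sqrt (2 * Real.pi) * C * θ * (Real.log Y)⁻¹ +
      48 * Real.pi / θ * Y ^ (-(1 - θ)) +
      81 * Real.pi * (Y ^ 7 * Real.exp (-(1 / 32 * Y ^ (1 - θ))))) +
    (1 + κ) * (1 + 1 / κ) * (576 * (Y ^ 7 * Real.exp (-(1 / 16 * Y ^ (1 : ℝ))))) +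
    4 * (1 + 1 / κ) * (8 * Real.pi ^ 2 * C ^ 2 *
      (Y ^ 11 * Real.exp (-(1 / 32 * Real.log Y ^ 2))) + C * (Real.log Y)⁻¹) with hg
  have hlog : Tendsto (fun Y : ℝ => (Real.log Y)⁻¹) atTop (𝓝 0) :=
    tendsto_inv_atTop_zero.comp Real.tendsto_log_atTop
  have hglim : Tendsto g atTop (𝓝 0) := by
    have h1 := ((hlog.const_mul (Real.pi * Real.sqrt (2 * Real.pi) * C * θ)).add
      ((tendsto_rpow_neg_atTop (sub_pos.2 hθ1)).const_mul (48 * Real.pi / θ))).add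
      ((tendsto_pow_mul_exp_neg_rpow 7 (sub_pos.2 hθ1) (by norm_num : (0 : ℝ) < 1 / 32)).const_mul
        (81 * Real.pi))
    have h2 := (tendsto_pow_mul_exp_neg_rpow 7 one_pos (by norm_num : (0 : ℝ) < 1 / 16)).const_mul 576
    have h3 := ((tendsto_pow_mul_exp_neg_log_sq 11 (by norm_num : (0 : ℝ) < 1 / 32)).const_mul
      (8 * Real.pi ^ 2 * C ^ 2)).add (hlog.const_mul C)
    have := ((h1.const_mul ((1 + κ) ^ 2)).add (h2.const_mul ((1 + κ) * (1 + 1 / κ)))).add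
      (h3.const_mul (4 * (1 + 1 / κ)))
    simp only [mul_zero, add_zero] at this
    exact this
  filter_upwards [hglim.eventually_le_const hε, eventually_log_sq_le_rpow (sub_pos.2 hθ1),
    eventually_ge_atTop (Real.exp 1)] with Y hgY hLθ hYe
  have hY1 : 1 ≤ Y := (Real.one_le_exp zero_le_one).trans hYe
  have hY0 : 0 < Y := by linarith
  have hL1 : 1 ≤ Real.log Y := by rwa [Real.le_log_iff_exp_le hY0]
  have hLY : Real.log Y ≤ Y := by linarith [Real.log_le_sub_one_of_pos hY0]
  have hexpL : Real.exp (Real.log Y) = Y := Real.exp_log hY0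
  have hP : Y ^ (-(1 - θ)) * Y = Real.exp (θ * Real.log Y) := by
    rw [Real.rpow_def_of_pos hY0]
    nth_rw 2 [← hexpL]
    rw [← Real.exp_add]
    congr 1
    ring
  have hQ : Y ^ (1 - θ) * Real.exp (θ * Real.log Y) = Y := by
    rw [Real.rpow_def_of_pos hY0, ← Real.exp_add]
    conv_rhs => rw [← hexpL]
    congr 1
    ring
  refine le_trans ?_ (mul_le_mul_of_nonneg_right hgY (by positivity))
  simp only [hg, Real.rpow_one]
  unfold meanSquareError
  generalize hR : Y ^ (-(1 - θ)) = R at *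
  have hR0 : 0 < R := by rw [← hR]; positivity
  generalize hQQ : Y ^ (1 - θ) = Q at *
  have hQ1 : 1 ≤ Q := by
    rw [← hQQ]
    exact Real.one_le_rpow hY1 (by linarith)
  generalize Real.log Y = L at *
  have hL0 : 0 < L := by linarith
  have hPle : Real.exp (θ * L) ≤ Y := by
    rw [← hexpL]
    exact Real.exp_le_exp.2 (by nlinarith)
  have hP1 : 1 ≤ Real.exp (θ * L) := Real.one_le_exp (by positivity)
  have hhalf : Real.exp (θ * L + 1 / 2) ≤ 2 * Real.exp (θ * L) := by
    rw [Real.exp_add, mul_comm]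
    have : Real.exp (1 / 2) ≤ 2 := by
      have h1 : Real.exp (1 / 2) ^ 2 = Real.exp 1 := by
        rw [← Real.exp_nat_mul]
        norm_num
      nlinarith [Real.exp_one_lt_d9, Real.exp_pos (1 / 2)]
    gcongr
  have hMle : (⌊Real.exp (θ * L + 1 / 2)⌋₊ : ℝ) ≤ 2 * Real.exp (θ * L) :=
    (Nat.floor_le (Real.exp_pos _).le).trans hhalf
  have hM1 : (1 : ℝ) ≤ (⌊Real.exp (θ * L + 1 / 2)⌋₊ : ℝ) := by
    exact_mod_cast (Nat.one_le_floor_iff _).2 (Real.one_le_exp (by positivity))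
  generalize (⌊Real.exp (θ * L + 1 / 2)⌋₊ : ℝ) = M at *
  generalize hPP : Real.exp (θ * L) = P at *
  have hYL1 : 1 ≤ Y * L := by nlinarith
  have hΔY : Y / L ≤ Y := div_le_self hY0.le hL1
  have hΔ0 : 0 < Y / L := by positivity
  have hθL : θ * L ≤ Y := by nlinarith
  have hθL0 : 0 ≤ θ * L := by positivity
  have hpi := Real.pi_pos
  have a1 : Real.pi * Real.sqrt (2 * Real.pi) * (Y / L) * (C * (θ * L)) ≤
      Real.pi * Real.sqrt (2 * Real.pi) * C * θ * L⁻¹ * (Y * L) := by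
    refine le_of_eq ?_
    field_simp
  have a2 : 16 * Real.pi * (M + 1) / (θ * L) ≤ 48 * Real.pi / θ * R * (Y * L) := by
    have : 48 * Real.pi / θ * R * (Y * L) = 48 * Real.pi * P * L / θ := by
      rw [← hP]
      field_simp
    rw [this, div_le_div_iff₀ (by positivity) hθ]
    have h1 : M + 1 ≤ 3 * P := by linarith
    have h2 : (1 : ℝ) ≤ L * L := by nlinarith
    calc 16 * Real.pi * (M + 1) * θ ≤ 16 * Real.pi * (3 * P) * θ := by gcongr
      _ = 48 * Real.pi * P * θ * 1 := by ring
      _ ≤ 48 * Real.pi * P * θ * (L * L) := by gcongr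
      _ = _ := by ring
  have a3 : Real.pi * (Y / L) ^ 2 * (θ * L) *
      (Real.exp (-(Y / L) ^ 2 / (8 * M ^ 2)) * ((M + 1) * (L + 2)) ^ 2) ≤
      81 * Real.pi * (Y ^ 7 * Real.exp (-(1 / 32 * Q))) * (Y * L) := by
    -- From L² ≤ Q, M ≤ 2P and QP = Y.
    have h1 : Real.exp (-(Y / L) ^ 2 / (8 * M ^ 2)) ≤ Real.exp (-(1 / 32 * Q)) := by
      refine Real.exp_le_exp.2 ?_
      rw [neg_div]
      refine neg_le_neg ?_
      rw [le_div_iff₀ (by positivity), div_pow, le_div_iff₀ (by positivity)]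
      have hM2 : M ^ 2 ≤ 4 * P ^ 2 := by
        calc M ^ 2 ≤ (2 * P) ^ 2 := pow_le_pow_left₀ (by linarith) hMle 2
          _ = 4 * P ^ 2 := by ring
      calc 1 / 32 * Q * (8 * M ^ 2) * L ^ 2 ≤ 1 / 32 * Q * (8 * (4 * P ^ 2)) * Q := by gcongr
        _ = (Q * P) ^ 2 := by ring
        _ = Y ^ 2 := by rw [hQ]
    have h2 : (M + 1) * (L + 2) ≤ (3 * Y) * (3 * Y) := by
      gcongr <;> linarith
    calc _ ≤ Real.pi * Y ^ 2 * Y * (Real.exp (-(1 / 32 * Q)) * ((3 * Y) * (3 * Y)) ^ 2) := by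
          gcongr
      _ = 81 * Real.pi * (Y ^ 7 * Real.exp (-(1 / 32 * Q))) * 1 := by ring
      _ ≤ _ := by gcongr
  have hQY : Q ≤ Y := by
    rw [← hQ]
    exact le_mul_of_one_le_right (by linarith) hP1
  have a4 : (θ * L) * (8 * (Y / L) * Real.exp (2 * (θ * L) + 1 - (Y / L) ^ 2 / 16)) ^ 2 ≤
      576 * (Y ^ 7 * Real.exp (-(1 / 16 * Y))) * (Y * L) := by
    have h1 : Real.exp (2 * (θ * L) + 1 - (Y / L) ^ 2 / 16) ≤
        Y ^ 2 * 3 * Real.exp (-(1 / 16 * Y)) := by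
      have e : Real.exp (2 * (θ * L) + 1 - (Y / L) ^ 2 / 16) =
          P ^ 2 * Real.exp 1 * Real.exp (-((Y / L) ^ 2 / 16)) := by
        rw [← hPP, ← Real.exp_nat_mul, ← Real.exp_add, ← Real.exp_add]
        congr 1
      rw [e]
      have h2 : Y ≤ (Y / L) ^ 2 := by
        rw [div_pow, le_div_iff₀ (by positivity), sq Y]
        exact mul_le_mul_of_nonneg_left (hLθ.trans hQY) hY0.le
      gcongr
      · linarith [Real.exp_one_lt_d9]
      · linarith
    have h3 : Real.exp (-(1 / 16 * Y)) ^ 2 ≤ Real.exp (-(1 / 16 * Y)) := by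
      rw [sq]
      exact mul_le_of_le_one_left (Real.exp_pos _).le (Real.exp_le_one_iff.2 (by linarith))
    calc _ ≤ Y * (8 * Y * (Y ^ 2 * 3 * Real.exp (-(1 / 16 * Y)))) ^ 2 := by gcongr
      _ = 576 * (Y ^ 7 * Real.exp (-(1 / 16 * Y)) ^ 2) * 1 := by ring
      _ ≤ _ := by gcongr
  have a5 : 8 * Real.pi ^ 2 * (C * (Y ^ 5 * Real.exp (-(L ^ 2 / 32)))) ^ 2 * (θ * L) ≤
      8 * Real.pi ^ 2 * C ^ 2 * (Y ^ 11 * Real.exp (-(1 / 32 * L ^ 2))) * (Y * L) := by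
    have e : -(L ^ 2 / 32) = -(1 / 32 * L ^ 2) := by ring
    rw [e]
    have h3 : Real.exp (-(1 / 32 * L ^ 2)) ^ 2 ≤ Real.exp (-(1 / 32 * L ^ 2)) := by
      rw [sq]
      exact mul_le_of_le_one_left (Real.exp_pos _).le
        (Real.exp_le_one_iff.2 (by nlinarith [sq_nonneg L]))
    calc _ ≤ 8 * Real.pi ^ 2 * (C * (Y ^ 5 * Real.exp (-(1 / 32 * L ^ 2)))) ^ 2 * Y := by gcongr
      _ = 8 * Real.pi ^ 2 * C ^ 2 * (Y ^ 11 * Real.exp (-(1 / 32 * L ^ 2)) ^ 2) * 1 := by ring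
      _ ≤ _ := by gcongr
  have a6 : C * (Y / L) ≤ C * L⁻¹ * (Y * L) := by
    have : C * L⁻¹ * (Y * L) = C * Y := by field_simp
    rw [this]
    gcongr
  have b1 := mul_le_mul_of_nonneg_left (add_le_add (add_le_add a1 a2) a3)
    (by positivity : 0 ≤ (1 + κ) ^ 2)
  have b2 := mul_le_mul_of_nonneg_left a4 (by positivity : 0 ≤ (1 + κ) * (1 + 1 / κ))
  have b3 := mul_le_mul_of_nonneg_left (add_le_add a5 a6) (by positivity : 0 ≤ 4 * (1 + 1 / κ))
  linarith only [b1, b2, b3]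

end Asymptotics


/-! ### Gaussian-weighted counts of pairs and of zeros. -/

section LocalEstimates
open Complex MeasureTheory Set

/-- The zeros of `ζ` at height about `Y` are at distance `o(1 / log Y)` from the critical line. -/
def ZerosApproachLine : Prop := ∀ δ : ℝ, 0 < δ → ∀ᶠ Y : ℝ in atTop,
  ∀ ρ ∈ zerosBetween (Y / 4) (4 * Y), |ρ.re - 1 / 2| * Real.log Y ≤ δ

theorem ZerosApproachLine.eventually_nearLine (h : ZerosApproachLine) {δ : ℝ} (hδ : 0 < δ)
    (hδ1 : δ ≤ 1) :
    ∀ᶠ Y : ℝ in atTop, ∀ T : ℝ, Y / 2 ≤ T → T ≤ 3 * Y → NearLine Y T δ := by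
  filter_upwards [h δ hδ, eventually_ge_atTop (Real.exp 1),
    (isLittleO_log_rpow_atTop (by norm_num : (0 : ℝ) < 1 / 2)).bound
      (by norm_num : (0 : ℝ) < 1 / 6)] with Y h1 h2 h3 T hT hT'
  have hY1 : 1 ≤ Y := (Real.one_le_exp zero_le_one).trans h2
  have hL := Real.log_nonneg hY1
  refine ⟨h2, ?_, hT, hT', hδ.le, hδ1, h1⟩
  rw [← Real.sqrt_eq_rpow, Real.norm_of_nonneg hL, Real.norm_of_nonneg (Real.sqrt_nonneg _)] at h3
  have := pow_le_pow_left₀ hL h3 2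
  rw [mul_pow, Real.sq_sqrt (by linarith)] at this
  linarith

/-- The upper bound for the weighted number of pairs of zeros with equal ordinates. -/
theorem ZerosApproachLine.eventually_sum_pairs_le (h : ZerosApproachLine) {ε : ℝ} (hε : 0 < ε) :
    ∀ᶠ Y : ℝ in atTop, ∀ T : ℝ, Y / 2 ≤ T → T ≤ 3 * Y →
      ∑ ρ ∈ zerosBetween (Y / 4) (4 * Y), ∑ ρ' ∈ zerosBetween (Y / 4) (4 * Y) with ρ'.im = ρ.im,
        zeroWeight (Y / Real.log Y) T ρ * zeroWeight (Y / Real.log Y) T ρ' ≤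
      (4 / 3 + ε) * Y / (2 * Real.sqrt (2 * Real.pi)) := by
  obtain ⟨C, hC, hmain⟩ := exists_fejer_mean_square_le
  set s := Real.sqrt (2 * Real.pi) with hs
  have hs0 : 0 < s := by positivity
  have hs2 : s * s = 2 * Real.pi := Real.mul_self_sqrt (by positivity)
  have hpi := Real.pi_pos
  -- A single τ plays the roles of κ and 1 - θ, and δ = τ/60 makes the loss 1360(1 + 1/τ)δ² at most
  -- τ. At τ = 0 the expression equals ε, so continuity provides an admissible τ.
  obtain ⟨τ, hτf, hτ0, hτ1⟩ : ∃ τ : ℝ, 0 < (1 - τ) ^ 2 * (4 / 3 + ε) -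
      (1 + τ) ^ 2 * (1 + (1 - τ) ^ 2 / 3) - 2 * τ / (Real.pi * s) ∧ 0 < τ ∧ τ < 1 := by
    have hc : ContinuousAt (fun τ : ℝ => (1 - τ) ^ 2 * (4 / 3 + ε) -
      (1 + τ) ^ 2 * (1 + (1 - τ) ^ 2 / 3) - 2 * τ / (Real.pi * s)) 0 := by
      have : Continuous (fun τ : ℝ => (1 - τ) ^ 2 * (4 / 3 + ε) -
        (1 + τ) ^ 2 * (1 + (1 - τ) ^ 2 / 3) - 2 * τ / (Real.pi * s)) := by fun_prop
      exact this.continuousAt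
    have h1 := hc.eventually_const_lt (u := 0) (by norm_num; linarith)
    have h2 : ∀ᶠ τ : ℝ in 𝓝[>] 0, τ ∈ Ioo (0 : ℝ) 1 := Ioo_mem_nhdsGT one_pos
    obtain ⟨τ, h3, h4⟩ := ((h1.filter_mono nhdsWithin_le_nhds).and h2).exists
    exact ⟨τ, h3, h4.1, h4.2⟩
  filter_upwards [h.eventually_nearLine (by positivity : 0 < τ / 60) (by linarith),
    eventually_meanSquareError_le hC hτ0 (sub_pos.2 hτ1) (by linarith : 1 - τ < 1) hτ0]
    with Y hN herr T hT hT'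
  have hN := hN T hT hT'
  have hm := hmain Y T (τ / 60) (1 - τ) τ hN (sub_pos.2 hτ1) (by linarith) hτ0
  have hL := hN.one_le_log
  have hY := hN.one_le
  have hX : 0 < (1 - τ) * Real.log Y := mul_pos (sub_pos.2 hτ1) (by linarith)
  have hd := half_mul_sum_diag_le (S := zerosBetween (Y / 4) (4 * Y)) (γ := im) hX
    (r := zeroWeight (Y / Real.log Y) T) fun ρ _ => zeroWeight_nonneg _ _ ρ
  generalize ∑ ρ ∈ zerosBetween (Y / 4) (4 * Y), ∑ ρ' ∈ zerosBetween (Y / 4) (4 * Y) with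
    ρ'.im = ρ.im, zeroWeight (Y / Real.log Y) T ρ * zeroWeight (Y / Real.log Y) T ρ' = W at *
  generalize ∫ x in (0 : ℝ)..((1 - τ) * Real.log Y), (1 - x / ((1 - τ) * Real.log Y)) *
        ‖trigPoly (zerosBetween (Y / 4) (4 * Y)) im
          (fun ρ => (zeroWeight (Y / Real.log Y) T ρ : ℂ)) x‖ ^ 2 = H at *
  generalize meanSquareError C τ (1 - τ) Y = Er at *
  generalize Real.log Y = L at *
  have hν : 1360 * (1 + 1 / τ) * (τ / 60) ^ 2 ≤ τ := by
    have : 1360 * (1 + 1 / τ) * (τ / 60) ^ 2 = 1360 / 3600 * (τ ^ 2 + τ) := by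
      field_simp
      ring
    rw [this]
    nlinarith
  by_contra! hcon
  have hH0 : (1 - τ) * L / 2 * ((4 / 3 + ε) * Y / (2 * s)) < H :=
    lt_of_lt_of_le (mul_lt_mul_of_pos_left hcon (by positivity)) hd
  have hHp : 0 < H := lt_of_le_of_lt (by positivity) hH0
  have h1 : 4 * Real.pi ^ 2 * (1 - τ) * H ≤
      (1 + τ) ^ 2 * (Real.pi * s * (1 / 2 + (1 - τ) ^ 2 / 6)) * (Y * L) + τ * (Y * L) := by
    have : 4 * Real.pi ^ 2 * (1 - τ) * H ≤
        4 * Real.pi ^ 2 * (1 - 1360 * (1 + 1 / τ) * (τ / 60) ^ 2) * H := by gcongr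
    linarith
  have h2 : 4 * Real.pi ^ 2 * (1 - τ) * ((1 - τ) * L / 2 * ((4 / 3 + ε) * Y / (2 * s))) <
      4 * Real.pi ^ 2 * (1 - τ) * H := by
    refine mul_lt_mul_of_pos_left hH0 ?_
    have := sub_pos.2 hτ1
    positivity
  have h3 : 4 * Real.pi ^ 2 * (1 - τ) * ((1 - τ) * L / 2 * ((4 / 3 + ε) * Y / (2 * s))) =
      Real.pi * s / 2 * ((1 - τ) ^ 2 * (4 / 3 + ε)) * (Y * L) := by
    have hps : Real.pi ^ 2 / s = Real.pi * s / 2 := by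
      rw [div_eq_iff hs0.ne']
      linear_combination (-Real.pi / 2) * hs2
    linear_combination ((1 - τ) ^ 2 * (4 / 3 + ε) * Y * L) * hps
  have h4 := h2.trans_le h1
  rw [h3] at h4
  have hYL : 0 < Y * L := by positivity
  have h5 : 0 < Real.pi * s / 2 * ((1 - τ) ^ 2 * (4 / 3 + ε) -
      (1 + τ) ^ 2 * (1 + (1 - τ) ^ 2 / 3) - 2 * τ / (Real.pi * s)) * (Y * L) := by positivity
  have h6 : Real.pi * s / 2 * ((1 - τ) ^ 2 * (4 / 3 + ε) -
      (1 + τ) ^ 2 * (1 + (1 - τ) ^ 2 / 3) - 2 * τ / (Real.pi * s)) * (Y * L) =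
      Real.pi * s / 2 * ((1 - τ) ^ 2 * (4 / 3 + ε)) * (Y * L) -
      ((1 + τ) ^ 2 * (Real.pi * s * (1 / 2 + (1 - τ) ^ 2 / 6)) * (Y * L) + τ * (Y * L)) := by
    field_simp
    ring
  linarith

/-- The lower bound for the weighted number of zeros. -/
theorem ZerosApproachLine.eventually_le_sum_zeroWeight (h : ZerosApproachLine) {ε : ℝ}
    (hε : 0 < ε) (hε1 : ε ≤ 1) :
    ∀ᶠ Y : ℝ in atTop, ∀ T : ℝ, Y / 2 ≤ T → T ≤ 3 * Y →
      (1 - ε) * Y / (2 * Real.sqrt Real.pi) ≤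
        ∑ ρ ∈ zerosBetween (Y / 4) (4 * Y), zeroWeight (Y / Real.log Y) T ρ := by
  obtain ⟨C₂, hC₂, hbad⟩ := exists_norm_tsum_sub_sum_le
  obtain ⟨C₃, hC₃, hleft⟩ := exists_integral_norm_leftWeight_le
  set s := Real.sqrt Real.pi with hs
  have hs0 : 0 < s := by positivity
  have hs2 : s * s = Real.pi := Real.mul_self_sqrt Real.pi_pos.le
  have hpi := Real.pi_pos
  have hlim : Tendsto (fun Y : ℝ => (24 + C₃) * (Real.log Y)⁻¹ + 2 * Real.pi * (C₂ + 3174) *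
      (Y ^ 5 * Real.exp (-(1 / 32 * Real.log Y ^ 2)))) atTop (𝓝 0) := by
    have := ((tendsto_inv_atTop_zero.comp Real.tendsto_log_atTop).const_mul (24 + C₃)).add
      ((tendsto_pow_mul_exp_neg_log_sq 5 (by norm_num : (0 : ℝ) < 1 / 32)).const_mul
        (2 * Real.pi * (C₂ + 3174)))
    simp only [mul_zero, add_zero] at this
    exact this
  filter_upwards [h.eventually_nearLine (by positivity : 0 < ε / 4) (by linarith),
    hlim.eventually_le_const (by positivity : 0 < s * ε / 2)] with Y hN herr T hT hT'
  have hN := hN T hT hT'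
  have hL := hN.one_le_log
  have hY := hN.one_le
  have hw := hN.width_ge
  have hE := (hleft Y T _ hN).1 0
  have hb := hbad Y T _ 0 hN le_rfl (by linarith)
  have ho := norm_gaussTest_one_le hN le_rfl (by linarith)
  have hoff : ∀ ρ ∈ zerosBetween (Y / 4) (4 * Y), ‖offLineFactor (Y / Real.log Y) T ρ‖ ≤
      1 + 2 * (ε / 4) := fun ρ hρ => hN.norm_offLineFactor_le hρ
  have hΔL : Real.log Y * (Y / Real.log Y) = Y := by field_simp
  have hΔY : Y / Real.log Y = (Real.log Y)⁻¹ * Y := by ring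
  have e32 : -(Real.log Y ^ 2 / 32) = -(1 / 32 * Real.log Y ^ 2) := by ring
  rw [e32] at hb ho
  have hβY : Y ^ 5 * Real.exp (-(1 / 32 * Real.log Y ^ 2)) ≤
      Y ^ 5 * Real.exp (-(1 / 32 * Real.log Y ^ 2)) * Y := le_mul_of_one_le_right (by positivity) hY
  generalize hβ : Y ^ 5 * Real.exp (-(1 / 32 * Real.log Y ^ 2)) = β at *
  generalize zerosBetween (Y / 4) (4 * Y) = S at *
  generalize hΔ : Y / Real.log Y = Δ at *
  have hΔ0 : 0 < Δ := by linarith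
  have hΔ16 : 16 ≤ Δ ^ 2 := by nlinarith
  have hex := two_pi_mul_tsum_gaussTest hΔ0 hΔ16 T 0 (Real.log Y)
  -- At x = 0 the truncation keeps only n = 0, 1. The first coefficient vanishes, and the second
  -- term is log Y · √π Δ = √π Y, the main term of the count.
  have hfl : ⌊Real.exp ((0 : ℝ) + 1 / 2)⌋₊ = 1 := by
    rw [Nat.floor_eq_iff (Real.exp_pos _).le]
    have h1 : Real.exp (1 / 2) ^ 2 = Real.exp 1 := by
      rw [← Real.exp_nat_mul]
      norm_num
    rw [zero_add]
    refine ⟨by simp, ?_⟩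
    norm_num at h1 ⊢
    nlinarith [Real.exp_one_lt_d9, Real.exp_pos (1 / 2)]
  have hD := norm_tsum_dirCoeff_sub_sum_le (L := Real.log Y) (T := T) hΔ16 hΔ0 (le_refl (0 : ℝ))
    le_rfl hfl
  have hg0 : gaussKer Δ T 0 = ((s * Δ : ℝ) : ℂ) := by simp [gaussKer, hs]
  have hsum2 : ∑ n ∈ Finset.range (1 + 1), (dirCoeff (Real.log Y) n : ℂ) *
      gaussKer Δ T (0 - Real.log n) = ((s * Y : ℝ) : ℂ) := by
    rw [Finset.sum_range_succ, Finset.sum_range_one, dirCoeff_zero, dirCoeff_one, Nat.cast_one,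
      Real.log_one, sub_zero, hg0, ofReal_zero, zero_mul, zero_add, ← ofReal_mul]
    congr 1
    linear_combination s * hΔL
  rw [hsum2] at hD
  have hDe : 8 * Δ * Real.exp (2 * 0 + 1 - Δ ^ 2 / 16) ≤ 24 * Δ := by
    have : Real.exp (2 * 0 + 1 - Δ ^ 2 / 16) ≤ 3 :=
      (Real.exp_le_exp.2 (by nlinarith : 2 * 0 + 1 - Δ ^ 2 / 16 ≤ 1)).trans
        (by linarith [Real.exp_one_lt_d9])
    nlinarith
  set D := ∑' n : ℕ, (dirCoeff (Real.log Y) n : ℂ) * gaussKer Δ T (0 - Real.log n)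
  set M := ∑' ρ : ℂ, (stripMult ρ : ℂ) * gaussTest Δ T 0 ρ
  set Mg := ∑ ρ ∈ S, (stripMult ρ : ℂ) * gaussTest Δ T 0 ρ with hMg
  set Eh := ∫ t : ℝ, leftWeight Δ T (Real.log Y) t * exp (((0 : ℝ) * t : ℝ) * I)
  have hMgle : ‖Mg‖ ≤ (1 + 2 * (ε / 4)) * ∑ ρ ∈ S, zeroWeight Δ T ρ := by
    rw [hMg, Finset.mul_sum]
    refine (norm_sum_le _ _).trans (Finset.sum_le_sum fun ρ hρ => ?_)
    have hz : 0 ≤ stripMult ρ * gaussWeight Δ T ρ.im := zeroWeight_nonneg Δ T ρ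
    rw [gaussTest_eq, zero_mul, zero_mul, Real.exp_zero, ofReal_one, ofReal_zero, zero_mul,
      Complex.exp_zero, mul_one, mul_one, ← mul_assoc, ← ofReal_mul, norm_mul, norm_real,
      Real.norm_of_nonneg hz, mul_comm]
    exact mul_le_mul_of_nonneg_right (hoff ρ hρ) (zeroWeight_nonneg Δ T ρ)
  have hfin : s * Y ≤ 2 * Real.pi * ‖Mg‖ + 2 * Real.pi * ‖M - Mg‖ +
      2 * Real.pi * ‖gaussTest Δ T 0 1‖ + ‖Eh‖ + ‖D - ((s * Y : ℝ) : ℂ)‖ := by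
    have e : ((s * Y : ℝ) : ℂ) = 2 * Real.pi * Mg + 2 * Real.pi * (M - Mg) -
        2 * Real.pi * gaussTest Δ T 0 1 - Eh - (D - ((s * Y : ℝ) : ℂ)) := by
      rw [neg_zero, Real.exp_zero, ofReal_one, one_mul] at hex
      linear_combination -hex
    have e2 : ∀ z : ℂ, ‖2 * Real.pi * z‖ = 2 * Real.pi * ‖z‖ := fun z => by
      rw [norm_mul, norm_mul, RCLike.norm_two, norm_real, Real.norm_of_nonneg Real.pi_pos.le]
    calc s * Y = ‖((s * Y : ℝ) : ℂ)‖ := by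
          rw [norm_real, Real.norm_of_nonneg (by positivity)]
      _ ≤ ‖2 * Real.pi * Mg‖ + ‖2 * Real.pi * (M - Mg)‖ + ‖2 * Real.pi * gaussTest Δ T 0 1‖ +
          ‖Eh‖ + ‖D - ((s * Y : ℝ) : ℂ)‖ := by
          conv_lhs => rw [e]
          exact (norm_sub_le _ _).trans (add_le_add_left ((norm_sub_le _ _).trans
            (add_le_add_left ((norm_sub_le _ _).trans (add_le_add_left (norm_add_le _ _) _)) _)) _)
      _ = _ := by rw [e2, e2, e2]
  generalize ∑ ρ ∈ S, zeroWeight Δ T ρ = W at *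
  have herrY := mul_le_mul_of_nonneg_right herr (by linarith : 0 ≤ Y)
  have h1 : s * Y ≤ 2 * Real.pi * ((1 + 2 * (ε / 4)) * W) + s * ε / 2 * Y := by
    have h2 := mul_le_mul_of_nonneg_left hb (by positivity : 0 ≤ 2 * Real.pi)
    have h3 := mul_le_mul_of_nonneg_left ho (by positivity : 0 ≤ 2 * Real.pi)
    have h4 := mul_le_mul_of_nonneg_left hMgle (by positivity : 0 ≤ 2 * Real.pi)
    have h5 := mul_le_mul_of_nonneg_left hβY (by positivity : 0 ≤ 2 * Real.pi * (C₂ + 3174))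
    have h6 : (24 + C₃) * Δ = (24 + C₃) * (Real.log Y)⁻¹ * Y := by rw [hΔY]; ring
    linarith only [hfin, h2, h3, h4, h5, h6, hE, hD.trans hDe, herrY]
  rw [div_le_iff₀ (by positivity)]
  have h2 : s * ((1 - ε / 2) * Y) ≤ s * ((1 + ε / 2) * (W * (2 * s))) := by
    have : 2 * Real.pi * ((1 + 2 * (ε / 4)) * W) = s * ((1 + ε / 2) * (W * (2 * s))) := by
      rw [← hs2]
      ring
    linarith
  have h3 := le_of_mul_le_mul_left h2 hs0
  have h4 : (1 + ε / 2) * ((1 - ε) * Y) ≤ (1 - ε / 2) * Y := by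
    nlinarith [mul_nonneg (sq_nonneg ε) (by linarith : 0 ≤ Y)]
  exact le_of_mul_le_mul_left (h4.trans h3) (by positivity)

end LocalEstimates


/-! ### Removing the Gaussian weights by integration over T. -/

section Averaging
open Complex MeasureTheory Set

theorem continuous_zeroWeight (Δ : ℝ) (ρ : ℂ) : Continuous fun T => zeroWeight Δ T ρ := by
  unfold zeroWeight gaussWeight
  fun_prop

theorem zerosBetween_subset {a b a' b' : ℝ} (ha' : 0 < a') (h : a' ≤ a) (h' : b ≤ b') :
    zerosBetween a b ⊆ zerosBetween a' b' := fun ρ hρ => by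
  rw [mem_zerosBetween (ha'.trans_le h)] at hρ
  rw [mem_zerosBetween ha']
  exact ⟨hρ.1, by linarith [hρ.2.1], by linarith [hρ.2.2]⟩

theorem integral_gaussWeight_sq {Δ : ℝ} (hΔ : 0 < Δ) (t R : ℝ) :
    ∫ T in (t - Δ * R)..(t + Δ * R), gaussWeight Δ T t ^ 2 =
      Δ * ∫ u in (-R)..R, Real.exp (-2 * u ^ 2) := by
  have h := intervalIntegral.integral_comp_div_sub (a := t - Δ * R) (b := t + Δ * R)
    (fun u => Real.exp (-2 * u ^ 2)) hΔ.ne' (t / Δ)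
  have e1 : (t - Δ * R) / Δ - t / Δ = -R := by field_simp; ring
  have e2 : (t + Δ * R) / Δ - t / Δ = R := by field_simp; ring
  rw [e1, e2, smul_eq_mul] at h
  rw [← h]
  refine intervalIntegral.integral_congr fun T _ => ?_
  simp only [gaussWeight]
  rw [sq, ← Real.exp_add]
  congr 1
  field_simp
  ring

/-- The number of pairs of zeros with equal ordinates in `(Y, 2Y]`. -/
theorem ZerosApproachLine.eventually_card_pairs_le (h : ZerosApproachLine) {ε : ℝ} (hε : 0 < ε) :
    ∀ᶠ Y : ℝ in atTop, ∑ ρ ∈ zerosBetween Y (2 * Y), ∑ ρ' ∈ zerosBetween Y (2 * Y) with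
      ρ'.im = ρ.im, stripMult ρ * stripMult ρ' ≤
      (4 / 3 + ε) * (Y * Real.log Y / (2 * Real.pi)) := by
  -- The integral of exp(-2u²), the mass of a squared Gaussian weight in units of Δ.
  set c := Real.sqrt (Real.pi / 2) with hc
  have hpi := Real.pi_pos
  have hc0 : 0 < c := by positivity
  have hcs : Real.sqrt (2 * Real.pi) = 2 * c := by
    rw [hc, show 2 * Real.pi = 2 ^ 2 * (Real.pi / 2) by ring,
      Real.sqrt_mul (by norm_num : (0 : ℝ) ≤ 2 ^ 2), Real.sqrt_sq two_pos.le]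
  have hc2 : c * c = Real.pi / 2 := Real.mul_self_sqrt (by positivity)
  obtain ⟨τ, hτf, hτ0, hτ1⟩ : ∃ τ : ℝ, 0 < (4 / 3 + ε) * (1 - τ) - (1 + 2 * τ) * (4 / 3 + τ) ∧
      0 < τ ∧ τ < 1 / 2 := by
    have hcont : Continuous (fun τ : ℝ => (4 / 3 + ε) * (1 - τ) - (1 + 2 * τ) * (4 / 3 + τ)) := by
      fun_prop
    have hcont0 : ContinuousAt (fun τ : ℝ => (4 / 3 + ε) * (1 - τ) - (1 + 2 * τ) * (4 / 3 + τ)) 0 :=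
      hcont.continuousAt
    have h1 := hcont0.eventually_const_lt (u := 0) (by norm_num; linarith)
    have h2 : ∀ᶠ τ : ℝ in 𝓝[>] 0, τ ∈ Ioo (0 : ℝ) (1 / 2) := Ioo_mem_nhdsGT (by norm_num)
    obtain ⟨τ, h3, h4⟩ := ((h1.filter_mono nhdsWithin_le_nhds).and h2).exists
    exact ⟨τ, h3, h4.1, h4.2⟩
  have hgauss : ∀ᶠ Y : ℝ in atTop, c * (1 - τ) ≤
      ∫ u in (-(τ * Real.log Y))..(τ * Real.log Y), Real.exp (-2 * u ^ 2) := by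
    have hR : Tendsto (fun Y : ℝ => τ * Real.log Y) atTop atTop :=
      Real.tendsto_log_atTop.const_mul_atTop hτ0
    have h1 := intervalIntegral_tendsto_integral (μ := volume)
      (integrable_exp_neg_mul_sq (b := 2) two_pos) (tendsto_neg_atTop_atBot.comp hR) hR
    rw [integral_gaussian, ← hc] at h1
    exact h1.eventually_const_le (by nlinarith)
  filter_upwards [h.eventually_sum_pairs_le hτ0, hgauss, eventually_ge_atTop (Real.exp 1)]
    with Y hpairs hg hYe
  have hY1 : 1 ≤ Y := (Real.one_le_exp zero_le_one).trans hYe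
  have hY0 : 0 < Y := by linarith
  have hL1 : 1 ≤ Real.log Y := by rwa [Real.le_log_iff_exp_le hY0]
  have hΔ0 : 0 < Y / Real.log Y := by positivity
  have hΔL : Y / Real.log Y * (τ * Real.log Y) = τ * Y := by field_simp
  set Δ := Y / Real.log Y with hΔ
  set S := zerosBetween (Y / 4) (4 * Y)
  set Z := zerosBetween Y (2 * Y) with hZ
  have hZS : Z ⊆ S := zerosBetween_subset (by positivity) (by linarith) (by linarith)
  have hpos : ∀ T ρ ρ', 0 ≤ zeroWeight Δ T ρ * zeroWeight Δ T ρ' := fun T ρ ρ' =>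
    mul_nonneg (zeroWeight_nonneg _ _ _) (zeroWeight_nonneg _ _ _)
  have hZsum : ∀ T ∈ Icc ((1 - τ) * Y) ((2 + τ) * Y),
      ∑ ρ ∈ Z, ∑ ρ' ∈ Z with ρ'.im = ρ.im, zeroWeight Δ T ρ * zeroWeight Δ T ρ' ≤
      (4 / 3 + τ) * Y / (2 * Real.sqrt (2 * Real.pi)) := by
    intro T hT
    refine le_trans ?_ (hpairs T (by nlinarith [hT.1]) (by nlinarith [hT.2]))
    refine (Finset.sum_le_sum fun ρ _ => ?_).trans (Finset.sum_le_sum_of_subset_of_nonneg hZS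
      fun ρ _ _ => Finset.sum_nonneg fun ρ' _ => hpos T ρ ρ')
    exact Finset.sum_le_sum_of_subset_of_nonneg (Finset.filter_subset_filter _ hZS)
      fun ρ' _ _ => hpos T ρ ρ'
  have hcont := fun ρ => continuous_zeroWeight Δ ρ
  have hle : (1 - τ) * Y ≤ (2 + τ) * Y := by nlinarith
  have hup := intervalIntegral.integral_mono_on (μ := volume) hle
    (Continuous.intervalIntegrable (by fun_prop) _ _)
    (Continuous.intervalIntegrable (by fun_prop) _ _) hZsum
  rw [intervalIntegral.integral_const, smul_eq_mul, intervalIntegral.integral_finsetSum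
    fun i _ => Continuous.intervalIntegrable (by fun_prop) _ _] at hup
  -- The range of T exceeds (Y, 2Y] by τY = Δ · τ log Y at both ends, so every pair receives all but
  -- a proportion τ of its mass Δc.
  have hlow : (∑ ρ ∈ Z, ∑ ρ' ∈ Z with ρ'.im = ρ.im, stripMult ρ * stripMult ρ') *
      (Δ * (c * (1 - τ))) ≤ ∑ ρ ∈ Z, ∫ T in ((1 - τ) * Y)..((2 + τ) * Y),
        ∑ ρ' ∈ Z with ρ'.im = ρ.im, zeroWeight Δ T ρ * zeroWeight Δ T ρ' := by
    rw [Finset.sum_mul]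
    refine Finset.sum_le_sum fun ρ hρ => ?_
    rw [intervalIntegral.integral_finsetSum
      fun i _ => Continuous.intervalIntegrable (by fun_prop) _ _, Finset.sum_mul]
    refine Finset.sum_le_sum fun ρ' hρ' => ?_
    obtain ⟨-, him⟩ := Finset.mem_filter.1 hρ'
    obtain ⟨-, h1, h2⟩ := (mem_zerosBetween hY0).1 hρ
    have e : ∀ T, zeroWeight Δ T ρ * zeroWeight Δ T ρ' =
        stripMult ρ * stripMult ρ' * gaussWeight Δ T ρ.im ^ 2 := fun T => by
      rw [zeroWeight, zeroWeight, him]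
      ring
    simp_rw [e]
    rw [intervalIntegral.integral_const_mul]
    refine mul_le_mul_of_nonneg_left ?_ (mul_nonneg (stripMult_nonneg _) (stripMult_nonneg _))
    have h3 := integral_gaussWeight_sq hΔ0 ρ.im (τ * Real.log Y)
    rw [hΔL] at h3
    calc Δ * (c * (1 - τ)) ≤ ∫ T in (ρ.im - τ * Y)..(ρ.im + τ * Y), gaussWeight Δ T ρ.im ^ 2 := by
          rw [h3]
          gcongr
      _ ≤ _ := by
          refine intervalIntegral.integral_mono_interval (by nlinarith) (by nlinarith) (by nlinarith)
            (ae_of_all _ fun T => sq_nonneg _) (Continuous.intervalIntegrable ?_ _ _)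
          unfold gaussWeight
          fun_prop
  have hfin := hlow.trans hup
  generalize ∑ ρ ∈ Z, ∑ ρ' ∈ Z with ρ'.im = ρ.im, stripMult ρ * stripMult ρ' = P at *
  rw [hcs] at hfin
  have h1 : ((2 + τ) * Y - (1 - τ) * Y) * ((4 / 3 + τ) * Y / (2 * (2 * c))) ≤
      (4 / 3 + ε) * (Y * Real.log Y / (2 * Real.pi)) * (Δ * (c * (1 - τ))) := by
    have e1 : ((2 + τ) * Y - (1 - τ) * Y) * ((4 / 3 + τ) * Y / (2 * (2 * c))) =
        (1 + 2 * τ) * (4 / 3 + τ) * (Y ^ 2 / (4 * c)) := by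
      field_simp
      ring
    have e2 : (4 / 3 + ε) * (Y * Real.log Y / (2 * Real.pi)) * (Δ * (c * (1 - τ))) =
        (4 / 3 + ε) * (1 - τ) * (Y ^ 2 / (4 * c)) := by
      have hpc : Real.pi = 2 * (c * c) := by linarith
      rw [hΔ, hpc]
      field_simp
      ring
    rw [e1, e2]
    exact mul_le_mul_of_nonneg_right (by linarith) (by positivity)
  refine le_of_mul_le_mul_right (hfin.trans h1) ?_
  have : 0 < 1 - τ := by linarith
  positivity

/-- The power of Y is immaterial: the bound is only used against exp(-τ² log²Y). -/
theorem sum_stripMult_zerosBetween_le {Y : ℝ} (hY : 1 ≤ Y) :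
    ∑ ρ ∈ zerosBetween (Y / 4) (4 * Y), stripMult ρ ≤
      289 * Y ^ 4 * ∑' ρ : ℂ, stripMult ρ * ((1 + ρ.im ^ 2) ^ 2)⁻¹ := by
  have h1 := summable_stripMult.sum_le_tsum (zerosBetween (Y / 4) (4 * Y)) fun ρ _ =>
    mul_nonneg (stripMult_nonneg ρ) (by positivity)
  refine le_trans ?_ (mul_le_mul_of_nonneg_left h1 (by positivity))
  rw [Finset.mul_sum]
  refine Finset.sum_le_sum fun ρ hρ => ?_
  obtain ⟨-, h2, h3⟩ := (mem_zerosBetween (by linarith)).1 hρ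
  have h4 : 1 + ρ.im ^ 2 ≤ 17 * Y ^ 2 := by nlinarith
  have h5 : (1 + ρ.im ^ 2) ^ 2 ≤ 289 * Y ^ 4 := by
    calc (1 + ρ.im ^ 2) ^ 2 ≤ (17 * Y ^ 2) ^ 2 := pow_le_pow_left₀ (by positivity) h4 2
      _ = _ := by ring
  have h6 : 1 ≤ 289 * Y ^ 4 * ((1 + ρ.im ^ 2) ^ 2)⁻¹ := by
    rw [← div_eq_mul_inv, one_le_div (by positivity)]
    exact h5
  calc stripMult ρ = stripMult ρ * 1 := (mul_one _).symm
    _ ≤ stripMult ρ * (289 * Y ^ 4 * ((1 + ρ.im ^ 2) ^ 2)⁻¹) :=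
      mul_le_mul_of_nonneg_left h6 (stripMult_nonneg ρ)
    _ = _ := by ring

/-- The lower bound for the number of zeros with ordinates in `(Y, 2Y]`. -/
theorem ZerosApproachLine.eventually_le_card_zeros (h : ZerosApproachLine) {ε : ℝ} (hε : 0 < ε)
    (hε1 : ε ≤ 1) :
    ∀ᶠ Y : ℝ in atTop, (1 - ε) * (Y * Real.log Y / (2 * Real.pi)) ≤
      ∑ ρ ∈ zerosBetween Y (2 * Y), stripMult ρ := by
  set K := ∑' ρ : ℂ, stripMult ρ * ((1 + ρ.im ^ 2) ^ 2)⁻¹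
  have hK : 0 ≤ K := tsum_nonneg fun ρ => mul_nonneg (stripMult_nonneg ρ) (by positivity)
  set s := Real.sqrt Real.pi with hs
  have hpi := Real.pi_pos
  have hs0 : 0 < s := by positivity
  have hs2 : s * s = Real.pi := Real.mul_self_sqrt Real.pi_pos.le
  set τ := ε / 8 with hτ
  have hτ0 : 0 < τ := by positivity
  have hlim := (tendsto_pow_mul_exp_neg_log_sq 5 (by positivity : 0 < τ ^ 2)).const_mul (289 * K)
  rw [mul_zero] at hlim
  filter_upwards [h.eventually_le_sum_zeroWeight hτ0 (by linarith),
    hlim.eventually_le_const (by positivity : 0 < τ / (2 * s)), eventually_ge_atTop (Real.exp 1)]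
    with Y hsum hsmall hYe
  have hY1 : 1 ≤ Y := (Real.one_le_exp zero_le_one).trans hYe
  have hY0 : 0 < Y := by linarith
  have hL1 : 1 ≤ Real.log Y := by rwa [Real.le_log_iff_exp_le hY0]
  have hΔ0 : 0 < Y / Real.log Y := by positivity
  have hcount := sum_stripMult_zerosBetween_le hY1
  set Δ := Y / Real.log Y with hΔ
  have hΔL : Y = Δ * Real.log Y := by rw [hΔ]; field_simp
  set S := zerosBetween (Y / 4) (4 * Y) with hS
  set Z := zerosBetween Y (2 * Y) with hZ
  have hZS : Z ⊆ S := zerosBetween_subset (by positivity) (by linarith) (by linarith)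
  have hle : (1 + τ) * Y ≤ (2 - τ) * Y := by nlinarith
  have hcont := fun ρ => continuous_zeroWeight Δ ρ
  set E := Real.exp (-(τ ^ 2 * Real.log Y ^ 2)) with hE
  -- Here T stays τY inside (Y, 2Y], so a zero outside that interval is at least τ log Y widths away
  -- and carries weight at most E.
  have hI : ∀ T ∈ Icc ((1 + τ) * Y) ((2 - τ) * Y), (1 - τ) * Y / (2 * s) ≤
      ∑ ρ ∈ Z, zeroWeight Δ T ρ + 289 * Y ^ 4 * K * E := by
    intro T hT
    refine (hsum T (by nlinarith [hT.1]) (by nlinarith [hT.2])).trans ?_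
    rw [← Finset.sum_sdiff hZS, add_comm]
    refine add_le_add le_rfl ?_
    calc ∑ ρ ∈ S \ Z, zeroWeight Δ T ρ ≤ ∑ ρ ∈ S \ Z, stripMult ρ * E := by
          refine Finset.sum_le_sum fun ρ hρ => mul_le_mul_of_nonneg_left ?_ (stripMult_nonneg ρ)
          obtain ⟨h1, h2⟩ := Finset.mem_sdiff.1 hρ
          obtain ⟨h0, h3, h4⟩ := (mem_zerosBetween (by linarith)).1 h1
          have hfar : τ * Y ≤ |ρ.im - T| := by
            by_contra! hc
            have := abs_lt.1 hc
            refine h2 ((mem_zerosBetween hY0).2 ⟨h0, ?_, ?_⟩)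
            · linarith [hT.1]
            · linarith [hT.2]
          refine Real.exp_le_exp.2 ?_
          rw [neg_div]
          refine neg_le_neg ?_
          rw [le_div_iff₀ (by positivity), ← sq_abs (ρ.im - T)]
          calc τ ^ 2 * Real.log Y ^ 2 * Δ ^ 2 = (τ * (Δ * Real.log Y)) ^ 2 := by ring
            _ = (τ * Y) ^ 2 := by rw [← hΔL]
            _ ≤ _ := pow_le_pow_left₀ (by positivity) hfar 2
      _ ≤ ∑ ρ ∈ S, stripMult ρ * E := Finset.sum_le_sum_of_subset_of_nonneg Finset.sdiff_subset
          fun ρ _ _ => mul_nonneg (stripMult_nonneg ρ) (Real.exp_pos _).le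
      _ = (∑ ρ ∈ S, stripMult ρ) * E := (Finset.sum_mul _ _ _).symm
      _ ≤ _ := mul_le_mul_of_nonneg_right hcount (Real.exp_pos _).le
  have hintg := intervalIntegral.integral_mono_on (μ := volume) hle
    (Continuous.intervalIntegrable (by fun_prop) _ _)
    (Continuous.intervalIntegrable (by fun_prop) _ _) hI
  rw [intervalIntegral.integral_const, smul_eq_mul, intervalIntegral.integral_add
    (Continuous.intervalIntegrable (by fun_prop) _ _)
    (Continuous.intervalIntegrable (by fun_prop) _ _), intervalIntegral.integral_const,
    smul_eq_mul, intervalIntegral.integral_finsetSum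
    fun i _ => Continuous.intervalIntegrable (by fun_prop) _ _] at hintg
  have hup : ∑ ρ ∈ Z, ∫ T in ((1 + τ) * Y)..((2 - τ) * Y), zeroWeight Δ T ρ ≤
      (∑ ρ ∈ Z, stripMult ρ) * (s * Δ) := by
    rw [Finset.sum_mul]
    refine Finset.sum_le_sum fun ρ _ => ?_
    simp only [zeroWeight, gaussWeight]
    rw [intervalIntegral.integral_const_mul]
    refine mul_le_mul_of_nonneg_left ?_ (stripMult_nonneg ρ)
    have h1 := integral_exp_neg_sq_div' (D := Δ ^ 2) (by positivity) ρ.im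
    rw [Real.sqrt_mul hpi.le, Real.sqrt_sq hΔ0.le, ← hs] at h1
    rw [← h1, intervalIntegral.integral_of_le hle]
    refine setIntegral_le_integral ?_ (ae_of_all _ fun T => (Real.exp_pos _).le)
    refine (integrable_exp_neg_sq_div (D := Δ ^ 2) (by positivity) ρ.im).congr
      (ae_of_all _ fun T => ?_)
    simp only
    congr 1
    ring
  generalize ∑ ρ ∈ Z, ∫ T in ((1 + τ) * Y)..((2 - τ) * Y), zeroWeight Δ T ρ = A at *
  generalize ∑ ρ ∈ Z, stripMult ρ = N at *
  have herr : ((2 - τ) * Y - (1 + τ) * Y) * (289 * Y ^ 4 * K * E) ≤ τ / (2 * s) * Y ^ 2 := by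
    have h1 : 289 * K * (Y ^ 5 * E) ≤ τ / (2 * s) * Y ^ 2 := by
      refine hsmall.trans (le_mul_of_one_le_right (by positivity) (one_le_pow₀ hY1))
    refine le_trans ?_ h1
    have e : 289 * K * (Y ^ 5 * E) = Y * (289 * Y ^ 4 * K * E) := by ring
    rw [e]
    have hEp : 0 < E := Real.exp_pos _
    refine mul_le_mul_of_nonneg_right (by nlinarith) (by positivity)
  have hN : ((1 - 2 * τ) * (1 - τ) - τ) * (Y ^ 2 / (2 * s)) ≤ N * (s * Δ) := by
    have e : ((1 - 2 * τ) * (1 - τ) - τ) * (Y ^ 2 / (2 * s)) =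
        ((2 - τ) * Y - (1 + τ) * Y) * ((1 - τ) * Y / (2 * s)) - τ / (2 * s) * Y ^ 2 := by
      field_simp
      ring
    rw [e]
    linarith
  have e : (1 - ε) * (Y * Real.log Y / (2 * Real.pi)) * (s * Δ) =
      (1 - ε) * (Y ^ 2 / (2 * s)) := by
    rw [hΔ, ← hs2]
    field_simp
  refine le_of_mul_le_mul_right ?_ (by positivity : 0 < s * Δ)
  rw [e]
  refine le_trans (mul_le_mul_of_nonneg_right ?_ (by positivity)) hN
  nlinarith

end Averaging


/-! ### From pairs of equal ordinate to simple zeros on the line. -/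

section Counting
open Complex Set

/-- The reflection of a nonreal zero of zeta in the critical line is a zero. -/
theorem riemannZeta_one_sub_conj_eq_zero {ρ : ℂ} (h0 : riemannZeta ρ = 0) (him : ρ.im ≠ 0) :
    riemannZeta (1 - (starRingEnd ℂ) ρ) = 0 := by
  have hc : riemannZeta ((starRingEnd ℂ) ρ) = 0 := by rw [riemannZeta_conj, h0, map_zero]
  have hcim : ((starRingEnd ℂ) ρ).im ≠ 0 := by simpa using him
  rw [riemannZeta_one_sub, hc, mul_zero]
  · intro n hn
    rw [hn] at hcim
    simp at hcim
  · intro hn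
    rw [hn] at hcim
    simp at hcim

/-- A zero that is multiple or off the critical line is paired with at least two zeros of the same
ordinate, counted with multiplicity. -/
theorem two_le_sum_stripMult_im_eq {a b : ℝ} (ha : 0 < a) {ρ : ℂ} (hρ : ρ ∈ zerosBetween a b)
    (h : ¬ (ρ ∈ criticalLine ∧ zetaMult ρ = 1)) :
    2 ≤ ∑ ρ' ∈ zerosBetween a b with ρ'.im = ρ.im, stripMult ρ' := by
  have hmem := (mem_zerosBetween ha).1 hρ
  have him : ρ.im ≠ 0 := (ha.trans hmem.2.1).ne'
  have hm : stripMult ρ = zetaMult ρ := stripMult_eq_of_im_ne_zero hmem.1 him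
  have hone := one_le_zetaMult hmem.1
  have hρf : ρ ∈ {ρ' ∈ zerosBetween a b | ρ'.im = ρ.im} := by simp [hρ]
  by_cases hline : ρ ∈ criticalLine
  · have h2 : 2 ≤ zetaMult ρ := by
      have : zetaMult ρ ≠ 1 := fun h1 => h ⟨hline, h1⟩
      omega
    refine le_trans ?_ (Finset.single_le_sum (fun ρ' _ => stripMult_nonneg ρ') hρf)
    rw [hm]
    exact_mod_cast h2
  · set ρ₁ := 1 - (starRingEnd ℂ) ρ with hρ₁
    have him₁ : ρ₁.im = ρ.im := by simp [hρ₁]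
    have hz₁ : riemannZeta ρ₁ = 0 := riemannZeta_one_sub_conj_eq_zero hmem.1 him
    have hm₁ : stripMult ρ₁ = zetaMult ρ₁ := stripMult_eq_of_im_ne_zero hz₁ (him₁ ▸ him)
    have hone₁ := one_le_zetaMult hz₁
    have hne : ρ ≠ ρ₁ := fun he => hline <| by
      have := congrArg re he
      simp only [hρ₁, sub_re, one_re, conj_re] at this
      change ρ.re = 1 / 2
      linarith
    have hsub : ({ρ, ρ₁} : Finset ℂ) ⊆ {ρ' ∈ zerosBetween a b | ρ'.im = ρ.im} := by
      intro z hz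
      rw [Finset.mem_insert, Finset.mem_singleton] at hz
      rcases hz with rfl | rfl
      · exact hρf
      · simp only [Finset.mem_filter, mem_zerosBetween ha]
        exact ⟨⟨hz₁, him₁ ▸ hmem.2.1, him₁ ▸ hmem.2.2⟩, him₁⟩
    refine le_trans ?_ (Finset.sum_le_sum_of_subset_of_nonneg hsub
      fun ρ' _ _ => stripMult_nonneg ρ')
    rw [Finset.sum_pair hne, hm, hm₁]
    have h1 : (1 : ℝ) ≤ zetaMult ρ := by exact_mod_cast hone
    have h2 : (1 : ℝ) ≤ zetaMult ρ₁ := by exact_mod_cast hone₁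
    linarith

theorem zetaZeroCount_eq_sum {T : ℝ} (hT : 0 < T) {S : Set ℂ} (A : Set ℂ) [DecidablePred (· ∈ A)]
    (hS : S = zetaStrip T ∩ A) :
    (zetaZeroCount S : ℝ) = ∑ ρ ∈ zerosBetween T (2 * T) with ρ ∈ A, stripMult ρ := by
  have he : S ∩ riemannZetaZeros =
      (({ρ ∈ zerosBetween T (2 * T) | ρ ∈ A} : Finset ℂ) : Set ℂ) := by
    ext ρ
    simp only [hS, zetaStrip, mem_inter_iff, mem_ofPred_eq, Finset.coe_filter, mem_zerosBetween hT]
    change (_ ∧ riemannZeta ρ = 0) ↔ _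
    tauto
  rw [zetaZeroCount, he, finsum_mem_coe_finset, Nat.cast_sum]
  refine Finset.sum_congr rfl fun ρ hρ => ?_
  have hmem := (mem_zerosBetween hT).1 (Finset.mem_filter.1 hρ).1
  exact (stripMult_eq_of_im_ne_zero hmem.1 (hT.trans hmem.2.1).ne').symm

/-- Zeros that are multiple or off the critical line contribute at least twice to the pair count. -/
theorem two_mul_zetaZeroCount_le {T : ℝ} (hT : 0 < T) :
    2 * (zetaZeroCount (zetaStrip T) : ℝ) ≤
      zetaZeroCount (zetaStrip T ∩ (criticalLine ∩ simpleZetaZeros)) +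
      ∑ ρ ∈ zerosBetween T (2 * T), ∑ ρ' ∈ zerosBetween T (2 * T) with ρ'.im = ρ.im,
        stripMult ρ * stripMult ρ' := by
  classical
  rw [zetaZeroCount_eq_sum hT univ (inter_univ _).symm, zetaZeroCount_eq_sum hT _ rfl]
  simp only [mem_univ, Finset.filter_true, Finset.sum_filter, Finset.mul_sum]
  rw [← Finset.sum_add_distrib]
  refine Finset.sum_le_sum fun ρ hρ => ?_
  have hmem := (mem_zerosBetween hT).1 hρ
  have him : ρ.im ≠ 0 := (hT.trans hmem.2.1).ne'
  have hm0 := stripMult_nonneg ρ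
  rw [← Finset.sum_filter, ← Finset.mul_sum]
  split_ifs with hg
  -- A simple zero on the line reaches 2 as 1 + 1: once in the first count and once as the pair
  -- formed with itself.
  · have hρf : ρ ∈ {ρ' ∈ zerosBetween T (2 * T) | ρ'.im = ρ.im} := by simp [hρ]
    have h1 := Finset.single_le_sum (fun ρ' _ => stripMult_nonneg ρ') hρf
    have h2 : stripMult ρ = 1 := by
      rw [stripMult_eq_of_im_ne_zero hmem.1 him, hg.2.2, Nat.cast_one]
    rw [h2] at h1 ⊢
    linarith
  · have h1 := two_le_sum_stripMult_im_eq hT hρ fun hh => hg ⟨hh.1, hmem.1, hh.2⟩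
    nlinarith

theorem zetaZeroCount_mono {T : ℝ} (hT : 0 < T) {A B : Set ℂ} (h : A ⊆ B) :
    zetaZeroCount (zetaStrip T ∩ A) ≤ zetaZeroCount (zetaStrip T ∩ B) := by
  classical
  have h1 : (zetaZeroCount (zetaStrip T ∩ A) : ℝ) ≤ zetaZeroCount (zetaStrip T ∩ B) := by
    rw [zetaZeroCount_eq_sum hT _ rfl, zetaZeroCount_eq_sum hT _ rfl]
    exact Finset.sum_le_sum_of_subset_of_nonneg
      (Finset.monotone_filter_right _ fun _ _ hz => h hz) fun ρ _ _ => stripMult_nonneg ρ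
  exact_mod_cast h1

/-- If the zeros approach the critical line, at least two thirds of them are simple and lie on
it. -/
theorem ZerosApproachLine.eventually_le_zetaZeroCount (h : ZerosApproachLine) {ε : ℝ}
    (hε : 0 < ε) : ∀ᶠ T : ℝ in atTop, (2 / 3 - ε) * (zetaZeroCount (zetaStrip T) : ℝ) ≤
      zetaZeroCount (zetaStrip T ∩ (criticalLine ∩ simpleZetaZeros)) := by
  -- With Q = T log T / 2π, the pair sum is at most (4/3 + η)Q ≤ (4/3 + ε)(1 - η)Q ≤ (4/3 + ε)N, and
  -- 2 - 4/3 = 2/3.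
  obtain ⟨η, hη0, hη1, hηε⟩ : ∃ η : ℝ, 0 < η ∧ η ≤ 1 ∧ 4 / 3 + η ≤ (4 / 3 + ε) * (1 - η) := by
    refine ⟨min (ε / (7 / 3 + ε)) 1, by positivity, min_le_right _ _, ?_⟩
    have h1 : min (ε / (7 / 3 + ε)) 1 * (7 / 3 + ε) ≤ ε := by
      rw [← le_div_iff₀ (by positivity)]
      exact min_le_left _ _
    linarith
  filter_upwards [h.eventually_card_pairs_le hη0, h.eventually_le_card_zeros hη0 hη1,
    eventually_gt_atTop 1] with T hp hn hT
  have hT0 : 0 < T := by linarith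
  have h2 := two_mul_zetaZeroCount_le hT0
  have hN : (zetaZeroCount (zetaStrip T) : ℝ) = ∑ ρ ∈ zerosBetween T (2 * T), stripMult ρ := by
    classical
    rw [zetaZeroCount_eq_sum hT0 univ (inter_univ _).symm]
    simp
  rw [← hN] at hn
  have hX : 0 ≤ T * Real.log T / (2 * Real.pi) := by
    have := Real.log_pos hT
    positivity
  have h3 := mul_le_mul_of_nonneg_right hηε hX
  have h4 := mul_le_mul_of_nonneg_left hn (by linarith : 0 ≤ 4 / 3 + ε)
  linarith

/-- The range (Y/4, 4Y] is covered by the dyadic windows (T, 2T] with T = Y/4, Y/2, Y, 2Y. In each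
of them Y ≤ 4T ≤ T², so log Y ≤ 2 log T, which matches the 2 in the half-width of the box. -/
theorem zerosApproachLine_of_thinBox {b : ℝ → ℝ} (hb : Tendsto b atTop (𝓝 0))
    (hbox : ∀ᶠ T : ℝ in atTop, ∀ ρ : ℂ, riemannZeta ρ = 0 → T < ρ.im → ρ.im ≤ 2 * T →
      ρ ∈ thinBox (b T) T) : ZerosApproachLine := by
  intro δ hδ
  have hev : ∀ᶠ T : ℝ in atTop, ∀ ρ : ℂ, riemannZeta ρ = 0 → T < ρ.im → ρ.im ≤ 2 * T →
      ∀ Y ≤ 4 * T, 1 < Y → |ρ.re - 1 / 2| * Real.log Y ≤ δ := by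
    filter_upwards [hbox, hb.eventually_lt_const hδ, eventually_ge_atTop 4] with T hT hbT hT4
      ρ h0 h1 h2 Y hY hY1
    obtain ⟨h3, h4, -⟩ := hT ρ h0 h1 h2
    have hlog : Real.log Y ≤ 2 * Real.log T := by
      rw [← Nat.cast_two, ← Real.log_pow]
      exact Real.log_le_log (by linarith) (by nlinarith)
    have hlogY : 0 < Real.log Y := Real.log_pos hY1
    have habs : |ρ.re - 1 / 2| ≤ b T / (2 * Real.log T) :=
      abs_le.2 ⟨by linarith, by linarith⟩
    calc |ρ.re - 1 / 2| * Real.log Y ≤ |ρ.re - 1 / 2| * (2 * Real.log T) :=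
          mul_le_mul_of_nonneg_left hlog (abs_nonneg _)
      _ ≤ b T := by rwa [← le_div_iff₀ (by linarith)]
      _ ≤ δ := hbT.le
  have hcomp : ∀ c : ℝ, 0 < c → ∀ᶠ Y : ℝ in atTop, ∀ ρ : ℂ, riemannZeta ρ = 0 → c * Y < ρ.im →
      ρ.im ≤ 2 * (c * Y) → ∀ Y' ≤ 4 * (c * Y), 1 < Y' → |ρ.re - 1 / 2| * Real.log Y' ≤ δ :=
    fun c hc => (tendsto_id.const_mul_atTop hc).eventually hev
  filter_upwards [hcomp (1 / 4) (by norm_num), hcomp (1 / 2) (by norm_num),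
    hcomp 1 (by norm_num), hcomp 2 (by norm_num), eventually_gt_atTop 1] with Y e1 e2 e3 e4 hY ρ hρ
  obtain ⟨h0, h1, h2⟩ := (mem_zerosBetween (by linarith)).1 hρ
  rcases le_or_gt ρ.im (Y / 2) with g1 | g1
  · exact e1 ρ h0 (by linarith) (by linarith) Y (by linarith) hY
  rcases le_or_gt ρ.im Y with g2 | g2
  · exact e2 ρ h0 (by linarith) (by linarith) Y (by linarith) hY
  rcases le_or_gt ρ.im (2 * Y) with g3 | g3
  · exact e3 ρ h0 (by linarith) (by linarith) Y (by linarith) hY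
  · exact e4 ρ h0 (by linarith) (by linarith) Y (by linarith) hY

/-- A family of asymptotic lower bounds with loss `ε` amounts to one with loss `o(1)`. -/
theorem exists_tendsto_zero_of_eventually_le {c : ℝ} {M N : ℝ → ℝ} (hN : ∀ T, 0 ≤ N T)
    (hM : ∀ T, 0 ≤ M T) (h : ∀ ε > 0, ∀ᶠ T : ℝ in atTop, (c - ε) * N T ≤ M T) :
    ∃ ε : ℝ → ℝ, Tendsto ε atTop (𝓝 0) ∧ ∀ T, M T ≥ (c + ε T) * N T := by
  -- Capping at 0 is needed because M/N may stay above c; only the deficit has to tend to 0.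
  refine ⟨fun T => if N T = 0 then 0 else min 0 (M T / N T - c), ?_, fun T => ?_⟩
  · rw [Metric.tendsto_nhds]
    intro η hη
    filter_upwards [h (η / 2) (by positivity)] with T hT
    rw [dist_zero_right, Real.norm_eq_abs]
    split_ifs with h0
    · simpa using hη
    · have hpos : 0 < N T := lt_of_le_of_ne (hN T) (Ne.symm h0)
      have h1 : c - η / 2 ≤ M T / N T := (le_div_iff₀ hpos).2 hT
      rw [abs_of_nonpos (min_le_left _ _), neg_lt, lt_min_iff]
      constructor <;> linarith
  · by_cases h0 : N T = 0
    · simp [h0, hM T]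
    · have hpos : 0 < N T := lt_of_le_of_ne (hN T) (Ne.symm h0)
      have h1 : c + min 0 (M T / N T - c) ≤ M T / N T := by
        linarith [min_le_right 0 (M T / N T - c)]
      simpa [h0] using (le_div_iff₀ hpos).1 h1

theorem zetaZeroCount_thinBox_inter {b T : ℝ} (A : Set ℂ)
    (h : ∀ ρ : ℂ, riemannZeta ρ = 0 → T < ρ.im → ρ.im ≤ 2 * T → ρ ∈ thinBox b T) :
    zetaZeroCount (thinBox b T ∩ A) = zetaZeroCount (zetaStrip T ∩ A) := by
  have he : thinBox b T ∩ A ∩ riemannZetaZeros = zetaStrip T ∩ A ∩ riemannZetaZeros := by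
    ext ρ
    constructor
    · exact fun hρ => ⟨⟨thinBox_subset_zetaStrip _ _ hρ.1.1, hρ.1.2⟩, hρ.2⟩
    · exact fun hρ => ⟨⟨h ρ hρ.2 hρ.1.1.1 hρ.1.1.2, hρ.1.2⟩, hρ.2⟩
  rw [zetaZeroCount, he, zetaZeroCount]

/-- One bound for the zeros that are both simple and on the line serves all three conclusions: the
simple zeros and the zeros on the line are larger sets, and 1/3 is a weaker constant. -/
theorem ZerosApproachLine.exists_zetaZeroCount_ge (h : ZerosApproachLine) {c : ℝ} (hc : c ≤ 2 / 3)
    {A : Set ℂ} (hA : criticalLine ∩ simpleZetaZeros ⊆ A) :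
    ∃ ε : ℝ → ℝ, Tendsto ε atTop (𝓝 0) ∧ ∀ T, (zetaZeroCount (zetaStrip T ∩ A) : ℝ) ≥
      (c + ε T) * (zetaZeroCount (zetaStrip T) : ℝ) := by
  refine exists_tendsto_zero_of_eventually_le (fun T => Nat.cast_nonneg _)
    (fun T => Nat.cast_nonneg _) fun ε hε => ?_
  filter_upwards [h.eventually_le_zetaZeroCount hε, eventually_gt_atTop 0] with T hT hT0
  calc (c - ε) * (zetaZeroCount (zetaStrip T) : ℝ)
      ≤ (2 / 3 - ε) * (zetaZeroCount (zetaStrip T) : ℝ) :=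
        mul_le_mul_of_nonneg_right (by linarith) (Nat.cast_nonneg _)
    _ ≤ _ := hT
    _ ≤ _ := by exact_mod_cast zetaZeroCount_mono hT0 hA

end Counting

theorem theorem1 (b : ℝ → ℝ) (hb : Tendsto b atTop (𝓝 0))
    (hbox : ∀ᶠ T : ℝ in atTop, ∀ ρ : ℂ, riemannZeta ρ = 0 → T < ρ.im → ρ.im ≤ 2 * T →
      ρ ∈ thinBox (b T) T) :
    (∀ᶠ T : ℝ in atTop, zetaZeroCount (zetaStrip T) = zetaZeroCount (thinBox (b T) T)) ∧
    (∃ ε : ℝ → ℝ, Tendsto ε atTop (𝓝 0) ∧ ∀ᶠ T : ℝ in atTop,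
      zetaZeroCount (thinBox (b T) T ∩ simpleZetaZeros) =
        zetaZeroCount (zetaStrip T ∩ simpleZetaZeros) ∧
      (zetaZeroCount (zetaStrip T ∩ simpleZetaZeros) : ℝ) ≥
        (2 / 3 + ε T) * (zetaZeroCount (zetaStrip T) : ℝ)) ∧
    (∃ ε : ℝ → ℝ, Tendsto ε atTop (𝓝 0) ∧ ∀ᶠ T : ℝ in atTop,
      zetaZeroCount (thinBox (b T) T ∩ criticalLine) =
        zetaZeroCount (zetaStrip T ∩ criticalLine) ∧
      (zetaZeroCount (zetaStrip T ∩ criticalLine) : ℝ) ≥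
        (2 / 3 + ε T) * (zetaZeroCount (zetaStrip T) : ℝ)) ∧
    (∃ ε : ℝ → ℝ, Tendsto ε atTop (𝓝 0) ∧ ∀ᶠ T : ℝ in atTop,
      zetaZeroCount (thinBox (b T) T ∩ (criticalLine ∩ simpleZetaZeros)) =
        zetaZeroCount (zetaStrip T ∩ (criticalLine ∩ simpleZetaZeros)) ∧
      (zetaZeroCount (zetaStrip T ∩ (criticalLine ∩ simpleZetaZeros)) : ℝ) ≥
        (1 / 3 + ε T) * (zetaZeroCount (zetaStrip T) : ℝ)) := by
  have h := zerosApproachLine_of_thinBox hb hbox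
  refine ⟨?_, ?_, ?_, ?_⟩
  · filter_upwards [hbox] with T hT
    simpa using (zetaZeroCount_thinBox_inter Set.univ hT).symm
  · obtain ⟨ε, hε, hge⟩ := h.exists_zetaZeroCount_ge le_rfl Set.inter_subset_right
    exact ⟨ε, hε, hbox.mono fun T hT => ⟨zetaZeroCount_thinBox_inter _ hT, hge T⟩⟩
  · obtain ⟨ε, hε, hge⟩ := h.exists_zetaZeroCount_ge le_rfl Set.inter_subset_left
    exact ⟨ε, hε, hbox.mono fun T hT => ⟨zetaZeroCount_thinBox_inter _ hT, hge T⟩⟩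
  · obtain ⟨ε, hε, hge⟩ := h.exists_zetaZeroCount_ge (c := 1 / 3) (by norm_num) subset_rfl
    exact ⟨ε, hε, hbox.mono fun T hT => ⟨zetaZeroCount_thinBox_inter _ hT, hge T⟩⟩
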